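/- Let $(M,\tau)$ be a finite von Neumann algebra, i.e. a von Neumann algebra $M\subset B(\mathcal H)$ with a faithful normal tracial state $\tau$, and write $\|x\|_2=\tau(x^*x)^{1/2}$. Suppose that $M$ is diffuse (it has no minimal projections) and amenable (there is a state $\Phi$ on $B(\mathcal H)$ with $\Phi|_M=\tau$ and $\Phi(uTu^*)=\Phi(T)$ for all $T\in B(\mathcal H)$ and all unitaries $u\in M$). Let $N\subset M$ be a von Neumann subalgebra (with the same unit), and let $E_N:M\to N$ be the $\tau$-preserving conditional expectation. Then the following are equivalent. (1) $M\not\prec_M N$. Here $M\prec_M N$ means that there exist nonzero projections $p\in M$ and $q\in N$, a unital $*$-homomorphism $\Psi:pMp\to qNq$, and a partial isometry $v\in M$ such that $vv^*\in (pMp)'\cap pMp$, $v^*v\in \Psi(pMp)'\cap qMq$, $xv=v\Psi(x)$ for all $x\in pMp$, and, for $x\in pMp$, $xv=0$ only if $x=0$. (2) $[pMp:Np]=\infty$ for every nonzero projection $p\in N'\cap M$. Here the Pimsner–Popa index of an inclusion $B\subset A$ is $[A:B]=\lambda(A,B)^{-1}$ with $\lambda(A,B)=\max\{\lambda\ge 0: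 E_B(x)\ge\lambda x \text{ for all } x\in A,\ x\ge 0\}$ (and $0^{-1}=\infty$), where $E_B$ is the trace-preserving conditional expectation of $A$ onto $B$, with respect to the restriction of $\tau$ to $A=pMp$. (3) There is a sequence of unitaries $u_n\in M$ such that $\|E_N(u_nx)\|_2\to 0$ for every $x\in M$. -/

import Mathlib

open Filter Topology
open scoped ComplexOrder InnerProductSpace NNReal ENNReal

namespace FiniteVN

noncomputable section

/-- A faithful normal tracial state on a von Neumann algebra `M ⊆ B(H)`; a finite von Neumann
algebra is a pair `(M, τ)` with such a `τ`.  Normality is σ-weak continuity: `τ` is given by two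
square-summable sequences of vectors of `H`. -/
structure IsTrace {H : Type*} [NormedAddCommGroup H] [InnerProductSpace ℂ H] [CompleteSpace H]
    (M : VonNeumannAlgebra H) (τ : M.toStarSubalgebra →ₗ[ℂ] ℂ) : Prop where
  map_one : τ 1 = 1
  nonneg : ∀ x, 0 ≤ τ (star x * x)
  tracial : ∀ x y, τ (x * y) = τ (y * x)
  faithful : ∀ x, τ (star x * x) = 0 → x = 0
  normal : ∃ ξ η : ℕ → H, (Summable fun n => ‖ξ n‖ ^ 2) ∧ (Summable fun n => ‖η n‖ ^ 2) ∧
    ∀ x : M.toStarSubalgebra, HasSum (fun n => ⟪η n, (x : H →L[ℂ] H) (ξ n)⟫_ℂ) (τ x)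

/-- `M` is diffuse: it has no minimal projection, i.e. no projection `p ≠ 0` in `M` satisfies
`pMp = ℂp`. -/
def IsDiffuse {H : Type*} [NormedAddCommGroup H] [InnerProductSpace ℂ H] [CompleteSpace H]
    (M : VonNeumannAlgebra H) : Prop :=
  ∀ p ∈ M, IsStarProjection p → p ≠ 0 → ¬ ∀ x ∈ M, ∃ c : ℂ, p * x * p = c • p

/-- `(M, τ)` is amenable: there is a state `Φ` on `B(H)` (a hypertrace), invariant under
conjugation by the unitaries of `M`, which restricts to `τ` on `M`. -/
def IsAmenable {H : Type*} [NormedAddCommGroup H] [InnerProductSpace ℂ H] [CompleteSpace H]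
    (M : VonNeumannAlgebra H) (τ : M.toStarSubalgebra →ₗ[ℂ] ℂ) : Prop :=
  ∃ Φ : (H →L[ℂ] H) →ₗ[ℂ] ℂ, Φ 1 = 1 ∧ (∀ T : H →L[ℂ] H, T.IsPositive → 0 ≤ Φ T) ∧
    (∀ u ∈ M, u ∈ unitary (H →L[ℂ] H) → ∀ T, Φ (u * T * star u) = Φ T) ∧
    ∀ x : M.toStarSubalgebra, Φ x = τ x

/-- The corner `pPp`, for a projection `p` (used for `p ∈ P`), as a *-subalgebra of `B(H)` whose
unit is `p`. -/
def corner {H : Type*} [NormedAddCommGroup H] [InnerProductSpace ℂ H] [CompleteSpace H]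
    (P : VonNeumannAlgebra H) {p : H →L[ℂ] H} (hp : IsStarProjection p) :
    NonUnitalStarSubalgebra ℂ (H →L[ℂ] H) where
  carrier := {x | x ∈ P ∧ p * x = x ∧ x * p = x}
  add_mem' := by
    rintro a b ⟨ha, ha1, ha2⟩ ⟨hb, hb1, hb2⟩
    exact ⟨add_mem ha hb, by rw [mul_add, ha1, hb1], by rw [add_mul, ha2, hb2]⟩
  zero_mem' := ⟨zero_mem _, mul_zero _, zero_mul _⟩
  mul_mem' := by
    rintro a b ⟨ha, ha1, ha2⟩ ⟨hb, hb1, hb2⟩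
    exact ⟨mul_mem ha hb, by rw [← mul_assoc, ha1], by rw [mul_assoc, hb2]⟩
  smul_mem' := by
    rintro c a ⟨ha, ha1, ha2⟩
    exact ⟨P.toStarSubalgebra.smul_mem ha c, by rw [mul_smul_comm, ha1],
      by rw [smul_mul_assoc, ha2]⟩
  star_mem' := by
    rintro a ⟨ha, ha1, ha2⟩
    have hs : star p = p := hp.isSelfAdjoint
    refine ⟨star_mem ha, ?_, ?_⟩
    · have h := congrArg star ha2
      rwa [star_mul, hs] at h
    · have h := congrArg star ha1
      rwa [star_mul, hs] at h

theorem self_mem_corner {H : Type*} [NormedAddCommGroup H] [InnerProductSpace ℂ H]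
    [CompleteSpace H] (P : VonNeumannAlgebra H) {p : H →L[ℂ] H} (hp : IsStarProjection p)
    (h : p ∈ P) : p ∈ corner P hp :=
  ⟨h, hp.isIdempotentElem, hp.isIdempotentElem⟩

/-- `P ≺_M Q`: a corner of `P` embeds into `Q` inside `M`. -/
def CornerEmbeds {H : Type*} [NormedAddCommGroup H] [InnerProductSpace ℂ H] [CompleteSpace H]
    (M P Q : VonNeumannAlgebra H) : Prop :=
  ∃ (p q : H →L[ℂ] H) (hp : IsStarProjection p) (hq : IsStarProjection q)
    (hpP : p ∈ P) (_ : q ∈ Q), p ≠ 0 ∧ q ≠ 0 ∧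
    ∃ (Ψ : corner P hp →⋆ₙₐ[ℂ] corner Q hq) (v : H →L[ℂ] H),
      (Ψ ⟨p, self_mem_corner P hp hpP⟩ : H →L[ℂ] H) = q ∧
      v ∈ M ∧ v * star v * v = v ∧
      (v * star v ∈ corner M hp ∧ ∀ x : corner P hp, Commute (v * star v) (x : H →L[ℂ] H)) ∧
      (star v * v ∈ corner M hq ∧ ∀ x : corner P hp, Commute (star v * v) (Ψ x : H →L[ℂ] H)) ∧
      (∀ x : corner P hp, (x : H →L[ℂ] H) * v = v * (Ψ x : H →L[ℂ] H)) ∧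
      ∀ x : corner P hp, (x : H →L[ℂ] H) * v = 0 → x = 0

/-- The norm `‖x‖₂ = τ(x* x)^{1/2}`. -/
def norm2 {H : Type*} [NormedAddCommGroup H] [InnerProductSpace ℂ H] [CompleteSpace H]
    {M : VonNeumannAlgebra H} (τ : M.toStarSubalgebra →ₗ[ℂ] ℂ) (x : M.toStarSubalgebra) : ℝ :=
  Real.sqrt (τ (star x * x)).re

/-- `y = E_B(x)`, for the `τ`-preserving conditional expectation `E_B` onto a subalgebra `B`:
`y ∈ B` and `τ(yz) = τ(xz)` for all `z ∈ B`. -/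
def IsCondExp {H : Type*} [NormedAddCommGroup H] [InnerProductSpace ℂ H] [CompleteSpace H]
    {M : VonNeumannAlgebra H} (τ : M.toStarSubalgebra →ₗ[ℂ] ℂ) (B : Set M.toStarSubalgebra)
    (x y : M.toStarSubalgebra) : Prop :=
  y ∈ B ∧ ∀ z ∈ B, τ (y * z) = τ (x * z)

/-- The `τ`-preserving conditional expectation `E_B`, as the map given by the unique `y ∈ B` with
`τ(yz) = τ(xz)` for all `z ∈ B`. -/
def condExp {H : Type*} [NormedAddCommGroup H] [InnerProductSpace ℂ H] [CompleteSpace H]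
    {M : VonNeumannAlgebra H} (τ : M.toStarSubalgebra →ₗ[ℂ] ℂ) (B : Set M.toStarSubalgebra)
    (x : M.toStarSubalgebra) : M.toStarSubalgebra :=
  Classical.epsilon (IsCondExp τ B x)

/-- The element that defines `E_B(x)` is unique. -/
theorem IsCondExp.condExp_eq {H : Type*} [NormedAddCommGroup H] [InnerProductSpace ℂ H]
    [CompleteSpace H] {M : VonNeumannAlgebra H} {τ : M.toStarSubalgebra →ₗ[ℂ] ℂ}
    (hτ : IsTrace M τ) {B : Set M.toStarSubalgebra}
    (hsub : ∀ a ∈ B, ∀ b ∈ B, a - b ∈ B) (hstar : ∀ a ∈ B, star a ∈ B)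
    {x y : M.toStarSubalgebra} (h : IsCondExp τ B x y) : condExp τ B x = y := by
  have h' : IsCondExp τ B x (condExp τ B x) := Classical.epsilon_spec (p := IsCondExp τ B x) ⟨y, h⟩
  have hd := hsub _ h'.1 _ h.1
  have h0 : τ (star (condExp τ B x - y) * (condExp τ B x - y)) = 0 := by
    rw [hτ.tracial, sub_mul, map_sub, h'.2 _ (hstar _ hd), h.2 _ (hstar _ hd), sub_self]
  exact sub_eq_zero.1 (hτ.faithful _ h0)

/-- The subalgebra `N ⊆ M`, as a set of elements of `M`. -/
def subalg {H : Type*} [NormedAddCommGroup H] [InnerProductSpace ℂ H] [CompleteSpace H]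
    (M N : VonNeumannAlgebra H) : Set M.toStarSubalgebra :=
  {x | (x : H →L[ℂ] H) ∈ N}

/-- The reduced algebra `pMp`, as a set of elements of `M`. -/
def reduced {H : Type*} [NormedAddCommGroup H] [InnerProductSpace ℂ H] [CompleteSpace H]
    (M : VonNeumannAlgebra H) (p : M.toStarSubalgebra) : Set M.toStarSubalgebra :=
  {x | ∃ y, x = p * y * p}

/-- The algebra `Np` (used for projections `p ∈ N' ∩ M`), as a set of elements of `M`. -/
def induced {H : Type*} [NormedAddCommGroup H] [InnerProductSpace ℂ H] [CompleteSpace H]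
    (M N : VonNeumannAlgebra H) (p : M.toStarSubalgebra) : Set M.toStarSubalgebra :=
  {x | ∃ y ∈ subalg M N, x = y * p}

/-- The constant `λ(A, B)`: the largest `c ≥ 0` with `E_B(x) ≥ c x` for all positive `x ∈ A`. -/
def ppConst {H : Type*} [NormedAddCommGroup H] [InnerProductSpace ℂ H] [CompleteSpace H]
    {M : VonNeumannAlgebra H} (τ : M.toStarSubalgebra →ₗ[ℂ] ℂ) (A B : Set M.toStarSubalgebra) :
    ℝ≥0∞ :=
  sSup {l | ∃ c : ℝ≥0, l = (c : ℝ≥0∞) ∧ ∀ x ∈ A, (x : H →L[ℂ] H).IsPositive →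
    ((condExp τ B x : H →L[ℂ] H) - ((c : ℝ) : ℂ) • (x : H →L[ℂ] H)).IsPositive}

/-- The Pimsner-Popa index `[A : B] = λ(A, B)⁻¹`, which is `∞` when `λ(A, B) = 0`. -/
def ppIndex {H : Type*} [NormedAddCommGroup H] [InnerProductSpace ℂ H] [CompleteSpace H]
    {M : VonNeumannAlgebra H} (τ : M.toStarSubalgebra →ₗ[ℂ] ℂ) (A B : Set M.toStarSubalgebra) :
    ℝ≥0∞ :=
  (ppConst τ A B)⁻¹

end

end FiniteVN

set_option linter.unusedSectionVars false

/-! The proof runs 3 → 1 → 2 → 3 inside a C*-algebra `A` with a faithful tracial state whose balls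
are compact for the functionals τ(· z). All weak limits are taken along one fixed ultrafilter, so no
separability is needed and L² is never formed. The operators x e_N x* of Jones' basic construction
appear as the maps a ↦ x E(x* a) of `A` (`rankOne`). Their averages over a unitary group are
minimised in the 2-norm of the canonical trace of the basic construction, and the minimiser is
invariant under the group (`exists_average`).

2 → 3, by contraposition. If no sequence exists, then by `exists_seq` some finite set and some ε
obstruct every unitary. The average of u e_N u* over all unitaries commutes with left
multiplication, so it is right multiplication by some f in N' ∩ A. The obstruction makes f nonzero,
and (af)*(af) ≤ E(a*a). On a spectral projection p of f where f is bounded below this becomes a*a ≤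
K E(a*a) for a in Ap (`exists_finiteIndex`), which amounts to finite index up to shrinking p
(`exists_finiteIndex_iff`).

1 → 2, by contraposition. On a corner where the best constant K is nearly attained by a vector g,
one has xg ≈ g E(g* x g) uniformly on the unit ball of the corner (`exists_almost_intertwiner`).
Hence g e_N g* almost commutes with the corner and is almost idempotent. Averaging it and passing to
a nearby idempotent gives a bounded idempotent that commutes exactly with the corner and with the
right action of N, and whose range is ζN (`exists_idempotent`). The inequality with K and the
boundedness of the coefficient in ζN force a spectral gap at 0 for E(ζ*ζ). So ζ can be normalised to
ξ with E(ξ*ξ) a projection, and Ψ(x) = E(ξ* x ξ) is then a homomorphism with xξ = ξΨ(x)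
(`exists_intertwiner`).

3 → 1. An intertwiner v makes θ = v e_N v* linear over eAe. Spreading e over its unitary orbit
produces a central c and an f with cθ(m) = e m f for all m. Unitaries leaving N force cf = 0, hence
cθ(v) = 0; the support of c dominates e, so θ(v) = 0 and v = 0 (`not_tendsto_of_intertwiner`). -/

namespace FiniteVN

/-! ### Tracial C*-algebras with weakly compact balls. -/

section

variable {A : Type*} [CStarAlgebra A]

/-- Bounded sequences in `S` have a limit in `S`, along the hyperfilter and in the topology of
the functionals `τ(· z)`. -/
def WeakCompact (τ : A →ₗ[ℂ] ℂ) (S : Set A) : Prop :=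
  ∀ (x : ℕ → A) (C : ℝ), (∀ n, x n ∈ S) → (∀ n, ‖x n‖ ≤ C) →
    ∃ y ∈ S, ‖y‖ ≤ C ∧
      ∀ z, Tendsto (fun n => τ (x n * z)) (hyperfilter ℕ : Filter ℕ) (𝓝 (τ (y * z)))

/-- A faithful tracial state on a C*-algebra whose balls are compact for the topology of the
functionals `τ(· z)`. -/
structure IsWStarTrace (τ : A →ₗ[ℂ] ℂ) : Prop where
  map_one : τ 1 = 1
  nonneg : ∀ x, 0 ≤ τ (star x * x)
  tracial : ∀ x y, τ (x * y) = τ (y * x)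
  faithful : ∀ x, τ (star x * x) = 0 → x = 0
  compact : WeakCompact τ Set.univ

/-- The norm `τ(x* x)^{1/2}`. -/
noncomputable def l2norm (τ : A →ₗ[ℂ] ℂ) (x : A) : ℝ := Real.sqrt (τ (star x * x)).re

/-- `y` is the limit of `x` along the hyperfilter, in the topology of the functionals `τ(· z)`. -/
def WLim (τ : A →ₗ[ℂ] ℂ) (x : ℕ → A) (y : A) : Prop :=
  ∀ z, Tendsto (fun n => τ (x n * z)) (hyperfilter ℕ : Filter ℕ) (𝓝 (τ (y * z)))

namespace IsWStarTrace

variable {τ : A →ₗ[ℂ] ℂ} (hτ : IsWStarTrace τ)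
include hτ

theorem re_nonneg (x : A) : 0 ≤ (τ (star x * x)).re := (Complex.le_def.1 (hτ.nonneg x)).1

theorem im_eq_zero (x : A) : (τ (star x * x)).im = 0 := ((Complex.le_def.1 (hτ.nonneg x)).2).symm

theorem eq_zero_of_re {x : A} (h : (τ (star x * x)).re = 0) : x = 0 :=
  hτ.faithful x (Complex.ext h (hτ.im_eq_zero x))

theorem map_star_mul (x y : A) : τ (star y * x) = star (τ (star x * y)) := by
  -- Polarisation: τ(z*z) is real at z = x + y and at z = x + iy, which gives the imaginary and the
  -- real part of the identity.
  have h1 := hτ.im_eq_zero (x + y)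
  have h2 := hτ.im_eq_zero (x + Complex.I • y)
  have hx := hτ.im_eq_zero x
  have hy := hτ.im_eq_zero y
  simp only [star_add, star_smul, mul_add, add_mul, map_add, smul_mul_assoc, mul_smul_comm,
    map_smul, Complex.add_im, smul_eq_mul, Complex.star_def, Complex.conj_I, Complex.mul_im,
    Complex.neg_re, Complex.neg_im, Complex.I_re, Complex.I_im, Complex.mul_re] at h1 h2
  apply Complex.ext
  · simp only [Complex.star_def, Complex.conj_re]; linarith
  · simp only [Complex.star_def, Complex.conj_im]; linarith

theorem map_star (x : A) : τ (star x) = star (τ x) := by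
  simpa using hτ.map_star_mul 1 x

/-- The pre-inner product `τ(x* y)`. -/
@[reducible]
noncomputable def core : PreInnerProductSpace.Core ℂ A where
  inner x y := τ (star x * y)
  conj_inner_symm x y := by
    change star (τ (star y * x)) = _
    rw [hτ.map_star_mul x y, star_star]
  re_inner_nonneg x := hτ.re_nonneg x
  add_left x y z := by simp [add_mul]
  smul_left x y r := by simp

theorem l2_nonneg (x : A) : 0 ≤ l2norm τ x := Real.sqrt_nonneg _

theorem l2_sq (x : A) : l2norm τ x ^ 2 = (τ (star x * x)).re := Real.sq_sqrt (hτ.re_nonneg x)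

theorem l2_sq_ofReal (x : A) : τ (star x * x) = ((l2norm τ x ^ 2 : ℝ) : ℂ) := by
  rw [hτ.l2_sq]
  exact Complex.ext rfl (hτ.im_eq_zero x)

theorem norm_map_star_mul_le (x y : A) : ‖τ (star x * y)‖ ≤ l2norm τ x * l2norm τ y := by
  have h := @InnerProductSpace.Core.inner_mul_inner_self_le ℂ A _ _ _ hτ.core x y
  change ‖τ (star x * y)‖ * ‖τ (star y * x)‖ ≤ (τ (star x * x)).re * (τ (star y * y)).re at h
  rw [hτ.map_star_mul x y, norm_star, ← hτ.l2_sq, ← hτ.l2_sq] at h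
  refine abs_le_of_sq_le_sq' ?_ (mul_nonneg (hτ.l2_nonneg _) (hτ.l2_nonneg _)) |>.2
  nlinarith

theorem l2_star (x : A) : l2norm τ (star x) = l2norm τ x := by
  rw [l2norm, l2norm, star_star, hτ.tracial]

theorem norm_map_mul_le (x y : A) : ‖τ (x * y)‖ ≤ l2norm τ x * l2norm τ y := by
  simpa [hτ.l2_star] using hτ.norm_map_star_mul_le (star x) y

theorem l2_one : l2norm τ 1 = 1 := by simp [l2norm, hτ.map_one]

theorem l2_zero : l2norm τ 0 = 0 := by simp [l2norm]

theorem l2_eq_zero {x : A} (h : l2norm τ x = 0) : x = 0 :=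
  hτ.eq_zero_of_re (by rw [← hτ.l2_sq, h]; simp)

theorem l2_add_sq (x y : A) :
    l2norm τ (x + y) ^ 2 = l2norm τ x ^ 2 + 2 * (τ (star x * y)).re + l2norm τ y ^ 2 := by
  have h := congrArg Complex.re (hτ.map_star_mul x y)
  simp only [Complex.star_def, Complex.conj_re] at h
  simp only [hτ.l2_sq, star_add, mul_add, add_mul, map_add, Complex.add_re, h]
  ring

theorem l2_neg (x : A) : l2norm τ (-x) = l2norm τ x := by simp [l2norm]

theorem l2_sub_sq (x y : A) :
    l2norm τ (x - y) ^ 2 = l2norm τ x ^ 2 - 2 * (τ (star x * y)).re + l2norm τ y ^ 2 := by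
  rw [sub_eq_add_neg, hτ.l2_add_sq, hτ.l2_neg]
  simp; ring

theorem l2_add_le (x y : A) : l2norm τ (x + y) ≤ l2norm τ x + l2norm τ y := by
  refine abs_le_of_sq_le_sq' ?_ (add_nonneg (hτ.l2_nonneg _) (hτ.l2_nonneg _)) |>.2
  have := (Complex.re_le_norm _).trans (hτ.norm_map_star_mul_le x y)
  rw [hτ.l2_add_sq]; nlinarith

theorem l2_smul (c : ℂ) (x : A) : l2norm τ (c • x) = ‖c‖ * l2norm τ x := by
  have h : l2norm τ (c • x) ^ 2 = (‖c‖ * l2norm τ x) ^ 2 := by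
    rw [mul_pow, hτ.l2_sq, hτ.l2_sq, star_smul, smul_mul_smul_comm, map_smul, smul_eq_mul,
      Complex.star_def, Complex.conj_mul', ← Complex.ofReal_pow, Complex.re_ofReal_mul]
  exact (pow_left_inj₀ (hτ.l2_nonneg _) (mul_nonneg (norm_nonneg _) (hτ.l2_nonneg _))
    two_ne_zero).1 h

theorem ext {x y : A} (h : ∀ z, τ (x * z) = τ (y * z)) : x = y := by
  refine sub_eq_zero.1 (hτ.faithful _ ?_)
  rw [hτ.tracial, sub_mul, map_sub, h, sub_self]

theorem wlim_unique {x : ℕ → A} {y z : A} (hy : WLim τ x y) (hz : WLim τ x z) : y = z :=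
  hτ.ext fun w => tendsto_nhds_unique (hy w) (hz w)

theorem exists_wlim {x : ℕ → A} {C : ℝ} (h : ∀ n, ‖x n‖ ≤ C) : ∃ y, WLim τ x y ∧ ‖y‖ ≤ C := by
  obtain ⟨y, -, h1, h2⟩ := hτ.compact x C (fun _ => Set.mem_univ _) h
  exact ⟨y, h2, h1⟩

theorem wlim_norm_le {x : ℕ → A} {y : A} {C : ℝ} (h : WLim τ x y) (hC : ∀ n, ‖x n‖ ≤ C) :
    ‖y‖ ≤ C := by
  obtain ⟨z, h1, h2⟩ := hτ.exists_wlim hC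
  rwa [hτ.wlim_unique h h1]

theorem wlim_mul_left {x : ℕ → A} {y : A} (h : WLim τ x y) (a : A) :
    WLim τ (fun n => a * x n) (a * y) := fun z => by
  simp only [mul_assoc]
  simp only [hτ.tracial a]
  simpa [mul_assoc] using h (z * a)

theorem wlim_star {x : ℕ → A} {y : A} (h : WLim τ x y) :
    WLim τ (fun n => star (x n)) (star y) := fun z => by
  have key : ∀ a : A, τ (star a * z) = star (τ (a * star z)) := fun a => by
    rw [← hτ.map_star, star_mul, star_star, hτ.tracial]
  simp only [key]
  exact (h (star z)).star

omit hτ in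
theorem _root_.FiniteVN.WLim.mul_right {x : ℕ → A} {y : A} (h : WLim τ x y) (a : A) :
    WLim τ (fun n => x n * a) (y * a) := fun z => by
  simpa only [mul_assoc] using h (a * z)

omit hτ in
theorem _root_.FiniteVN.WLim.add {x x' : ℕ → A} {y y' : A} (h : WLim τ x y) (h' : WLim τ x' y') :
    WLim τ (fun n => x n + x' n) (y + y') := fun z => by
  simpa only [add_mul, map_add] using (h z).add (h' z)

omit hτ in
theorem _root_.FiniteVN.WLim.smul {x : ℕ → A} {y : A} (h : WLim τ x y) (c : ℂ) :
    WLim τ (fun n => c • x n) (c • y) := fun z => by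
  simpa only [smul_mul_assoc, map_smul] using (h z).const_smul c

omit hτ in
theorem _root_.FiniteVN.WLim.const (y : A) : WLim τ (fun _ => y) y := fun _ => tendsto_const_nhds

omit hτ in
theorem _root_.FiniteVN.WLim.sub {x x' : ℕ → A} {y y' : A} (h : WLim τ x y) (h' : WLim τ x' y') :
    WLim τ (fun n => x n - x' n) (y - y') := fun z => by
  simpa only [sub_mul, map_sub] using (h z).sub (h' z)

theorem wlim_of_l2 {x : ℕ → A} {y : A}
    (h : Tendsto (fun n => l2norm τ (x n - y)) atTop (𝓝 0)) : WLim τ x y := fun z => by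
  rw [tendsto_iff_norm_sub_tendsto_zero]
  refine Tendsto.mono_left ?_ Nat.hyperfilter_le_atTop
  refine squeeze_zero (fun _ => norm_nonneg _) (fun n => ?_)
    (by simpa using h.mul_const (l2norm τ z))
  rw [← map_sub, ← sub_mul]
  exact hτ.norm_map_mul_le _ _

/-- Lower semicontinuity of the 2-norm: the limit is paired with y*, and Cauchy-Schwarz gives ‖y‖₂²
≤ C‖y‖₂. -/
theorem l2_le_of_wlim {x : ℕ → A} {y : A} {C : ℝ} (h : WLim τ x y)
    (hC : ∀ᶠ n in atTop, l2norm τ (x n) ≤ C) : l2norm τ y ≤ C := by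
  have h1 : ‖τ (y * star y)‖ ≤ C * l2norm τ y :=
    le_of_tendsto (h (star y)).norm ((hC.filter_mono Nat.hyperfilter_le_atTop).mono fun n hn =>
      (hτ.norm_map_mul_le _ _).trans (by
        rw [hτ.l2_star]; exact mul_le_mul_of_nonneg_right hn (hτ.l2_nonneg _)))
  rw [hτ.tracial, hτ.l2_sq_ofReal, Complex.norm_real, Real.norm_of_nonneg (sq_nonneg _)] at h1
  rcases (hτ.l2_nonneg y).eq_or_lt with h0 | h0
  · obtain ⟨n, hn⟩ := hC.exists
    rw [← h0]; exact (hτ.l2_nonneg _).trans hn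
  · nlinarith

variable [PartialOrder A] [StarOrderedRing A]

theorem map_nonneg {a : A} (ha : 0 ≤ a) : 0 ≤ τ a := by
  obtain ⟨b, rfl⟩ := CStarAlgebra.nonneg_iff_eq_star_mul_self.1 ha
  exact hτ.nonneg b

theorem map_re_nonneg {a : A} (ha : 0 ≤ a) : 0 ≤ (τ a).re := (Complex.le_def.1 (hτ.map_nonneg ha)).1

theorem map_re_mono {a b : A} (h : a ≤ b) : (τ a).re ≤ (τ b).re := by
  simpa using hτ.map_re_nonneg (sub_nonneg.2 h)

theorem map_mul_re_nonneg {a b : A} (ha : 0 ≤ a) (hb : 0 ≤ b) : 0 ≤ (τ (a * b)).re := by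
  obtain ⟨c, rfl⟩ := CStarAlgebra.nonneg_iff_eq_star_mul_self.1 ha
  rw [mul_assoc, hτ.tracial]
  exact hτ.map_re_nonneg (star_right_conjugate_nonneg hb c)

theorem l2_mul_le (a x : A) : l2norm τ (a * x) ≤ ‖a‖ * l2norm τ x := by
  refine abs_le_of_sq_le_sq' ?_ (mul_nonneg (norm_nonneg _) (hτ.l2_nonneg _)) |>.2
  rw [mul_pow, hτ.l2_sq, hτ.l2_sq, star_mul]
  have h : star x * (star a * a) * x ≤ (‖a‖ ^ 2 : ℝ) • (star x * x) := by
    refine (CStarAlgebra.star_left_conjugate_le_norm_smul (IsSelfAdjoint.star_mul_self a)).trans ?_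
    rw [CStarRing.norm_star_mul_self, sq]
  have := hτ.map_re_mono h
  rw [show ((‖a‖ ^ 2 : ℝ) • (star x * x)) = ((‖a‖ ^ 2 : ℝ) : ℂ) • (star x * x) from
    (Complex.coe_smul _ _).symm, map_smul, smul_eq_mul, Complex.re_ofReal_mul] at this
  simpa [mul_assoc] using this

theorem l2_mul_le' (x a : A) : l2norm τ (x * a) ≤ l2norm τ x * ‖a‖ := by
  have := hτ.l2_mul_le (star a) (star x)
  rwa [← star_mul, hτ.l2_star, hτ.l2_star, norm_star, mul_comm] at this

theorem l2_le_norm (x : A) : l2norm τ x ≤ ‖x‖ := by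
  simpa [hτ.l2_one] using hτ.l2_mul_le x 1

theorem wlim_of_norm {x : ℕ → A} {y : A} (h : Tendsto x atTop (𝓝 y)) : WLim τ x y := by
  refine hτ.wlim_of_l2 (squeeze_zero (fun _ => hτ.l2_nonneg _) (fun n => hτ.l2_le_norm _) ?_)
  exact tendsto_iff_norm_sub_tendsto_zero.1 h

/-- Since c c⁻ = -(c⁻)², a faithful trace detects positivity by testing c against its own negative
part only. -/
theorem nonneg_of_negPart {c : A} (hc : IsSelfAdjoint c) (h : 0 ≤ (τ (c * c⁻)).re) : 0 ≤ c := by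
  have h1 : c * c⁻ = -(star c⁻ * c⁻) := by
    conv_lhs => rw [← CFC.posPart_sub_negPart c hc]
    rw [sub_mul, CFC.posPart_sub_negPart c hc, CFC.posPart_mul_negPart, zero_sub,
      (CFC.negPart_nonneg c).isSelfAdjoint.star_eq]
  have h2 : c⁻ = 0 := by
    refine hτ.eq_zero_of_re (le_antisymm ?_ (hτ.re_nonneg _))
    rw [h1, map_neg, Complex.neg_re] at h
    linarith
  exact (CFC.negPart_eq_zero_iff c hc).1 h2

theorem nonneg_of_forall {c : A} (hc : IsSelfAdjoint c) (h : ∀ b, 0 ≤ b → 0 ≤ (τ (c * b)).re) :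
    0 ≤ c := hτ.nonneg_of_negPart hc (h _ (CFC.negPart_nonneg c))

theorem wlim_nonneg {x : ℕ → A} {y : A} (h : WLim τ x y) (hx : ∀ n, 0 ≤ x n) : 0 ≤ y := by
  refine hτ.nonneg_of_forall ?_ fun b hb => ?_
  · refine hτ.wlim_unique (hτ.wlim_star h) ?_
    simpa only [fun n => (hx n).isSelfAdjoint.star_eq] using h
  · exact ge_of_tendsto ((Complex.continuous_re.tendsto _).comp (h b))
      (Eventually.of_forall fun n => hτ.map_mul_re_nonneg (hx n) hb)

theorem wlim_mono {x x' : ℕ → A} {y y' : A} (h : WLim τ x y) (h' : WLim τ x' y')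
    (hx : ∀ n, x n ≤ x' n) : y ≤ y' :=
  sub_nonneg.1 (hτ.wlim_nonneg (h'.sub h) fun n => sub_nonneg.2 (hx n))

end IsWStarTrace

end

/-! ### Functional calculus and spectral projections in a weakly compact subalgebra. -/

section

variable {A : Type*} [CStarAlgebra A] {τ : A →ₗ[ℂ] ℂ} {N : StarSubalgebra ℂ A}

theorem IsWStarTrace.weakCompact_top (hτ : IsWStarTrace τ) :
    WeakCompact τ ((⊤ : StarSubalgebra ℂ A) : Set A) := by
  simpa using hτ.compact

theorem IsWStarTrace.wlim_mem (hτ : IsWStarTrace τ) {S : Set A} (hS : WeakCompact τ S) {x : ℕ → A}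
    {y : A} {C : ℝ} (h : WLim τ x y) (hx : ∀ n, x n ∈ S) (hC : ∀ n, ‖x n‖ ≤ C) : y ∈ S := by
  obtain ⟨z, hz, -, h'⟩ := hS x C hx hC
  rwa [hτ.wlim_unique h h']

variable [PartialOrder A] [StarOrderedRing A]

/-- Norm limits are weak limits of bounded sequences. Closedness is what keeps the continuous
functional calculus of elements of N inside N. -/
theorem WeakCompact.isClosed (hτ : IsWStarTrace τ) {S : Set A} (hS : WeakCompact τ S) :
    IsClosed S := by
  refine IsSeqClosed.isClosed fun x y hx hy => ?_
  obtain ⟨C, hC⟩ := (Metric.isBounded_range_of_tendsto x hy).exists_norm_le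
  exact hτ.wlim_mem hS (hτ.wlim_of_norm hy) hx fun n => hC _ ⟨n, rfl⟩

theorem WeakCompact.cfc_mem (hτ : IsWStarTrace τ) (hN : WeakCompact τ (N : Set A)) (f : ℝ → ℝ)
    {a : A} (ha : a ∈ N) : cfc f a ∈ N :=
  have := hN.isClosed hτ
  _root_.cfc_mem f ha

theorem cfc_mul_self {f : ℝ → ℝ} {a : A} (ha : IsSelfAdjoint a) (hf : Continuous f) :
    cfc f a * a = cfc (fun s => f s * s) a := by
  rw [cfc_mul f (fun s => s) a hf.continuousOn, cfc_id' ℝ a]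

/-- Every positive element has a support projection. -/
theorem WeakCompact.exists_support (hτ : IsWStarTrace τ) (hN : WeakCompact τ (N : Set A)) {t : A}
    (ht : 0 ≤ t) (htN : t ∈ N) :
    ∃ e ∈ N, IsStarProjection e ∧ e * t = t ∧ t * e = t ∧ (∀ y, t * y = 0 → e * y = 0) ∧
      ∀ y, Commute t y → Commute e y := by
  have hts : IsSelfAdjoint t := ht.isSelfAdjoint
  -- The support is the weak limit of t(t + 1/(n+1))⁻¹. The `max s 0` only makes the function
  -- continuous on all of ℝ.
  let r : ℕ → A := fun n => cfc (fun s : ℝ => (max s 0 + 1 / ((n : ℝ) + 1))⁻¹) t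
  have hpos : ∀ (n : ℕ) (s : ℝ), 0 < max s 0 + 1 / ((n : ℝ) + 1) := fun n s => by positivity
  have hcont : ∀ n : ℕ, Continuous fun s : ℝ => (max s 0 + 1 / ((n : ℝ) + 1))⁻¹ := fun n =>
    Continuous.inv₀ (by fun_prop) fun s => (hpos n s).ne'
  have hrt : ∀ n, r n * t = cfc (fun s : ℝ => (max s 0 + 1 / ((n : ℝ) + 1))⁻¹ * s) t := fun n =>
    cfc_mul_self hts (hcont n)
  have hcomm : ∀ n y, Commute t y → Commute (r n * t) y := fun n y h =>
    (h.cfc_real _).mul_left h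
  have hbd : ∀ n, ‖r n * t‖ ≤ 1 := fun n => by
    rw [hrt]
    refine norm_cfc_le zero_le_one fun s hs => ?_
    have hs0 : 0 ≤ s := spectrum_nonneg_of_nonneg ht hs
    rw [max_eq_left hs0, inv_mul_eq_div, Real.norm_of_nonneg (by positivity), div_le_one (by positivity)]
    have : (0 : ℝ) ≤ 1 / ((n : ℝ) + 1) := by positivity
    linarith
  have hsa : ∀ n, star (r n * t) = r n * t := fun n => by
    rw [hrt]
    exact (cfc_predicate (R := ℝ) _ t)
  have hrN : ∀ n, r n * t ∈ N := fun n => mul_mem (hN.cfc_mem hτ _ htN) htN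
  obtain ⟨e, he, -⟩ := hτ.exists_wlim hbd
  have heN : e ∈ N := hτ.wlim_mem hN he hrN hbd
  have hes : star e = e := hτ.wlim_unique (hτ.wlim_star he) (by simpa only [hsa] using he)
  have hec : ∀ y, Commute t y → Commute e y := fun y hy => by
    refine hτ.wlim_unique (he.mul_right y) ?_
    have := hτ.wlim_mul_left he y
    simpa only [fun n => (hcomm n y hy).eq] using this
  have het : e * t = t := by
    refine hτ.wlim_unique (he.mul_right t) (hτ.wlim_of_norm ?_)
    rw [tendsto_iff_norm_sub_tendsto_zero]
    refine squeeze_zero (fun _ => norm_nonneg _) (fun n => ?_) tendsto_one_div_add_atTop_nhds_zero_nat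
    have : r n * t * t - t =
        cfc (fun s : ℝ => (max s 0 + 1 / ((n : ℝ) + 1))⁻¹ * s * s - s) t := by
      have h1 : Continuous (fun s : ℝ => (max s 0 + 1 / ((n : ℝ) + 1))⁻¹ * s) :=
        (hcont n).mul continuous_id
      have h2 : Continuous (fun s : ℝ => (max s 0 + 1 / ((n : ℝ) + 1))⁻¹ * s * s) :=
        h1.mul continuous_id
      rw [cfc_sub (fun s : ℝ => (max s 0 + 1 / ((n : ℝ) + 1))⁻¹ * s * s) (fun s => s) t
        h2.continuousOn, cfc_id' ℝ t, ← cfc_mul_self hts h1, ← hrt]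
    rw [this]
    refine norm_cfc_le (by positivity) fun s hs => ?_
    have hs0 : 0 ≤ s := spectrum_nonneg_of_nonneg ht hs
    rw [max_eq_left hs0]
    set d : ℝ := 1 / ((n : ℝ) + 1) with hd
    have hd0 : 0 < d := by positivity
    have h2 : (s + d)⁻¹ * s * s - s = -(d * (s / (s + d))) := by field_simp; ring
    rw [h2, norm_neg, Real.norm_of_nonneg (by positivity)]
    have : s / (s + d) ≤ 1 := by rw [div_le_one (by positivity)]; linarith
    nlinarith
  have hte : t * e = t := by rw [← (hec t rfl).eq, het]
  have hker : ∀ y, t * y = 0 → e * y = 0 := fun y hy => by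
    refine hτ.wlim_unique (he.mul_right y) ?_
    simpa only [mul_assoc, hy, mul_zero] using WLim.const (τ := τ) 0
  refine ⟨e, heN, ⟨?_, hes⟩, het, hte, hker, hec⟩
  -- Idempotence: t(1 - e) = 0, so e kills 1 - e as well.
  have := hker (1 - e) (by rw [mul_sub, mul_one, hte, sub_self])
  rw [mul_sub, mul_one, sub_eq_zero] at this
  exact this.symm

/-- The spectral projection of `c` for the interval `(t, ∞)`. -/
theorem WeakCompact.exists_spectralCut (hτ : IsWStarTrace τ) (hN : WeakCompact τ (N : Set A)) {c : A}
    (hc : 0 ≤ c) (hcN : c ∈ N) {t : ℝ} (ht : 0 < t) :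
    ∃ s ∈ N, IsStarProjection s ∧ (∀ y, Commute c y → Commute s y) ∧ (∀ y, c * y = 0 → s * y = 0) ∧
      (t : ℂ) • s ≤ c * s ∧ c * (1 - s) ≤ (t : ℂ) • (1 - s) ∧ (t < ‖c‖ → s ≠ 0) := by
  have hcs : IsSelfAdjoint c := hc.isSelfAdjoint
  let T : A := cfc (fun s : ℝ => max (s - t) 0) c
  let D : A := cfc (fun s : ℝ => max (t - s) 0) c
  have hT : 0 ≤ T := cfc_nonneg fun s _ => le_max_right _ _
  have hD : 0 ≤ D := cfc_nonneg fun s _ => le_max_right _ _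
  have hTD : T - D = c - (t : ℂ) • 1 := by
    have h1 : c - (t : ℂ) • 1 = cfc (fun s : ℝ => s - t) c := by
      rw [cfc_sub (fun s => s) (fun _ => t) c, cfc_id' ℝ c, cfc_const t c, Algebra.algebraMap_eq_smul_one,
        Complex.coe_smul]
    rw [h1, ← cfc_sub _ _ c]
    congr 1
    funext s
    rcases le_total s t with h | h
    · rw [max_eq_right (by linarith), max_eq_left (by linarith)]; ring
    · rw [max_eq_left (by linarith), max_eq_right (by linarith)]; ring
  have hTD0 : T * D = 0 := by
    rw [← cfc_mul _ _ c]
    have : (fun s : ℝ => max (s - t) 0 * max (t - s) 0) = fun _ => 0 := by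
      funext s
      rcases le_total s t with h | h
      · rw [max_eq_right (by linarith), zero_mul]
      · rw [max_eq_right (a := t - s) (by linarith), mul_zero]
    rw [this]; simp
  -- The projection is the support of T = (c - t)₊. As T is a continuous multiple of c, the kernel
  -- of c lies in that of T.
  have hTc : T = cfc (fun s : ℝ => max (s - t) 0 / max s t) c * c := by
    have hcont : Continuous fun s : ℝ => max (s - t) 0 / max s t :=
      Continuous.div (by fun_prop) (by fun_prop) fun s => (ht.trans_le (le_max_right s t)).ne'
    rw [cfc_mul_self hcs hcont]
    refine cfc_congr fun s _ => ?_
    rcases le_total s t with h | h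
    · simp [max_eq_right (a := s - t) (by linarith : s - t ≤ 0)]
    · have : s ≠ 0 := by linarith
      simp [max_eq_left h, this]
  obtain ⟨e, heN, hep, heT, hTe, hker, hcomm⟩ := hN.exists_support hτ hT (hN.cfc_mem hτ _ hcN)
  have heD : e * D = 0 := hker D hTD0
  have hcc : ∀ y, Commute c y → Commute e y := fun y hy => hcomm y (hy.cfc_real _)
  have hec : Commute e c := hcc c rfl
  have hDe : D * e = 0 := by
    have : Commute e D := hcomm D (by
      exact (Commute.cfc_real (Commute.refl c) _).symm.cfc_real _ |>.symm)
    rw [← this.eq, heD]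
  have hes : star e = e := hep.isSelfAdjoint
  refine ⟨e, heN, hep, hcc, fun y hy => hker y ?_, ?_, ?_, ?_⟩
  · rw [hTc, mul_assoc, hy, mul_zero]
  · have : c * e - (t : ℂ) • e = T := by
      calc c * e - (t : ℂ) • e = (c - (t : ℂ) • 1) * e := by rw [sub_mul, smul_mul_assoc, one_mul]
        _ = T := by rw [← hTD, sub_mul, hDe, hTe, sub_zero]
    rw [← sub_nonneg, this]; exact hT
  · have : (t : ℂ) • (1 - e) - c * (1 - e) = D := by
      calc (t : ℂ) • (1 - e) - c * (1 - e) = -((c - (t : ℂ) • 1) * (1 - e)) := by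
            rw [sub_mul, smul_mul_assoc, one_mul, neg_sub]
        _ = D := by rw [← hTD, sub_mul, mul_sub, mul_sub, hDe, hTe]; simp
    rw [← sub_nonneg, this]; exact hD
  · intro hlt he
    have hT0 : T = 0 := by rw [← heT, he, zero_mul]
    have : c ≤ algebraMap ℝ A t := by
      rw [← sub_nonneg, Algebra.algebraMap_eq_smul_one, ← Complex.coe_smul]
      rw [hT0, zero_sub] at hTD
      rw [← neg_sub, ← hTD, neg_neg]; exact hD
    exact absurd ((CStarAlgebra.norm_le_iff_le_algebraMap c ht.le hc).2 this) (not_le.2 hlt)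

/-- The inverse square root of `max(c, t)`. -/
theorem WeakCompact.exists_invSqrt (hτ : IsWStarTrace τ) (hN : WeakCompact τ (N : Set A)) {c : A}
    (hc : 0 ≤ c) (hcN : c ∈ N) {t : ℝ} (ht : 0 < t) :
    ∃ w ∈ N, ∃ w' ∈ N, IsSelfAdjoint w ∧ w * w' = 1 ∧ w' * w = 1 ∧
      (∀ y, Commute c y → Commute w y) ∧
      ∀ s, IsStarProjection s → Commute c s → (t : ℂ) • s ≤ c * s → w * w * (c * s) = s := by
  have hcs : IsSelfAdjoint c := hc.isSelfAdjoint
  have hm : ∀ s : ℝ, 0 < max s t := fun s => ht.trans_le (le_max_right s t)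
  have hq : ∀ s : ℝ, 0 < √(max s t) := fun s => Real.sqrt_pos.2 (hm s)
  let f : ℝ → ℝ := fun s => (√(max s t))⁻¹
  let g : ℝ → ℝ := fun s => √(max s t)
  have hg : Continuous g := by fun_prop
  have hf : Continuous f := hg.inv₀ fun s => (hq s).ne'
  have hfg : cfc f c * cfc g c = 1 := by
    rw [← cfc_mul _ _ c hf.continuousOn hg.continuousOn]
    have : (fun s => f s * g s) = fun _ => 1 := funext fun s => inv_mul_cancel₀ (hq s).ne'
    rw [this, cfc_const_one ℝ c]
  have hgf : cfc g c * cfc f c = 1 := by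
    rw [← cfc_mul _ _ c hg.continuousOn hf.continuousOn]
    have : (fun s => g s * f s) = fun _ => 1 := funext fun s => mul_inv_cancel₀ (hq s).ne'
    rw [this, cfc_const_one ℝ c]
  let D : A := cfc (fun s : ℝ => max (t - s) 0) c
  have hD : 0 ≤ D := cfc_nonneg fun s _ => le_max_right _ _
  have hDD : D * (c - (t : ℂ) • 1) = -(D * D) := by
    have h1 : c - (t : ℂ) • 1 = cfc (fun s : ℝ => s - t) c := by
      rw [cfc_sub (fun s => s) (fun _ => t) c, cfc_id' ℝ c, cfc_const t c,
        Algebra.algebraMap_eq_smul_one, Complex.coe_smul]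
    rw [h1, ← cfc_mul _ _ c, ← cfc_mul _ _ c, ← cfc_neg]
    congr 1
    funext s
    rcases le_total s t with h | h
    · rw [max_eq_left (by linarith)]; ring
    · rw [max_eq_right (by linarith)]; ring
  have hmax : cfc f c * cfc f c * (c + D) = 1 := by
    have h1 : c + D = cfc (fun s : ℝ => s + max (t - s) 0) c := by
      rw [cfc_add c (fun s => s) (fun s => max (t - s) 0), cfc_id' ℝ c]
    rw [h1, ← cfc_mul _ _ c hf.continuousOn hf.continuousOn,
      ← cfc_mul (fun s => f s * f s) (fun s => s + max (t - s) 0) c (hf.mul hf).continuousOn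
        (by fun_prop), ← cfc_const_one ℝ c]
    refine cfc_congr fun s _ => ?_
    have h2 : s + max (t - s) 0 = g s * g s := by
      rw [Real.mul_self_sqrt (hm s).le]
      rcases le_total s t with h | h
      · rw [max_eq_left (by linarith), max_eq_right h]; ring
      · rw [max_eq_right (by linarith), max_eq_left h]; ring
    simp only [h2]
    have := (hq s).ne'
    simp only [f, g]
    field_simp
  refine ⟨cfc f c, hN.cfc_mem hτ _ hcN, cfc g c, hN.cfc_mem hτ _ hcN, cfc_predicate f c, hfg, hgf,
    fun y hy => hy.cfc_real _, fun s hs hcomm hle => ?_⟩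
  have hDs : Commute D s := hcomm.cfc_real _
  have hs0 : 0 ≤ s := hs.nonneg
  have hX : 0 ≤ D * s := hDs.mul_nonneg hD hs0
  have hY : 0 ≤ c * s - (t : ℂ) • s := sub_nonneg.2 hle
  have hss : s * s = s := hs.isIdempotentElem
  -- D = (t - c)₊ is the correction in max(c, t) = c + D. It vanishes on s: the left side is a
  -- product of commuting positive elements, so -(Ds)² ≥ 0 and Ds = 0.
  have hYX : (D * s) * (c * s - (t : ℂ) • s) = -((D * s) * (D * s)) := by
    have h1 : c * s - (t : ℂ) • s = (c - (t : ℂ) • 1) * s := by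
      rw [sub_mul, smul_mul_assoc, one_mul]
    have h2 : Commute s (c - (t : ℂ) • 1) :=
      hcomm.symm.sub_right ((Commute.one_right s).smul_right _)
    calc (D * s) * (c * s - (t : ℂ) • s) = D * (s * (c - (t : ℂ) • 1)) * s := by
          rw [h1]; simp only [mul_assoc]
      _ = (D * (c - (t : ℂ) • 1)) * (s * s) := by rw [h2.eq]; simp only [mul_assoc]
      _ = -(D * (D * s) * s) := by rw [hDD, neg_mul]; simp only [mul_assoc]
      _ = _ := by
          rw [mul_assoc D (D * s) s, mul_assoc D s s, hss, mul_assoc D s (D * s), ← mul_assoc s D s,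
            ← hDs.eq, mul_assoc D s s, hss]
  have hcDs : Commute (D * s) (c * s - (t : ℂ) • s) := by
    have h1 : Commute D c := (Commute.refl c).cfc_real _
    have h2 : Commute (D * s) c := h1.mul_left hcomm.symm
    have h3 : Commute (D * s) s := hDs.mul_left (Commute.refl s)
    exact (h2.mul_right h3).sub_right (h3.smul_right _)
  have h0 : (D * s) * (D * s) = 0 := by
    refine le_antisymm ?_ ((Commute.refl _).mul_nonneg hX hX)
    have := hcDs.mul_nonneg hX hY
    rw [hYX] at this
    exact neg_nonneg.1 this
  have h1 : D * s = 0 := by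
    have : star (D * s) * (D * s) = 0 := by rw [hX.isSelfAdjoint.star_eq, h0]
    exact CStarRing.star_mul_self_eq_zero_iff _ |>.1 this
  calc cfc f c * cfc f c * (c * s) = cfc f c * cfc f c * (c + D) * s := by
        rw [mul_assoc _ (c + D), add_mul, h1, add_zero]
    _ = s := by rw [hmax, one_mul]

end

/-! ### The trace-preserving conditional expectation. -/

section

variable {A : Type*} [CStarAlgebra A] {τ : A →ₗ[ℂ] ℂ} {N : StarSubalgebra ℂ A}
  [PartialOrder A] [StarOrderedRing A]

/-- Truncating a selfadjoint element brings it closer to the selfadjoint contractions. -/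
theorem WeakCompact.exists_clamp (hτ : IsWStarTrace τ) (hN : WeakCompact τ (N : Set A)) {x a : A}
    (hx1 : x ≤ 1) (hx2 : -1 ≤ x) (ha : IsSelfAdjoint a) (haN : a ∈ N) :
    ∃ b ∈ N, IsSelfAdjoint b ∧ ‖b‖ ≤ 1 ∧ l2norm τ (x - b) ≤ l2norm τ (x - a) := by
  let b : A := cfc (fun s : ℝ => max (-1) (min s 1)) a
  let P : A := cfc (fun s : ℝ => max (s - 1) 0) a
  let Q : A := cfc (fun s : ℝ => max (-1 - s) 0) a
  have hP : 0 ≤ P := cfc_nonneg fun s _ => le_max_right _ _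
  have hQ : 0 ≤ Q := cfc_nonneg fun s _ => le_max_right _ _
  have hbs : IsSelfAdjoint b := cfc_predicate _ a
  have hxs : IsSelfAdjoint x := by
    have := (sub_nonneg.2 hx1).isSelfAdjoint
    simpa using (IsSelfAdjoint.one A).sub this
  have hsum : a = b + (P - Q) := by
    rw [← cfc_sub _ _ a, ← cfc_add a _ _]
    conv_lhs => rw [← cfc_id' ℝ a]
    refine cfc_congr fun s _ => ?_
    rcases le_total s 1 with h1 | h1
    · rcases le_total s (-1) with h2 | h2
      · rw [min_eq_left h1, max_eq_left h2, max_eq_right (by linarith), max_eq_left (by linarith)]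
        ring
      · rw [min_eq_left h1, max_eq_right h2, max_eq_right (by linarith), max_eq_right (by linarith)]
        ring
    · rw [min_eq_right h1, max_eq_right (by linarith), max_eq_left (by linarith),
        max_eq_right (by linarith)]
      ring
  have hbP : b * P = P := by
    rw [← cfc_mul _ _ a]
    refine cfc_congr fun s _ => ?_
    rcases le_total s 1 with h1 | h1
    · rw [max_eq_right (a := s - 1) (by linarith), mul_zero]
    · rw [min_eq_right h1, max_eq_right (by linarith), one_mul]
  have hbQ : b * Q = -Q := by
    rw [← cfc_mul _ _ a, ← cfc_neg]
    refine cfc_congr fun s _ => ?_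
    rcases le_total s (-1) with h1 | h1
    · rw [min_eq_left (by linarith), max_eq_left h1, neg_one_mul]
    · rw [max_eq_right (a := -1 - s) (by linarith), mul_zero, neg_zero]
  refine ⟨b, hN.cfc_mem hτ _ haN, hbs, norm_cfc_le zero_le_one fun s _ => ?_, ?_⟩
  · rw [Real.norm_eq_abs, abs_le]
    exact ⟨le_max_left _ _, max_le (by norm_num) (min_le_right _ _)⟩
  · refine abs_le_of_sq_le_sq' ?_ (hτ.l2_nonneg _) |>.2
    have h1 : x - a = (x - b) - (P - Q) := by rw [hsum]; abel
    -- The error a - b = P - Q lives where b = 1 (on P) or b = -1 (on Q), and -1 ≤ x ≤ 1 there, so x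
    -- - b makes an obtuse angle with P - Q.
    have h2 : (τ (star (x - b) * (P - Q))).re ≤ 0 := by
      have e : star (x - b) * (P - Q) = -((1 - x) * P + (x - -1) * Q) := by
        rw [(hxs.sub hbs).star_eq, mul_sub, sub_mul, sub_mul, hbP, hbQ]
        noncomm_ring
      rw [e, map_neg, map_add, Complex.neg_re, Complex.add_re]
      have := hτ.map_mul_re_nonneg (sub_nonneg.2 hx1) hP
      have := hτ.map_mul_re_nonneg (sub_nonneg.2 hx2) hQ
      linarith
    rw [h1, hτ.l2_sub_sq (x - b)]
    have := sq_nonneg (l2norm τ (P - Q))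
    linarith

/-- Orthogonal projection without completing to L²: the distance from x to the selfadjoint
contractions of N is attained by weak compactness. By `exists_clamp` the minimiser is also closest
among all selfadjoint elements of N, so x - z₀ is orthogonal to N. -/
theorem exists_condExp_of_contraction (hτ : IsWStarTrace τ) (hN : WeakCompact τ (N : Set A)) {x : A}
    (hxs : IsSelfAdjoint x) (hx : ‖x‖ ≤ 1) : ∃ y ∈ N, ∀ z ∈ N, τ (y * z) = τ (x * z) := by
  have hx1 : x ≤ 1 := by
    refine hxs.le_algebraMap_norm_self.trans ?_
    rw [← map_one (algebraMap ℝ A)]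
    exact algebraMap_mono A hx
  have hx2 : -1 ≤ x := by
    refine le_trans ?_ hxs.neg_algebraMap_norm_le_self
    rw [← map_one (algebraMap ℝ A)]
    exact neg_le_neg (algebraMap_mono A hx)
  let S : Set ℝ := {d | ∃ z ∈ N, IsSelfAdjoint z ∧ ‖z‖ ≤ 1 ∧ d = l2norm τ (x - z)}
  have hSne : S.Nonempty := ⟨_, 0, zero_mem _, .zero A, by simp, rfl⟩
  have hSb : BddBelow S := ⟨0, by rintro _ ⟨z, -, -, -, rfl⟩; exact hτ.l2_nonneg _⟩
  have hseq : ∀ n : ℕ, ∃ z ∈ N, IsSelfAdjoint z ∧ ‖z‖ ≤ 1 ∧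
      l2norm τ (x - z) < sInf S + 1 / ((n : ℝ) + 1) := fun n => by
    obtain ⟨_, ⟨z, h1, h2, h3, rfl⟩, h⟩ := exists_lt_of_csInf_lt hSne
      (lt_add_of_pos_right (sInf S) (by positivity : (0 : ℝ) < 1 / ((n : ℝ) + 1)))
    exact ⟨z, h1, h2, h3, h⟩
  choose z hzN hzs hz1 hzlt using hseq
  obtain ⟨z₀, hz₀, hz₀1⟩ := hτ.exists_wlim hz1
  have hz₀N : z₀ ∈ N := hτ.wlim_mem hN hz₀ hzN hz1
  have hz₀s : IsSelfAdjoint z₀ :=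
    hτ.wlim_unique (hτ.wlim_star hz₀) (by simpa only [fun n => (hzs n).star_eq] using hz₀)
  have hmin0 : l2norm τ (x - z₀) ≤ sInf S := by
    refine le_of_forall_pos_le_add fun ε hε => ?_
    refine hτ.l2_le_of_wlim ((WLim.const x).sub hz₀) ?_
    filter_upwards [(tendsto_order.1 tendsto_one_div_add_atTop_nhds_zero_nat).2 ε hε] with n hn
    exact (hzlt n).le.trans (by linarith)
  have hmin : ∀ a ∈ N, IsSelfAdjoint a → l2norm τ (x - z₀) ≤ l2norm τ (x - a) := fun a ha has => by
    obtain ⟨b, hbN, hbs, hb1, hb⟩ := hN.exists_clamp hτ hx1 hx2 has ha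
    exact (hmin0.trans (csInf_le hSb ⟨b, hbN, hbs, hb1, rfl⟩)).trans hb
  have horth : ∀ b ∈ N, IsSelfAdjoint b → τ ((x - z₀) * b) = 0 := fun b hb hbs => by
    have hs : star (x - z₀) = x - z₀ := (hxs.sub hz₀s).star_eq
    have him : (τ ((x - z₀) * b)).im = 0 := by
      have := hτ.map_star ((x - z₀) * b)
      rw [star_mul, hs, hbs.star_eq, hτ.tracial] at this
      exact Complex.conj_eq_iff_im.1 this.symm
    -- First variation in the direction b: a nonnegative quadratic without constant term has no
    -- linear term, as its discriminant shows.
    have hre : ∀ t : ℝ, 0 ≤ l2norm τ b ^ 2 * (t * t) + (-2 * (τ ((x - z₀) * b)).re) * t + 0 := fun t => by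
      have h1 := hmin (z₀ + (t : ℂ) • b) (add_mem hz₀N (N.smul_mem hb _))
        (hz₀s.add (IsSelfAdjoint.smul (Complex.conj_ofReal t) hbs))
      have h2 : x - (z₀ + (t : ℂ) • b) = (x - z₀) - (t : ℂ) • b := by abel
      have h3 : l2norm τ (x - z₀) ^ 2 ≤ l2norm τ (x - (z₀ + (t : ℂ) • b)) ^ 2 := by
        gcongr
        exact hτ.l2_nonneg _
      rw [h2, hτ.l2_sub_sq (x - z₀), hs, mul_smul_comm, map_smul, smul_eq_mul, Complex.re_ofReal_mul, hτ.l2_smul,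
        mul_pow, Complex.norm_real, Real.norm_eq_abs, sq_abs] at h3
      nlinarith
    have := discrim_le_zero hre
    have hre0 : (τ ((x - z₀) * b)).re = 0 := by
      rw [discrim] at this
      nlinarith [sq_nonneg ((τ ((x - z₀) * b)).re)]
    exact Complex.ext hre0 him
  refine ⟨z₀, hz₀N, fun b hb => ?_⟩
  have h1 := horth (b + star b) (add_mem hb (star_mem hb)) (IsSelfAdjoint.add_star_self b)
  have h2 := horth (Complex.I • (b - star b)) (N.smul_mem (sub_mem hb (star_mem hb)) _) (by
    rw [isSelfAdjoint_iff, star_smul, star_sub, star_star, Complex.star_def, Complex.conj_I, neg_smul,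
      ← smul_neg, neg_sub])
  rw [mul_smul_comm, map_smul, smul_eq_mul, mul_eq_zero, or_iff_right Complex.I_ne_zero, mul_sub,
    map_sub] at h2
  rw [mul_add, map_add] at h1
  have h3 : τ ((x - z₀) * b) = 0 := by linear_combination (h1 + h2) / 2
  rw [sub_mul, map_sub, sub_eq_zero] at h3
  exact h3.symm

theorem exists_condExp (hτ : IsWStarTrace τ) (hN : WeakCompact τ (N : Set A)) (x : A) :
    ∃ y ∈ N, ∀ z ∈ N, τ (y * z) = τ (x * z) := by
  have hsa : ∀ x : A, IsSelfAdjoint x → ∃ y ∈ N, ∀ z ∈ N, τ (y * z) = τ (x * z) := fun x hx => by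
    rcases eq_or_ne x 0 with rfl | h0
    · exact ⟨0, zero_mem _, fun _ _ => rfl⟩
    have hn : ‖x‖ ≠ 0 := norm_ne_zero_iff.2 h0
    obtain ⟨y, hy, h⟩ := exists_condExp_of_contraction hτ hN (x := ((‖x‖⁻¹ : ℝ) : ℂ) • x)
      (IsSelfAdjoint.smul (Complex.conj_ofReal _) hx)
      (by rw [norm_smul, Complex.norm_real, norm_inv, norm_norm, inv_mul_cancel₀ hn])
    refine ⟨(‖x‖ : ℂ) • y, N.smul_mem hy _, fun z hz => ?_⟩
    rw [smul_mul_assoc, map_smul, h z hz, smul_mul_assoc, map_smul, smul_smul, Complex.ofReal_inv,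
      mul_inv_cancel₀ (Complex.ofReal_ne_zero.2 hn), one_smul]
  obtain ⟨y₁, hy₁, h₁⟩ := hsa (x + star x) (IsSelfAdjoint.add_star_self x)
  obtain ⟨y₂, hy₂, h₂⟩ := hsa (Complex.I • (x - star x)) (by
    rw [isSelfAdjoint_iff, star_smul, star_sub, star_star, Complex.star_def, Complex.conj_I, neg_smul,
      ← smul_neg, neg_sub])
  refine ⟨(1 / 2 : ℂ) • (y₁ - Complex.I • y₂), N.smul_mem (sub_mem hy₁ (N.smul_mem hy₂ _)) _,
    fun z hz => ?_⟩
  simp only [smul_mul_assoc, sub_mul, add_mul, map_smul, map_sub, map_add, smul_eq_mul] at h₁ h₂ ⊢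
  rw [h₁ z hz, h₂ z hz]
  linear_combination (-1/2 : ℂ) * (τ (x * z) - τ (star x * z)) * Complex.I_mul_I

/-- `E` is the `τ`-preserving conditional expectation onto `N`. -/
structure IsExpectation (τ : A →ₗ[ℂ] ℂ) (N : StarSubalgebra ℂ A) (E : A →ₗ[ℂ] A) : Prop where
  trace : IsWStarTrace τ
  weakCompact : WeakCompact τ (N : Set A)
  mem : ∀ x, E x ∈ N
  map_mul : ∀ x, ∀ z ∈ N, τ (E x * z) = τ (x * z)

theorem eq_of_forall_mem (hτ : IsWStarTrace τ) {x y : A} (hx : x ∈ N) (hy : y ∈ N)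
    (h : ∀ z ∈ N, τ (x * z) = τ (y * z)) : x = y := by
  refine sub_eq_zero.1 (hτ.faithful _ ?_)
  rw [hτ.tracial, sub_mul, map_sub, h _ (star_mem (sub_mem hx hy)), sub_self]

theorem exists_isExpectation (hτ : IsWStarTrace τ) (hN : WeakCompact τ (N : Set A)) :
    ∃ E : A →ₗ[ℂ] A, IsExpectation τ N E := by
  choose E hE h using exists_condExp hτ hN
  refine ⟨⟨⟨E, fun x y => ?_⟩, fun c x => ?_⟩, hτ, hN, hE, h⟩
  · refine eq_of_forall_mem hτ (hE _) (add_mem (hE _) (hE _)) fun z hz => ?_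
    rw [h _ z hz, add_mul, add_mul, map_add, map_add, h _ z hz, h _ z hz]
  · refine eq_of_forall_mem hτ (hE _) (N.smul_mem (hE _) _) fun z hz => ?_
    rw [h _ z hz, smul_mul_assoc, smul_mul_assoc, map_smul, map_smul, RingHom.id_apply, h _ z hz]

namespace IsExpectation

variable {E : A →ₗ[ℂ] A} (hE : IsExpectation τ N E)
include hE

theorem eq_of {x y : A} (hy : y ∈ N) (h : ∀ z ∈ N, τ (y * z) = τ (x * z)) : E x = y :=
  eq_of_forall_mem hE.trace (hE.mem x) hy fun z hz => by rw [hE.map_mul x z hz, h z hz]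

theorem map_mul_left {b : A} (hb : b ∈ N) (x : A) : E (b * x) = b * E x :=
  hE.eq_of (mul_mem hb (hE.mem x)) fun z hz => by
    rw [mul_assoc, hE.trace.tracial, mul_assoc, hE.map_mul x _ (mul_mem hz hb), ← mul_assoc,
      hE.trace.tracial, ← mul_assoc]

theorem map_mul_right {b : A} (hb : b ∈ N) (x : A) : E (x * b) = E x * b :=
  hE.eq_of (mul_mem (hE.mem x) hb) fun z hz => by
    rw [mul_assoc, hE.map_mul x _ (mul_mem hb hz), mul_assoc]

theorem map_star (x : A) : E (star x) = star (E x) :=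
  hE.eq_of (star_mem (hE.mem x)) fun z hz => by
    have key : ∀ y : A, τ (star y * z) = star (τ (y * star z)) := fun y => by
      rw [← hE.trace.map_star, star_mul, star_star, hE.trace.tracial]
    rw [key, key, hE.map_mul x _ (star_mem hz)]

theorem map_of_mem {b : A} (hb : b ∈ N) : E b = b := hE.eq_of hb fun _ _ => rfl

theorem map_one : E 1 = 1 := hE.map_of_mem (one_mem N)

theorem trace_map (x : A) : τ (E x) = τ x := by simpa using hE.map_mul x 1 (one_mem N)

theorem map_mul' (x : A) {z : A} (hz : z ∈ N) : τ (z * E x) = τ (z * x) := by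
  rw [hE.trace.tracial, hE.map_mul x z hz, hE.trace.tracial]

theorem trace_mul_map (x z : A) : τ (E x * z) = τ (x * E z) := by
  rw [← hE.map_mul x _ (hE.mem z), ← hE.trace.tracial z, ← hE.map_mul z _ (hE.mem x),
    hE.trace.tracial]

/-- The negative part of E x lies in N, so pairing it with E x is the same as pairing it with x ≥ 0.
-/
theorem map_nonneg {x : A} (hx : 0 ≤ x) : 0 ≤ E x := by
  have hs : IsSelfAdjoint (E x) := by
    rw [isSelfAdjoint_iff, ← hE.map_star, hx.isSelfAdjoint.star_eq]
  refine hE.trace.nonneg_of_negPart hs ?_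
  have := hE.weakCompact.isClosed hE.trace
  have hm : (E x)⁻ ∈ N := cfcₙ_mem (𝕜 := ℝ) _ (hE.mem x)
  rw [hE.map_mul x _ hm]
  exact hE.trace.map_mul_re_nonneg hx (CFC.negPart_nonneg _)

theorem map_mono {x y : A} (h : x ≤ y) : E x ≤ E y := by
  simpa using hE.map_nonneg (sub_nonneg.2 h)

theorem map_isSelfAdjoint {x : A} (hx : IsSelfAdjoint x) : IsSelfAdjoint (E x) := by
  rw [isSelfAdjoint_iff, ← hE.map_star, hx.star_eq]

theorem star_mul_le (x : A) : star (E x) * E x ≤ E (star x * x) := by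
  have h := hE.map_nonneg (star_mul_self_nonneg (x - E x))
  have e : E (star (x - E x) * (x - E x)) = E (star x * x) - star (E x) * E x := by
    rw [star_sub, sub_mul, mul_sub, mul_sub, map_sub, map_sub, map_sub, hE.map_mul_right (hE.mem x),
      hE.map_mul_left (star_mem (hE.mem x)), hE.map_star, hE.map_mul_left (star_mem (hE.mem x)),
      hE.map_of_mem (hE.mem x)]
    abel
  rw [e] at h
  exact sub_nonneg.1 h

theorem norm_map_le_of_nonneg {x : A} (hx : 0 ≤ x) : ‖E x‖ ≤ ‖x‖ := by
  rw [CStarAlgebra.norm_le_iff_le_algebraMap _ (norm_nonneg x) (hE.map_nonneg hx)]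
  have h := hE.map_mono hx.isSelfAdjoint.le_algebraMap_norm_self
  have hm : algebraMap ℝ A ‖x‖ ∈ N := by
    rw [IsScalarTower.algebraMap_apply ℝ ℂ A]
    exact N.algebraMap_mem _
  rwa [hE.map_of_mem hm] at h

theorem norm_map_le (x : A) : ‖E x‖ ≤ ‖x‖ := by
  have h1 := CStarAlgebra.norm_le_norm_of_nonneg_of_le (star_mul_self_nonneg (E x)) (hE.star_mul_le x)
  have h2 := h1.trans (hE.norm_map_le_of_nonneg (star_mul_self_nonneg x))
  rw [CStarRing.norm_star_mul_self, CStarRing.norm_star_mul_self] at h2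
  exact abs_le_of_sq_le_sq' (by nlinarith) (norm_nonneg _) |>.2

theorem wlim {x : ℕ → A} {y : A} (h : WLim τ x y) : WLim τ (fun n => E (x n)) (E y) := fun z => by
  simpa only [hE.trace_mul_map] using h (E z)

theorem map_comm {p : A} (hp : ∀ b ∈ N, Commute b p) : ∀ b ∈ N, Commute b (E p) := fun b hb => by
  rw [Commute, SemiconjBy, ← hE.map_mul_left hb, (hp b hb).eq, hE.map_mul_right hb]

theorem eq_zero_of_map_star_mul {x : A} (h : E (star x * x) = 0) : x = 0 :=
  hE.trace.faithful x (by rw [← hE.trace_map, h, map_zero])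

end IsExpectation

end

/-! ### Complete positivity and the Cauchy-Schwarz inequality of the basic construction. -/

section

/-- R is the negative part of G. It is described by algebraic identities alone, so that it can be
handled entry by entry when C is a matrix algebra. -/
theorem exists_negative_part {C : Type*} [CStarAlgebra C] [PartialOrder C] [StarOrderedRing C]
    (G : C) (hG : star G = G) :
    ∃ R S : C, star R = R ∧ R = star S * S ∧ G * R = -(R * R) ∧ (R = 0 → ∃ D, G = star D * D) := by
  have hGs : IsSelfAdjoint G := hG
  have hR : 0 ≤ G⁻ := CFC.negPart_nonneg G
  obtain ⟨S, hS⟩ := CStarAlgebra.nonneg_iff_eq_star_mul_self.1 hR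
  refine ⟨G⁻, S, hR.isSelfAdjoint.star_eq, hS, ?_, fun h0 => ?_⟩
  · conv_lhs => rw [← CFC.posPart_sub_negPart G hGs]
    rw [sub_mul, CFC.posPart_sub_negPart G hGs, CFC.posPart_mul_negPart, zero_sub]
  · exact CStarAlgebra.nonneg_iff_eq_star_mul_self.1 ((CFC.negPart_eq_zero_iff G hGs).1 h0)

/-- A matrix over a C*-algebra which is positive for a faithful positive functional factors as
`d* d`. -/
theorem exists_gram_factor {B ι : Type*} [CStarAlgebra B] [PartialOrder B] [StarOrderedRing B]
    [Fintype ι] [DecidableEq ι] {σ : B →ₗ[ℂ] ℂ} (hpos : ∀ x, 0 ≤ (σ (star x * x)).re)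
    (hfaith : ∀ x, (σ (star x * x)).re = 0 → x = 0) (G : CStarMatrix ι ι B) (hG : star G = G)
    (h : ∀ b : ι → B, 0 ≤ (σ (∑ i, ∑ j, star (b i) * (G i j * b j))).re) :
    ∃ D : CStarMatrix ι ι B, G = star D * D := by
  obtain ⟨R, S, hRs, hS, hGR, hfin⟩ := exists_negative_part G hG
  let Y := S * R
  have hY : star Y * Y = R * (R * R) := by
    simp only [Y, star_mul, hRs, mul_assoc]
    rw [← mul_assoc (star S), ← hS]
  -- The hypothesis is tested on the k-th column of R, which gives the diagonal entry of RGR = -R³ =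
  -- -Y*Y. The entries of Y*Y on the diagonal are also sums of squares, so Y = 0 and then R = 0.
  have hk : ∀ k, (σ ((star Y * Y) k k)).re ≤ 0 := fun k => by
    have h1 := h fun j => R j k
    have h2 : ∑ i, ∑ j, star (R i k) * (G i j * R j k) = (R * (G * R)) k k := by
      rw [CStarMatrix.mul_apply]
      refine Finset.sum_congr rfl fun i _ => ?_
      rw [CStarMatrix.mul_apply, Finset.mul_sum]
      refine Finset.sum_congr rfl fun j _ => ?_
      rw [CStarMatrix.star_apply_of_isSelfAdjoint hRs]
    rw [h2, hGR, mul_neg, ← hY, CStarMatrix.neg_apply, map_neg, Complex.neg_re] at h1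
    linarith
  have hY0 : Y = 0 := by
    ext i k
    refine hfaith _ (le_antisymm ?_ (hpos _))
    refine le_trans ?_ (hk k)
    rw [CStarMatrix.mul_apply, map_sum, Complex.re_sum]
    refine le_trans (le_of_eq ?_) (Finset.single_le_sum (f := fun i => (σ ((star Y) k i * Y i k)).re)
      (fun j _ => ?_) (Finset.mem_univ i))
    · rw [CStarMatrix.star_apply]
    · rw [CStarMatrix.star_apply]; exact hpos _
  have hR3 : R * (R * R) = 0 := by rw [← hY, hY0, mul_zero]
  have hR2 : R * R = 0 := by
    refine (CStarRing.star_mul_self_eq_zero_iff _).1 ?_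
    rw [star_mul, hRs, mul_assoc, hR3, mul_zero]
  have hR0 : R = 0 := by
    refine (CStarRing.star_mul_self_eq_zero_iff _).1 ?_
    rw [hRs, hR2]
  exact hfin hR0

variable {A : Type*} [CStarAlgebra A] {τ : A →ₗ[ℂ] ℂ} {N : StarSubalgebra ℂ A}
  [PartialOrder A] [StarOrderedRing A] {E : A →ₗ[ℂ] A}

/-- Conditional expectations are completely positive. -/
theorem IsExpectation.exists_gram (hE : IsExpectation τ N E) {ι : Type*} [Fintype ι]
    (x : ι → A) :
    ∃ d : ι → ι → A, (∀ k i, d k i ∈ N) ∧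
      ∀ i j, E (star (x i) * x j) = ∑ k, star (d k i) * d k j := by
  classical
  have hcl : IsClosed (N : Set A) := hE.weakCompact.isClosed hE.trace
  let _ : PartialOrder N := CStarAlgebra.spectralOrder N
  have : StarOrderedRing N := CStarAlgebra.spectralOrderedRing N
  let σ : N →ₗ[ℂ] ℂ := τ.comp N.toSubalgebra.toSubmodule.subtype
  have hσ : ∀ y : N, σ y = τ (y : A) := fun _ => rfl
  let G : CStarMatrix ι ι N := CStarMatrix.ofMatrix fun i j => ⟨E (star (x i) * x j), hE.mem _⟩
  have hGa : ∀ i j, ((G i j : N) : A) = E (star (x i) * x j) := fun _ _ => rfl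
  obtain ⟨D, hD⟩ := exists_gram_factor (σ := σ) (G := G)
    (fun y => by simpa [hσ] using hE.trace.re_nonneg (y : A))
    (fun y hy => Subtype.ext (hE.trace.eq_zero_of_re (by simpa [hσ] using hy)))
    (by
      ext i j
      rw [CStarMatrix.star_apply]
      simp [hGa, ← hE.map_star])
    -- Here ∑ τ(bᵢ* E(xᵢ* xⱼ) bⱼ) is the square of the 2-norm of ∑ xᵢ bᵢ. The factorisation is made
    -- over N, so the factors have entries in N.
    (fun b => by
      have : τ (∑ i, ∑ j, star (b i : A) * (E (star (x i) * x j) * (b j : A)))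
          = τ (star (∑ i, x i * (b i : A)) * ∑ j, x j * (b j : A)) := by
        simp only [star_sum, Finset.sum_mul_sum, map_sum]
        refine Finset.sum_congr rfl fun i _ => Finset.sum_congr rfl fun j _ => ?_
        rw [← hE.map_mul_right (b j).2, hE.map_mul' _ (star_mem (b i).2), star_mul]
        simp only [mul_assoc]
      rw [hσ]
      push_cast
      simp only [hGa, StarMemClass.coe_star]
      rw [this]
      exact hE.trace.re_nonneg _)
  refine ⟨fun k i => (D k i : A), fun k i => (D k i).2, fun i j => ?_⟩
  rw [← hGa, hD, CStarMatrix.mul_apply]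
  push_cast
  refine Finset.sum_congr rfl fun k _ => ?_
  rw [CStarMatrix.star_apply]
  rfl

/-- The Cauchy-Schwarz inequality for `∑ r i x i E(x i* a)` in the Hilbert space of the basic
construction. -/
theorem IsExpectation.norm_sq_le (hE : IsExpectation τ N E) {ι : Type*} [Fintype ι]
    (x : ι → A) (r : ι → ℝ) (a b : A) :
    0 ≤ ∑ i, ∑ j, r i * r j * l2norm τ (E (star (x i) * x j)) ^ 2 ∧
    ‖τ (star b * ∑ i, (r i : ℂ) • (x i * E (star (x i) * a)))‖ ^ 2 ≤
      (∑ i, ∑ j, r i * r j * l2norm τ (E (star (x i) * x j)) ^ 2) *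
        (τ (star b * b * E (star a * a))).re := by
  -- One Gram factorisation for all xᵢ together with a, which is the index `none`. The families V
  -- and W of elements of `A` then play the role of ∑ rᵢ xᵢ e_N xᵢ* and of b e_N a*, and the claim
  -- is Cauchy-Schwarz for them.
  obtain ⟨d, hdN, hd⟩ := hE.exists_gram (fun o : Option ι => o.elim a x)
  let V : Option ι → A := fun k => ∑ i, (r i : ℂ) • (x i * star (d k (some i)))
  let W : Option ι → A := fun k => b * star (d k none)
  have hij : ∀ i j, E (star (x i) * x j) = ∑ k, star (d k (some i)) * d k (some j) :=
    fun i j => hd (some i) (some j)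
  have hia : ∀ i, E (star (x i) * a) = ∑ k, star (d k (some i)) * d k none :=
    fun i => hd (some i) none
  have haa : E (star a * a) = ∑ k, star (d k none) * d k none := hd none none
  have hQ : ∑ i, ∑ j, r i * r j * l2norm τ (E (star (x i) * x j)) ^ 2 = ∑ k, l2norm τ (V k) ^ 2 := by
    have h1 : ∀ k, l2norm τ (V k) ^ 2 = ∑ i, ∑ j, r i * r j *
        (τ (star (x i) * x j * (star (d k (some j)) * d k (some i)))).re := fun k => by
      rw [hE.trace.l2_sq]
      simp only [V, star_sum, Finset.sum_mul_sum, map_sum, Complex.re_sum]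
      refine Finset.sum_congr rfl fun i _ => Finset.sum_congr rfl fun j _ => ?_
      rw [star_smul, smul_mul_smul_comm, map_smul, Complex.star_def, Complex.conj_ofReal,
        ← Complex.ofReal_mul, smul_eq_mul, Complex.re_ofReal_mul, star_mul, star_star,
        hE.trace.tracial]
      congr 2
      rw [mul_assoc, hE.trace.tracial, hE.trace.tracial (star (x i) * x j)]
      simp only [mul_assoc]
    have h2 : ∀ i j, l2norm τ (E (star (x i) * x j)) ^ 2 =
        ∑ k, (τ (star (x i) * x j * (star (d k (some j)) * d k (some i)))).re := fun i j => by
      rw [hE.trace.l2_sq, ← hE.map_star, star_mul, star_star, hE.trace.tracial,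
        hE.map_mul _ _ (hE.mem _), hij j i, Finset.mul_sum, map_sum, Complex.re_sum]
    simp only [h1, h2, Finset.mul_sum]
    refine Eq.trans ?_ Finset.sum_comm
    refine Finset.sum_congr rfl fun i _ => Finset.sum_comm
  have hVW : τ (star b * ∑ i, (r i : ℂ) • (x i * E (star (x i) * a))) =
      ∑ k, τ (star (W k) * V k) := by
    simp only [V, W, Finset.mul_sum, map_sum, hia]
    rw [Finset.sum_comm]
    refine Finset.sum_congr rfl fun i _ => ?_
    simp only [mul_smul_comm, map_smul, Finset.smul_sum, Finset.mul_sum, map_sum]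
    refine Finset.sum_congr rfl fun k _ => ?_
    rw [star_mul, star_star, mul_assoc (d k none), hE.trace.tracial (d k none)]
    simp only [mul_assoc]
  have hW : ∑ k, l2norm τ (W k) ^ 2 = (τ (star b * b * E (star a * a))).re := by
    rw [haa, Finset.mul_sum, map_sum, Complex.re_sum]
    refine Finset.sum_congr rfl fun k _ => ?_
    rw [hE.trace.l2_sq]
    simp only [W, star_mul, star_star]
    rw [mul_assoc, hE.trace.tracial]
    simp only [mul_assoc]
  rw [hQ, hVW, ← hW]
  refine ⟨Finset.sum_nonneg fun _ _ => sq_nonneg _, ?_⟩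
  calc ‖∑ k, τ (star (W k) * V k)‖ ^ 2 ≤ (∑ k, l2norm τ (V k) * l2norm τ (W k)) ^ 2 := by
        gcongr
        refine (norm_sum_le _ _).trans (Finset.sum_le_sum fun k _ => ?_)
        rw [mul_comm]
        exact hE.trace.norm_map_star_mul_le _ _
    _ ≤ _ := Finset.sum_mul_sq_le_sq_mul_sq _ _ _

end

/-! ### Averaging in the basic construction. -/

section

variable {A : Type*} [CStarAlgebra A] {τ : A →ₗ[ℂ] ℂ} {N : StarSubalgebra ℂ A}

/-- The map `a ↦ x E(x* a)`, that is the operator `x e_N x*` of the basic construction. -/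
noncomputable def rankOne (E : A →ₗ[ℂ] A) (x : A) : A →ₗ[ℂ] A :=
  (LinearMap.mulLeft ℂ x).comp (E.comp (LinearMap.mulLeft ℂ (star x)))

theorem rankOne_apply (E : A →ₗ[ℂ] A) (x a : A) : rankOne E x a = x * E (star x * a) := rfl

variable [PartialOrder A] [StarOrderedRing A] {E : A →ₗ[ℂ] A}

theorem IsExpectation.norm_rankOne_le (hE : IsExpectation τ N E) (x a : A) :
    ‖rankOne E x a‖ ≤ ‖x‖ * ‖x‖ * ‖a‖ := by
  rw [rankOne_apply]
  calc ‖x * E (star x * a)‖ ≤ ‖x‖ * ‖E (star x * a)‖ := norm_mul_le _ _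
    _ ≤ ‖x‖ * (‖x‖ * ‖a‖) := by
      gcongr
      refine (hE.norm_map_le _).trans ((norm_mul_le _ _).trans ?_)
      rw [norm_star]
    _ = _ := by ring

/-- Averaging `g e_N g*` over a group of unitaries: the minimal vector of the closed convex hull of
the orbit, for the Hilbert space norm of the trace of the basic construction, is fixed. -/
theorem IsExpectation.exists_average (hE : IsExpectation τ N E) (G : Subgroup (unitary A)) (g : A) :
    ∃ (T : A →ₗ[ℂ] A) (h : ℕ → A →ₗ[ℂ] A),
      (∀ n, h n ∈ convexHull ℝ (Set.range fun u : G => rankOne E ((u : unitary A) * g))) ∧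
      (∀ a, WLim τ (fun n => h n a) (T a)) ∧
      (∀ u ∈ G, ∀ a, T (u * a) = u * T a) ∧ ∀ b ∈ N, ∀ a, T (a * b) = T a * b := by
  let x : G → A := fun u => (u : unitary A) * g
  let k : G → G → ℝ := fun u w => l2norm τ (E (star (x u) * x w)) ^ 2
  let θ : G → A →ₗ[ℂ] A := fun u => rankOne E (x u)
  -- L is the trace form Tr(H(μ)H(ν)), pulled back to formal real weights on the group. Working with
  -- weights avoids having to define the trace on operators.
  let L : (G →₀ ℝ) →ₗ[ℝ] (G →₀ ℝ) →ₗ[ℝ] ℝ :=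
    Finsupp.linearCombination ℝ fun u => Finsupp.linearCombination ℝ (k u)
  let H : (G →₀ ℝ) →ₗ[ℝ] (A →ₗ[ℂ] A) := Finsupp.linearCombination ℝ θ
  have hksymm : ∀ u w, k u w = k w u := fun u w => by
    simp only [k]
    rw [← hE.trace.l2_star, ← hE.map_star, star_mul, star_star]
  have hLapp : ∀ μ ν, L μ ν = ∑ u ∈ μ.support, ∑ w ∈ ν.support, μ u * ν w * k u w := fun μ ν => by
    simp only [L, Finsupp.linearCombination_apply, Finsupp.sum, LinearMap.sum_apply,
      LinearMap.smul_apply, smul_eq_mul, Finset.mul_sum, mul_assoc]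
  have hLsymm : ∀ μ ν, L μ ν = L ν μ := fun μ ν => by
    rw [hLapp, hLapp, Finset.sum_comm]
    refine Finset.sum_congr rfl fun u _ => Finset.sum_congr rfl fun w _ => ?_
    rw [hksymm]; ring
  have hHapp : ∀ μ a, H μ a = ∑ u ∈ μ.support, (μ u : ℂ) • (x u * E (star (x u) * a)) := fun μ a => by
    simp only [H, Finsupp.linearCombination_apply, Finsupp.sum, LinearMap.sum_apply,
      LinearMap.smul_apply, Complex.coe_smul]
    rfl
  have hCS : ∀ μ a b, 0 ≤ L μ μ ∧ ‖τ (star b * H μ a)‖ ^ 2 ≤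
      L μ μ * (τ (star b * b * E (star a * a))).re := fun μ a b => by
    have := hE.norm_sq_le (fun i : μ.support => x i) (fun i => μ i) a b
    rw [hLapp, hHapp]
    have e1 : ∑ u ∈ μ.support, ∑ w ∈ μ.support, μ u * μ w * k u w =
        ∑ i : μ.support, ∑ j : μ.support, μ i * μ j * l2norm τ (E (star (x i) * x j)) ^ 2 := by
      rw [← Finset.sum_coe_sort]
      exact Finset.sum_congr rfl fun i _ => (Finset.sum_coe_sort _ _).symm
    have e2 : ∑ u ∈ μ.support, (μ u : ℂ) • (x u * E (star (x u) * a)) =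
        ∑ i : μ.support, (μ i : ℂ) • (x i * E (star (x i) * a)) := (Finset.sum_coe_sort _ _).symm
    rw [e1, e2]
    exact this
  let tr : G → (G →₀ ℝ) →ₗ[ℝ] (G →₀ ℝ) := fun u => Finsupp.lmapDomain ℝ ℝ (u * ·)
  have hxu : ∀ u w, x (u * w) = (u : unitary A) * x w := fun u w => by
    simp only [x, Subgroup.coe_mul, Submonoid.coe_mul, mul_assoc]
  have hLtr : ∀ u μ ν, L (tr u μ) (tr u ν) = L μ ν := fun u μ ν => by
    have : L.compl₁₂ (tr u) (tr u) = L := by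
      ext w w'
      simp [L, tr, k, hxu, ← mul_assoc, star_mul]
      simp [mul_assoc]
    exact congrArg (fun f => f μ ν) this
  have hHtr : ∀ u μ a, H (tr u μ) ((u : unitary A) * a) = (u : unitary A) * H μ a := fun u μ a => by
    induction μ using Finsupp.induction_linear with
    | zero => simp
    | add f g hf hg => rw [map_add, map_add, map_add, LinearMap.add_apply, LinearMap.add_apply, hf, hg, mul_add]
    | single w t =>
      simp only [H, tr, Finsupp.lmapDomain_apply, Finsupp.mapDomain_single, Finsupp.linearCombination_single,
        LinearMap.smul_apply, θ, rankOne_apply, hxu, star_mul, mul_smul_comm]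
      rw [mul_assoc (star (x w)), ← mul_assoc (star ((u : unitary A) : A)), Unitary.coe_star_mul_self, one_mul,
        mul_assoc]
  let Pr : Set (G →₀ ℝ) := {μ | (∀ u, 0 ≤ μ u) ∧ Finsupp.linearCombination ℝ (fun _ => (1 : ℝ)) μ = 1}
  have hPrtr : ∀ u, ∀ μ ∈ Pr, tr u μ ∈ Pr := fun u μ hμ => by
    refine ⟨fun w => ?_, ?_⟩
    · have : w = u * (u⁻¹ * w) := by simp
      rw [this]
      simp only [tr, Finsupp.lmapDomain_apply]
      rw [Finsupp.mapDomain_apply (mul_right_injective u)]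
      exact hμ.1 _
    · simp only [tr, Finsupp.lmapDomain_apply]
      rw [Finsupp.linearCombination_mapDomain]
      exact hμ.2
  have hPrmid : ∀ μ ∈ Pr, ∀ ν ∈ Pr, (1 / 2 : ℝ) • (μ + ν) ∈ Pr := fun μ hμ ν hν => by
    refine ⟨fun u => ?_, ?_⟩
    · have h1 := hμ.1 u
      have h2 := hν.1 u
      simp only [Finsupp.smul_apply, Finsupp.add_apply, smul_eq_mul]
      positivity
    · rw [map_smul, map_add, hμ.2, hν.2]; norm_num
  have hPrne : Pr.Nonempty := ⟨Finsupp.single 1 1, fun u => by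
    classical rw [Finsupp.single_apply]; split_ifs <;> norm_num, by simp⟩
  let I : ℝ := sInf ((fun μ => L μ μ) '' Pr)
  have hI : ∀ μ ∈ Pr, I ≤ L μ μ := fun μ hμ =>
    csInf_le ⟨0, by rintro _ ⟨ν, -, rfl⟩; exact (hCS ν 0 0).1⟩ ⟨μ, hμ, rfl⟩
  have hseq : ∀ n : ℕ, ∃ μ ∈ Pr, L μ μ < I + 1 / ((n : ℝ) + 1) := fun n => by
    obtain ⟨_, ⟨μ, h1, rfl⟩, h⟩ := exists_lt_of_csInf_lt (hPrne.image _)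
      (lt_add_of_pos_right I (by positivity : (0 : ℝ) < 1 / ((n : ℝ) + 1)))
    exact ⟨μ, h1, h⟩
  choose μ hμ hμlt using hseq
  have hhull : ∀ n, H (μ n) ∈ convexHull ℝ (Set.range θ) := fun n => by
    simp only [H, Finsupp.linearCombination_apply, Finsupp.sum]
    refine (convex_convexHull ℝ _).sum_mem (fun u _ => (hμ n).1 u) ?_
      fun u _ => subset_convexHull _ _ ⟨u, rfl⟩
    have := (hμ n).2
    simpa [Finsupp.linearCombination_apply, Finsupp.sum] using this
  have hbd : ∀ n a, ‖H (μ n) a‖ ≤ ‖g‖ * ‖g‖ * ‖a‖ := fun n a => by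
    have hconv : Convex ℝ {f : A →ₗ[ℂ] A | ‖f a‖ ≤ ‖g‖ * ‖g‖ * ‖a‖} := by
      intro f hf f' hf' s t hs ht hst
      simp only [Set.mem_ofPred_eq, LinearMap.add_apply, LinearMap.smul_apply] at hf hf' ⊢
      refine (norm_add_le _ _).trans ?_
      rw [norm_smul, norm_smul, Real.norm_of_nonneg hs, Real.norm_of_nonneg ht]
      calc s * ‖f a‖ + t * ‖f' a‖ ≤ s * (‖g‖ * ‖g‖ * ‖a‖) + t * (‖g‖ * ‖g‖ * ‖a‖) := by gcongr
        _ = ‖g‖ * ‖g‖ * ‖a‖ := by rw [← add_mul, hst, one_mul]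
    refine convexHull_min ?_ hconv (hhull n)
    rintro _ ⟨u, rfl⟩
    refine (hE.norm_rankOne_le _ _).trans ?_
    have : ‖x u‖ ≤ ‖g‖ := by
      simp only [x]
      rw [CStarRing.norm_coe_unitary_mul]
    gcongr
  choose T₀ hT₀ using fun a => (hE.trace.exists_wlim fun n => hbd n a)
  let T : A →ₗ[ℂ] A :=
    { toFun := T₀
      map_add' := fun a b => hE.trace.wlim_unique (hT₀ _).1
        (by simpa only [map_add] using (hT₀ a).1.add (hT₀ b).1)
      map_smul' := fun c a => hE.trace.wlim_unique (hT₀ _).1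
        (by simpa only [map_smul, RingHom.id_apply] using (hT₀ a).1.smul c) }
  have hT : ∀ a, WLim τ (fun n => H (μ n) a) (T a) := fun a => (hT₀ a).1
  refine ⟨T, fun n => H (μ n), hhull, hT, fun u hu a => ?_, fun b hb a => ?_⟩
  · let v : G := ⟨u, hu⟩
    -- Parallelogram law: a weight and its translate both have energy below I + 1/(n+1), while their
    -- midpoint has energy at least I. By `hCS` small energy means small matrix coefficients.
    have hsmall : ∀ n, L (μ n - tr v (μ n)) (μ n - tr v (μ n)) ≤ 4 * (1 / ((n : ℝ) + 1)) := fun n => by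
      have h1 := hI _ (hPrmid _ (hμ n) _ (hPrtr v _ (hμ n)))
      have h2 := hμlt n
      have h3 := hLtr v (μ n) (μ n)
      have h4 := hLsymm (μ n) (tr v (μ n))
      simp only [map_smul, map_add, map_sub, LinearMap.add_apply, LinearMap.sub_apply,
        LinearMap.smul_apply, smul_eq_mul] at h1 ⊢
      linarith
    have h0 : WLim τ (fun n => H (μ n) (u * a) - u * H (μ n) a) 0 := fun z => by
      have e : ∀ n, H (μ n) (u * a) - u * H (μ n) a = H (μ n - tr v (μ n)) (u * a) := fun n => by
        rw [map_sub, LinearMap.sub_apply, hHtr v]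
      simp only [e, zero_mul, map_zero]
      refine Tendsto.mono_left ?_ Nat.hyperfilter_le_atTop
      rw [tendsto_zero_iff_norm_tendsto_zero]
      have hsq : Tendsto (fun n => ‖τ (H (μ n - tr v (μ n)) (u * a) * z)‖ ^ 2) atTop (𝓝 0) := by
        let c := (τ (star (star z) * star z * E (star ((u : A) * a) * (u * a)))).re
        have hc : 0 ≤ c := hE.trace.map_mul_re_nonneg (star_mul_self_nonneg _)
          (hE.map_nonneg (star_mul_self_nonneg _))
        refine squeeze_zero (fun _ => sq_nonneg _) (fun n => ?_)
          (g := fun n : ℕ => 4 * (1 / ((n : ℝ) + 1)) * c) (by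
            have := ((tendsto_one_div_add_atTop_nhds_zero_nat (𝕜 := ℝ)).const_mul 4).mul_const c
            rwa [mul_zero, zero_mul] at this)
        rw [hE.trace.tracial]
        have := (hCS (μ n - tr v (μ n)) (u * a) (star z)).2
        rw [star_star] at this
        refine this.trans ?_
        simp only [c, star_star]
        exact mul_le_mul_of_nonneg_right (hsmall n) (by simpa only [c, star_star] using hc)
      have := hsq.sqrt
      simpa [Real.sqrt_sq] using this
    have h1 := (hT (u * a)).sub (hE.trace.wlim_mul_left (hT a) u)
    exact sub_eq_zero.1 (hE.trace.wlim_unique h1 h0)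
  · refine hE.trace.wlim_unique (hT _) ?_
    have := (hT a).mul_right b
    have e : ∀ n, H (μ n) (a * b) = H (μ n) a * b := fun n => by
      rw [hHapp, hHapp, Finset.sum_mul]
      refine Finset.sum_congr rfl fun u _ => ?_
      rw [smul_mul_assoc, ← mul_assoc (star (x u)), hE.map_mul_right hb, ← mul_assoc]
    simpa only [e] using this

end

/-! ### From the failure of (3) to a finite index inequality. -/

section

variable {A : Type*} [CStarAlgebra A] {τ : A →ₗ[ℂ] ℂ} {N : StarSubalgebra ℂ A}
  [PartialOrder A] [StarOrderedRing A] {E : A →ₗ[ℂ] A}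

/-- Pairing a*a with zz* gives ‖az‖₂², which is lower semicontinuous in a. -/
theorem IsWStarTrace.star_mul_le_of_wlim (hτ : IsWStarTrace τ) {x : ℕ → A} {y c : A}
    (h : WLim τ x y) (hx : ∀ n, star (x n) * x n ≤ c) : star y * y ≤ c := by
  have hc : IsSelfAdjoint c := IsSelfAdjoint.of_nonneg ((star_mul_self_nonneg _).trans (hx 0))
  rw [← sub_nonneg]
  refine hτ.nonneg_of_forall (hc.sub (.star_mul_self y)) fun b hb => ?_
  obtain ⟨z, rfl⟩ := CStarAlgebra.nonneg_iff_eq_mul_star_self.1 hb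
  have key : ∀ a : A, (τ (star a * a * (z * star z))).re = l2norm τ (a * z) ^ 2 := fun a => by
    rw [hτ.l2_sq, ← mul_assoc, hτ.tracial, star_mul]
    simp only [mul_assoc]
  have hle : ∀ n, l2norm τ (x n * z) ^ 2 ≤ (τ (c * (z * star z))).re := fun n => by
    rw [← key]
    have := hτ.map_mul_re_nonneg (sub_nonneg.2 (hx n)) hb
    rw [sub_mul, map_sub, Complex.sub_re] at this
    linarith
  have h1 : l2norm τ (y * z) ≤ √(τ (c * (z * star z))).re :=
    hτ.l2_le_of_wlim (h.mul_right z) (Eventually.of_forall fun n => Real.le_sqrt_of_sq_le (hle n))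
  have h2 := (Real.le_sqrt (hτ.l2_nonneg _) ((sq_nonneg _).trans (hle 0))).1 h1
  rw [sub_mul, map_sub, Complex.sub_re, key]
  linarith

/-- Vectors z from N suffice as tests, because the square root of c⁻ lies in N. -/
theorem WeakCompact.nonneg_of_forall_mem (hτ : IsWStarTrace τ) (hN : WeakCompact τ (N : Set A))
    {c : A} (hc : IsSelfAdjoint c) (hcN : c ∈ N)
    (h : ∀ z ∈ N, 0 ≤ (τ (star z * c * z)).re) : 0 ≤ c := by
  have hf : Continuous fun x : ℝ => √(x⁻) := by fun_prop
  have hk : IsSelfAdjoint (cfc (fun x : ℝ => √(x⁻)) c) := cfc_predicate _ _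
  have hkk : cfc (fun x : ℝ => √(x⁻)) c * cfc (fun x : ℝ => √(x⁻)) c = c⁻ := by
    rw [← cfc_mul _ _ c, CFC.negPart_def, cfcₙ_eq_cfc]
    exact cfc_congr fun x _ => Real.mul_self_sqrt (negPart_nonneg x)
  refine hτ.nonneg_of_negPart hc ?_
  have := h _ (hN.cfc_mem hτ (fun x : ℝ => √(x⁻)) hcN)
  rwa [hk.star_eq, mul_assoc, hτ.tracial, mul_assoc, hkk] at this

/-- Tested on z in N, the two sides compare ‖acz‖₂ with ‖c‖ ‖az‖₂. Since c commutes with z it moves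
to the far right, where traciality bounds right multiplication by ‖c‖. -/
theorem IsExpectation.map_conj_le (hE : IsExpectation τ N E) {c : A}
    (hc : ∀ b ∈ N, Commute b c) (a : A) :
    E (star c * (star a * a) * c) ≤ ((‖c‖ ^ 2 : ℝ) : ℂ) • E (star a * a) := by
  have hτ := hE.trace
  have h1 : 0 ≤ star c * (star a * a) * c := star_left_conjugate_nonneg (star_mul_self_nonneg a) c
  rw [← sub_nonneg]
  refine hE.weakCompact.nonneg_of_forall_mem hτ ?_ ?_ fun z hz => ?_
  · refine IsSelfAdjoint.sub ?_ (hE.map_isSelfAdjoint (IsSelfAdjoint.of_nonneg h1))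
    exact IsSelfAdjoint.smul (Complex.conj_ofReal _) (hE.map_isSelfAdjoint (.star_mul_self a))
  · exact sub_mem (N.smul_mem (hE.mem _) _) (hE.mem _)
  · have key : ∀ x : A, (τ (star z * E (star x * x) * z)).re = l2norm τ (x * z) ^ 2 := fun x => by
      rw [hτ.l2_sq, mul_assoc, hτ.tracial, mul_assoc, hE.map_mul _ _ (mul_mem hz (star_mem hz)),
        ← mul_assoc, hτ.tracial, star_mul]
      simp only [mul_assoc]
    have e : star c * (star a * a) * c = star (a * c) * (a * c) := by
      rw [star_mul]; simp only [mul_assoc]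
    rw [mul_sub, sub_mul, map_sub, Complex.sub_re, mul_smul_comm, smul_mul_assoc, map_smul, e, key,
      smul_eq_mul, Complex.re_ofReal_mul, key, sub_nonneg, mul_assoc, ← (hc z hz).eq, ← mul_assoc]
    have := hτ.l2_mul_le' (a * z) c
    calc _ ≤ (l2norm τ (a * z) * ‖c‖) ^ 2 := pow_le_pow_left₀ (hτ.l2_nonneg _) this 2
      _ = _ := by ring

/-- One sequence serves all x, even when M is not separable. If uₙ is chosen almost orthogonal over
N to its predecessors, then the elements uₘ* E(uₘ x) are almost orthogonal components of x, and a
Bessel inequality makes ‖E(uₙ x)‖₂² summable for every x. -/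
theorem IsExpectation.exists_seq (hE : IsExpectation τ N E)
    (hF : ∀ (s : Finset A) (ε : ℝ), 0 < ε → ∃ u ∈ unitary A, ∀ x ∈ s, l2norm τ (E (u * x)) < ε) :
    ∃ u : ℕ → A, (∀ n, u n ∈ unitary A) ∧
      ∀ x, Tendsto (fun n => l2norm τ (E (u n * x))) atTop (𝓝 0) := by
  have hτ := hE.trace
  -- Each unitary carries a counter that exceeds all previous ones, so the tolerance (1/4)^k against
  -- its predecessors decays geometrically.
  obtain ⟨f, hf1, hf2⟩ := exists_seq_of_forall_finset_exists
    (fun i : ℕ × A => i.2 ∈ unitary A)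
    (fun i j => i.1 < j.1 ∧ l2norm τ (E (j.2 * star i.2)) ≤ (1 / 4) ^ j.1) fun s _ => by
      classical
      obtain ⟨u, hu, h⟩ := hF (s.image fun i => star i.2) ((1 / 4) ^ (s.sup Prod.fst + 1))
        (by positivity)
      refine ⟨(s.sup Prod.fst + 1, u), hu, fun i hi => ⟨?_, ?_⟩⟩
      · exact Nat.lt_succ_of_le (Finset.le_sup (f := Prod.fst) hi)
      · exact (h _ (Finset.mem_image_of_mem _ hi)).le
  let u : ℕ → A := fun n => (f n).2
  have hu : ∀ n, u n ∈ unitary A := hf1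
  have hmono : StrictMono fun n => (f n).1 := strictMono_nat_of_lt_succ fun n =>
    (hf2 n (n + 1) n.lt_succ_self).1
  have hsmall : ∀ m n, m < n → l2norm τ (E (u n * star (u m))) ≤ (1 / 4) ^ n := fun m n h =>
    (hf2 m n h).2.trans (pow_le_pow_of_le_one (by norm_num) (by norm_num) (hmono.id_le n))
  refine ⟨u, hu, fun x => ?_⟩
  let y : ℕ → A := fun n => E (u n * x)
  let S : ℕ → ℝ := fun n => ∑ m ∈ Finset.range n, l2norm τ (y m) ^ 2
  let w : ℕ → A := fun n => ∑ m ∈ Finset.range n, star (u m) * y m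
  let X := ‖x‖ ^ 2
  have hX : 0 ≤ X := sq_nonneg _
  have hynorm : ∀ n, ‖y n‖ ≤ ‖x‖ := fun n => by
    refine (hE.norm_map_le _).trans ?_
    exact (CStarRing.norm_mem_unitary_mul _ (hu n)).le
  have hwsum : ∀ n, (τ (star (w n) * x)).re = S n := fun n => by
    simp only [w, S, star_sum, Finset.sum_mul, map_sum, Complex.re_sum]
    refine Finset.sum_congr rfl fun m _ => ?_
    rw [star_mul, star_star, mul_assoc, ← hE.map_mul' _ (star_mem (hE.mem _)), hτ.l2_sq]
  have hterm : ∀ m n, m < n → (τ (star (star (u m) * y m) * (star (u n) * y n))).re ≤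
      X * (1 / 4) ^ n := fun m n h => by
    have e : τ (star (star (u m) * y m) * (star (u n) * y n)) =
        τ (E (u m * star (u n)) * (y n * star (y m))) := by
      rw [hE.map_mul _ _ (mul_mem (hE.mem _) (star_mem (hE.mem _))), star_mul, star_star,
        ← mul_assoc, ← mul_assoc, hτ.tracial (_ * y n) (star (y m))]
      simp only [mul_assoc]
    rw [e]
    refine (Complex.re_le_norm _).trans ((hτ.norm_map_mul_le _ _).trans ?_)
    have h1 : l2norm τ (E (u m * star (u n))) ≤ (1 / 4) ^ n := by
      rw [← hτ.l2_star, ← hE.map_star, star_mul, star_star]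
      exact hsmall m n h
    have h2 : l2norm τ (y n * star (y m)) ≤ X := by
      refine (hτ.l2_le_norm _).trans ((norm_mul_le _ _).trans ?_)
      rw [norm_star]
      calc _ ≤ ‖x‖ * ‖x‖ := mul_le_mul (hynorm n) (hynorm m) (norm_nonneg _) (norm_nonneg _)
        _ = X := (sq _).symm
    calc _ ≤ (1 / 4) ^ n * X := mul_le_mul h1 h2 (hτ.l2_nonneg _) (by positivity)
      _ = _ := mul_comm _ _
  -- The n-th step adds ‖y n‖₂² and n cross terms, in total at most 2n X 4⁻ⁿ ≤ 2X 2⁻ⁿ, which is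
  -- exactly the increment of X(4 - 4·2⁻ⁿ).
  have hw : ∀ n, l2norm τ (w n) ^ 2 ≤ S n + X * (4 - 4 * (1 / 2) ^ n) := fun n => by
    induction n with
    | zero => simp [w, S, hτ.l2_zero]
    | succ n ih =>
      have h1 : (τ (star (w n) * (star (u n) * y n))).re ≤ X * (1 / 2) ^ n := by
        simp only [w, star_sum, Finset.sum_mul, map_sum, Complex.re_sum]
        refine (Finset.sum_le_sum fun m hm => hterm m n (Finset.mem_range.1 hm)).trans ?_
        rw [Finset.sum_const, Finset.card_range, nsmul_eq_mul]
        have h2 : (n : ℝ) ≤ 2 ^ n := by exact_mod_cast n.lt_two_pow_self.le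
        have h3 : ((1 : ℝ) / 4) ^ n = (1 / 2) ^ n * (1 / 2) ^ n := by rw [← mul_pow]; norm_num
        have h4 : (2 : ℝ) ^ n * (1 / 2) ^ n = 1 := by rw [← mul_pow]; norm_num
        calc (n : ℝ) * (X * (1 / 4) ^ n) ≤ 2 ^ n * (X * (1 / 4) ^ n) := by gcongr
          _ = X * (1 / 2) ^ n * (2 ^ n * (1 / 2) ^ n) := by rw [h3]; ring
          _ = _ := by rw [h4, mul_one]
      have h5 : l2norm τ (star (u n) * y n) = l2norm τ (y n) := by
        simp only [l2norm, star_mul, star_star, mul_assoc]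
        rw [← mul_assoc (u n), Unitary.mul_star_self_of_mem (hu n), one_mul]
      have hw' : w (n + 1) = w n + star (u n) * y n := Finset.sum_range_succ _ _
      have hS' : S (n + 1) = S n + l2norm τ (y n) ^ 2 := Finset.sum_range_succ _ _
      rw [hw', hτ.l2_add_sq, h5, hS', pow_succ ((1 : ℝ) / 2)]
      linarith
  have hSn : ∀ n, S n ≤ 5 * X := fun n => by
    have h1 : S n ≤ l2norm τ (w n) * l2norm τ x := by
      rw [← hwsum]
      exact (Complex.re_le_norm _).trans (hτ.norm_map_star_mul_le _ _)
    have h0 : 0 ≤ S n := Finset.sum_nonneg fun m _ => sq_nonneg _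
    have h2 : S n ^ 2 ≤ l2norm τ (w n) ^ 2 * l2norm τ x ^ 2 := by
      rw [← mul_pow]; exact pow_le_pow_left₀ h0 h1 2
    have h3 : l2norm τ x ^ 2 ≤ X := pow_le_pow_left₀ (hτ.l2_nonneg _) (hτ.l2_le_norm x) 2
    have h4 : l2norm τ (w n) ^ 2 ≤ S n + 4 * X := by
      have : 0 ≤ X * (4 * (1 / 2) ^ n) := by positivity
      linarith [hw n]
    have h5 : S n ^ 2 ≤ (S n + 4 * X) * X := h2.trans (mul_le_mul h4 h3 (sq_nonneg _) (by positivity))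
    by_contra! h
    nlinarith
  have hsum : Summable fun n => l2norm τ (y n) ^ 2 :=
    summable_of_sum_range_le (fun _ => sq_nonneg _) hSn
  have := hsum.tendsto_atTop_zero.sqrt
  simpa [Real.sqrt_sq (hτ.l2_nonneg _)] using this

/-- If no net of unitaries of `A` leaves `N`, then `E` has finite index on a corner `Ap`. -/
theorem IsExpectation.exists_finiteIndex (hE : IsExpectation τ N E)
    {s : Finset A} {ε : ℝ} (hε : 0 < ε)
    (hF : ∀ u ∈ unitary A, ∃ x ∈ s, ε ≤ l2norm τ (E (u * x))) :
    ∃ (p : A) (K : ℝ), IsStarProjection p ∧ p ≠ 0 ∧ (∀ b ∈ N, Commute b p) ∧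
      ∀ a, a * p = a → star a * a ≤ (K : ℂ) • E (star a * a) := by
  have hτ := hE.trace
  -- The unitaries span A, so the average T commutes with all left multiplications and is right
  -- multiplication by f = T 1. Linearity over N on the right puts f into N'.
  obtain ⟨T, h, hh, hT, hTu, hTN⟩ := hE.exists_average (⊤ : Subgroup (unitary A)) 1
  have hTl : ∀ b a, T (b * a) = b * T a := fun b a => by
    have hb : b ∈ Submodule.span ℂ (unitary A : Set A) := by
      rw [CStarAlgebra.span_unitary]; trivial
    induction hb using Submodule.span_induction with
    | mem u hu => exact hTu ⟨u, hu⟩ trivial a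
    | zero => simp
    | add x y _ _ hx hy => rw [add_mul, map_add, hx, hy, add_mul]
    | smul c x _ hx => rw [smul_mul_assoc, map_smul, hx, smul_mul_assoc]
  let f := T 1
  have hTf : ∀ a, T a = a * f := fun a => by rw [← hTl, mul_one]
  have hfN : ∀ b ∈ N, Commute b f := fun b hb => by
    have := hTN b hb 1
    rwa [one_mul, hTf] at this
  have hr : ∀ (u : unitary A) a, rankOne E ((u : A) * 1) a = (u : A) * E (star (u : A) * a) :=
    fun u a => by rw [mul_one, rankOne_apply]
  have hpair : ∀ (u : unitary A) a, (τ (star a * ((u : A) * E (star (u : A) * a)))).re =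
      l2norm τ (E (star (u : A) * a)) ^ 2 := fun u a => by
    rw [hτ.l2_sq, ← hE.map_star, hE.map_mul _ _ (hE.mem _), star_mul, star_star, mul_assoc]
  have hpos : ∀ n a, 0 ≤ (τ (star a * h n a)).re := fun n a => by
    have hc : Convex ℝ {g : A →ₗ[ℂ] A | 0 ≤ (τ (star a * g a)).re} := by
      intro g hg g' hg' s t hs ht _
      simp only [Set.mem_ofPred_eq, LinearMap.add_apply, LinearMap.smul_apply, mul_add, mul_smul_comm,
        map_add, Complex.add_re] at hg hg' ⊢
      simp only [← Complex.coe_smul s, ← Complex.coe_smul t, map_smul, smul_eq_mul,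
        Complex.re_ofReal_mul]
      positivity
    refine convexHull_min ?_ hc (hh n)
    rintro _ ⟨u, rfl⟩
    simp only [Set.mem_ofPred_eq, hr, hpair]
    exact sq_nonneg _
  have him : ∀ n a, (τ (star a * h n a)).im = 0 := fun n a => by
    have hc : Convex ℝ {g : A →ₗ[ℂ] A | (τ (star a * g a)).im = 0} := by
      intro g hg g' hg' s t hs ht _
      simp only [Set.mem_ofPred_eq, LinearMap.add_apply, LinearMap.smul_apply, mul_add, mul_smul_comm,
        map_add, Complex.add_im] at hg hg' ⊢
      simp only [← Complex.coe_smul s, ← Complex.coe_smul t, map_smul, smul_eq_mul,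
        Complex.im_ofReal_mul, hg, hg', mul_zero, add_zero]
    refine convexHull_min ?_ hc (hh n)
    rintro _ ⟨u, rfl⟩
    simp only [Set.mem_ofPred_eq, hr]
    have := hτ.im_eq_zero (E (star ((u : unitary A) : A) * a))
    rwa [← hE.map_star, hE.map_mul _ _ (hE.mem _), star_mul, star_star, mul_assoc] at this
  -- The obstruction, applied to u*, holds at every point of the orbit and is affine, so it survives
  -- convex combinations and the limit; this is why f ≠ 0.
  have hlow : ∀ n, ε ^ 2 ≤ ∑ x ∈ s, (τ (star x * h n x)).re := fun n => by
    have hc : Convex ℝ {g : A →ₗ[ℂ] A | ε ^ 2 ≤ ∑ x ∈ s, (τ (star x * g x)).re} := by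
      intro g hg g' hg' t t' ht ht' htt
      simp only [Set.mem_ofPred_eq, LinearMap.add_apply, LinearMap.smul_apply, mul_add, mul_smul_comm,
        map_add, Complex.add_re, Finset.sum_add_distrib] at hg hg' ⊢
      simp only [← Complex.coe_smul t, ← Complex.coe_smul t', map_smul, smul_eq_mul,
        Complex.re_ofReal_mul, ← Finset.mul_sum]
      calc ε ^ 2 = t * ε ^ 2 + t' * ε ^ 2 := by rw [← add_mul, htt, one_mul]
        _ ≤ _ := by gcongr
    refine convexHull_min ?_ hc (hh n)
    rintro _ ⟨u, rfl⟩
    simp only [Set.mem_ofPred_eq, hr, hpair]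
    obtain ⟨x, hx, hxε⟩ := hF (star ((u : unitary A) : A)) (Unitary.star_mem (u : unitary A).2)
    exact (pow_le_pow_left₀ hε.le hxε 2).trans
      (Finset.single_le_sum (f := fun x => l2norm τ (E (star ((u : unitary A) : A) * x)) ^ 2)
        (fun _ _ => sq_nonneg _) hx)
  have hsq : ∀ n a, star (h n a) * h n a ≤ E (star a * a) := fun n a => by
    have hc : Convex ℝ {g : A →ₗ[ℂ] A | star (g a) * g a ≤ E (star a * a)} := by
      intro g hg g' hg' t t' ht ht' htt
      simp only [Set.mem_ofPred_eq, LinearMap.add_apply, LinearMap.smul_apply] at hg hg' ⊢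
      -- Operator convexity of x ↦ x*x, with its explicit defect.
      have e : t • (star (g a) * g a) + t' • (star (g' a) * g' a) -
          star (t • g a + t' • g' a) * (t • g a + t' • g' a) =
          (t * t') • (star (g a - g' a) * (g a - g' a)) := by
        obtain rfl : t' = 1 - t := by linarith
        simp only [star_add, star_smul, star_trivial, star_sub, add_mul, mul_add, sub_mul, mul_sub,
          smul_mul_assoc, mul_smul_comm, smul_sub]
        module
      have e1 : 0 ≤ (t * t') • (star (g a - g' a) * (g a - g' a)) :=
        smul_nonneg (mul_nonneg ht ht') (star_mul_self_nonneg _)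
      rw [← e, sub_nonneg] at e1
      calc _ ≤ _ := e1
        _ ≤ t • E (star a * a) + t' • E (star a * a) :=
          add_le_add (smul_le_smul_of_nonneg_left hg ht) (smul_le_smul_of_nonneg_left hg' ht')
        _ = _ := by rw [← add_smul, htt, one_smul]
    refine convexHull_min ?_ hc (hh n)
    rintro _ ⟨u, rfl⟩
    have e : ∀ b : A, star (((u : unitary A) : A) * b) * (((u : unitary A) : A) * b) = star b * b :=
      fun b => by
        rw [star_mul, mul_assoc, ← mul_assoc (star ((u : unitary A) : A)), Unitary.coe_star_mul_self,
          one_mul]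
    simp only [Set.mem_ofPred_eq, hr]
    rw [e]
    refine (hE.star_mul_le _).trans (le_of_eq ?_)
    rw [star_mul, star_star, mul_assoc, ← mul_assoc ((u : unitary A) : A),
      Unitary.mul_star_self_of_mem (u : unitary A).2, one_mul]
  have hlim : ∀ a, Tendsto (fun n => τ (star a * h n a)) (hyperfilter ℕ)
      (𝓝 (τ (star a * (a * f)))) := fun a => by
    have := hT a (star a)
    simp only [hTf, hτ.tracial _ (star a)] at this
    exact this
  have hlimre : ∀ a, Tendsto (fun n => (τ (star a * h n a)).re) (hyperfilter ℕ)
      (𝓝 (τ (star a * (a * f))).re) := fun a => (Complex.continuous_re.tendsto _).comp (hlim a)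
  have hfre : ∀ b, 0 ≤ b → 0 ≤ (τ (f * b)).re ∧ (τ (f * b)).im = 0 := fun b hb => by
    obtain ⟨a, rfl⟩ := CStarAlgebra.nonneg_iff_eq_star_mul_self.1 hb
    rw [hτ.tracial, mul_assoc]
    refine ⟨ge_of_tendsto' (hlimre a) fun n => hpos n a, ?_⟩
    refine tendsto_nhds_unique ((Complex.continuous_im.tendsto _).comp (hlim a)) ?_
    simpa only [Function.comp_def, him] using tendsto_const_nhds
  have hfsa : IsSelfAdjoint f := by
    let c := Complex.I • (f - star f)
    have hc : IsSelfAdjoint c := by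
      simp only [c, IsSelfAdjoint, star_smul, star_sub, star_star, Complex.star_def, Complex.conj_I]
      module
    have hcb : ∀ b, 0 ≤ b → (τ (c * b)).re = 0 := fun b hb => by
      have e : τ (star f * b) = star (τ (f * b)) := by
        rw [← hτ.map_star, star_mul, (IsSelfAdjoint.of_nonneg hb).star_eq, hτ.tracial]
      simp only [c, smul_mul_assoc, map_smul, sub_mul, map_sub, e, smul_eq_mul]
      simp [(hfre b hb).2]
    have h0 : c = 0 := le_antisymm
      (neg_nonneg.1 (hτ.nonneg_of_forall hc.neg fun b hb => by
        rw [neg_mul, map_neg, Complex.neg_re, hcb b hb, neg_zero]))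
      (hτ.nonneg_of_forall hc fun b hb => (hcb b hb).ge)
    exact (sub_eq_zero.1 ((smul_eq_zero.1 h0).resolve_left Complex.I_ne_zero)).symm
  have hf0 : 0 ≤ f := hτ.nonneg_of_forall hfsa fun b hb => (hfre b hb).1
  have hfne : f ≠ 0 := fun h0 => by
    have h1 : ε ^ 2 ≤ ∑ x ∈ s, (τ (star x * (x * f))).re :=
      ge_of_tendsto' (tendsto_finsetSum s fun x _ => hlimre x) hlow
    simp only [h0, mul_zero, map_zero, Complex.zero_re, Finset.sum_const_zero] at h1
    nlinarith
  have hfl : ∀ a, star (a * f) * (a * f) ≤ E (star a * a) := fun a => by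
    rw [← hTf]
    exact hτ.star_mul_le_of_wlim (hT a) fun n => hsq n a
  -- On the spectral projection p of f above ‖f‖/2 the element w² inverts f, so a = (a w²)f for a in
  -- Ap. Then `hfl` applies to a w², and w² is removed by `map_conj_le`; hence K = ‖w²‖².
  have hδ : 0 < ‖f‖ / 2 := half_pos (norm_pos_iff.2 hfne)
  have htop : ∀ a : A, a ∈ (⊤ : StarSubalgebra ℂ A) := fun _ => trivial
  obtain ⟨p, -, hp, hpc, -, hpf, -, hpne⟩ :=
    hτ.weakCompact_top.exists_spectralCut hτ hf0 (htop f) hδ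
  obtain ⟨w, -, -, -, hw, -, -, hwc, hwp⟩ :=
    hτ.weakCompact_top.exists_invSqrt hτ hf0 (htop f) hδ
  have hpf' : Commute f p := (hpc f (Commute.refl f)).symm
  refine ⟨p, ‖w * w‖ ^ 2, hp, hpne (half_lt_self (norm_pos_iff.2 hfne)),
    fun b hb => (hpc b (hfN b hb).symm).symm, fun a ha => ?_⟩
  have hww : ∀ y, Commute f y → Commute (w * w) y := fun y hy => (hwc y hy).mul_left (hwc y hy)
  have e : a * (w * w) * f = a := by
    have h1 : w * w * (f * p) = p := hwp p hp hpf' hpf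
    calc a * (w * w) * f = a * p * (w * w) * f := by rw [ha]
      _ = a * (w * w * (f * p)) := by
        rw [mul_assoc a, ← (hww p hpf').eq, mul_assoc, mul_assoc (w * w), ← hpf'.eq]
      _ = a := by rw [h1, ha]
  have h1 := hfl (a * (w * w))
  rw [e] at h1
  refine h1.trans ?_
  have e2 : star (a * (w * w)) * (a * (w * w)) = star (w * w) * (star a * a) * (w * w) := by
    rw [star_mul a]
    simp only [mul_assoc]
  rw [e2]
  exact hE.map_conj_le (fun b hb => (hww b (hfN b hb).symm).symm) a

end

/-! ### The index inequality for E compared with the expectation onto Np. -/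

section

variable {A : Type*} [CStarAlgebra A] {τ : A →ₗ[ℂ] ℂ} {N : StarSubalgebra ℂ A}
  [PartialOrder A] [StarOrderedRing A] {E : A →ₗ[ℂ] A}

theorem exists_inv_add {e : A} (he : 0 ≤ e) {δ : ℝ} (hδ : 0 < δ) :
    ∃ r : A, 0 ≤ r ∧ (∀ y, Commute e y → Commute r y) ∧ r * e + (δ : ℂ) • r = 1 ∧
      ∃ f : ℝ → ℝ, r = cfc f e := by
  let f : ℝ → ℝ := fun s => (max s 0 + δ)⁻¹
  have hf : Continuous f := by
    refine Continuous.inv₀ (by fun_prop) fun s => ?_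
    have := le_max_right s 0
    positivity
  have hsa := IsSelfAdjoint.of_nonneg he
  refine ⟨cfc f e, cfc_nonneg fun s _ => ?_, fun y hy => ?_, ?_, f, rfl⟩
  · have := le_max_right s 0
    simp only [f]; positivity
  · exact hy.cfc_real f
  · rw [cfc_mul_self hsa hf, Complex.coe_smul, ← cfc_smul δ f e hf.continuousOn,
      ← cfc_add e (fun s => f s * s) (fun s => δ • f s) (hf.mul continuous_id).continuousOn
        (hf.const_smul δ).continuousOn,
      ← cfc_one ℝ e]
    refine cfc_congr fun s hs => ?_
    have h0 : 0 ≤ s := spectrum_nonneg_of_nonneg he hs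
    simp only [f, max_eq_left h0, smul_eq_mul]
    have : s + δ ≠ 0 := by positivity
    field_simp
    rfl

/-- The element y is E(x)E(p)⁻¹, and yp will be the expectation of x onto Np. The regularisations
(E(p) + δ)⁻¹E(x) are bounded by ‖x‖ because E(x) ≤ ‖x‖E(p), so they have a weak limit. -/
theorem IsExpectation.exists_cornerExpectation (hE : IsExpectation τ N E) {p : A}
    (hp : IsStarProjection p) (hpN : ∀ b ∈ N, Commute b p) {x : A} (hx : 0 ≤ x) (hxp : x * p = x) :
    ∃ y ∈ N, 0 ≤ y ∧ y * E p = E x := by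
  have hτ := hE.trace
  have hpx : p * x = x := by
    have := congrArg star hxp
    rwa [star_mul, hp.isSelfAdjoint.star_eq, (IsSelfAdjoint.of_nonneg hx).star_eq] at this
  have hEp : 0 ≤ E p := hE.map_nonneg hp.nonneg
  have hcomm := hE.map_comm hpN
  have hxle : E x ≤ ((‖x‖ : ℝ) : ℂ) • E p := by
    rw [← map_smul]
    refine hE.map_mono ?_
    have := star_left_conjugate_le_conjugate (IsSelfAdjoint.of_nonneg hx).le_algebraMap_norm_self p
    rwa [hp.isSelfAdjoint.star_eq, hpx, hxp, Algebra.algebraMap_eq_smul_one, mul_smul_comm, mul_one,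
      smul_mul_assoc, hp.isIdempotentElem.eq, ← Complex.coe_smul] at this
  choose r hr0 hrc hr1 f hrf using fun n : ℕ =>
    exists_inv_add hEp (Nat.one_div_pos_of_nat (α := ℝ) (n := n))
  have hrN : ∀ n, r n ∈ N := fun n => by
    rw [hrf]; exact hE.weakCompact.cfc_mem hτ _ (hE.mem p)
  have hrEx : ∀ n, Commute (r n) (E x) := fun n => hrc n _ (hcomm _ (hE.mem x)).symm
  have h0 : ∀ n, 0 ≤ r n * E x := fun n => (hrEx n).mul_nonneg (hr0 n) (hE.map_nonneg hx)
  have hle : ∀ n, r n * E x ≤ algebraMap ℝ A ‖x‖ := fun n => by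
    have h1 : 0 ≤ r n * (((‖x‖ : ℝ) : ℂ) • E p - E x) := by
      refine Commute.mul_nonneg (hr0 n) (sub_nonneg.2 hxle) ?_
      exact ((hrc n _ (Commute.refl _)).smul_right _).sub_right (hrEx n)
    have h2 : r n * E p ≤ 1 := by
      rw [← hr1 n]
      refine le_add_of_nonneg_right ?_
      rw [Complex.coe_smul]
      exact smul_nonneg Nat.one_div_pos_of_nat.le (hr0 n)
    rw [mul_sub, sub_nonneg, mul_smul_comm] at h1
    refine h1.trans ?_
    rw [Complex.coe_smul, Algebra.algebraMap_eq_smul_one]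
    exact smul_le_smul_of_nonneg_left h2 (norm_nonneg x)
  have hbd : ∀ n, ‖r n * E x‖ ≤ ‖x‖ := fun n =>
    (CStarAlgebra.norm_le_iff_le_algebraMap _ (norm_nonneg x) (h0 n)).2 (hle n)
  obtain ⟨y, hy, -⟩ := hτ.exists_wlim hbd
  refine ⟨y, hτ.wlim_mem hE.weakCompact hy (fun n => mul_mem (hrN n) (hE.mem x)) hbd,
    hτ.wlim_nonneg hy h0, hτ.wlim_unique (hy.mul_right (E p)) (hτ.wlim_of_norm ?_)⟩
  rw [tendsto_iff_norm_sub_tendsto_zero]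
  have e : ∀ n, r n * E x * E p - E x = -(((1 / ((n : ℝ) + 1) : ℝ) : ℂ) • (r n * E x)) := fun n => by
    have h1 : r n * E x * E p = r n * E p * E x := by
      rw [mul_assoc, (hcomm _ (hE.mem x)).eq, mul_assoc]
    have h2 : E x = r n * E p * E x + ((1 / ((n : ℝ) + 1) : ℝ) : ℂ) • (r n * E x) := by
      rw [← smul_mul_assoc, ← add_mul, hr1 n, one_mul]
    rw [h1, sub_eq_iff_eq_add, eq_neg_add_iff_add_eq, add_comm]
    exact h2.symm
  refine squeeze_zero (fun _ => norm_nonneg _) (g := fun n : ℕ => 1 / ((n : ℝ) + 1) * ‖x‖)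
    (fun n => ?_) (by
      have := (tendsto_one_div_add_atTop_nhds_zero_nat (𝕜 := ℝ)).mul_const ‖x‖
      rwa [zero_mul] at this)
  rw [e, norm_neg, norm_smul, Complex.norm_real, Real.norm_of_nonneg Nat.one_div_pos_of_nat.le]
  exact mul_le_mul_of_nonneg_left (hbd n) Nat.one_div_pos_of_nat.le

/-- The chain is K⁻¹x ≤ E(x) = yE(p) ≤ y, compressed by p. -/
theorem IsExpectation.smul_le_of_finiteIndex (hE : IsExpectation τ N E) {p : A}
    (hp : IsStarProjection p) (hpN : ∀ b ∈ N, Commute b p) {K : ℝ} (hK : 0 < K)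
    (hpK : ∀ a, a * p = a → star a * a ≤ (K : ℂ) • E (star a * a))
    {x y : A} (hx : 0 ≤ x) (hxp : x * p = x) (hyN : y ∈ N) (hy0 : 0 ≤ y) (hy : y * E p = E x) :
    ((K⁻¹ : ℝ) : ℂ) • x ≤ y * p := by
  have hcomm := hE.map_comm hpN
  have hpx : p * x = x := by
    have := congrArg star hxp
    rwa [star_mul, hp.isSelfAdjoint.star_eq, (IsSelfAdjoint.of_nonneg hx).star_eq] at this
  have h1 : ((K⁻¹ : ℝ) : ℂ) • x ≤ E x := by
    obtain ⟨a, rfl⟩ := CStarAlgebra.nonneg_iff_eq_star_mul_self.1 hx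
    have ha : a * p = a := by
      have : star (a * (1 - p)) * (a * (1 - p)) = 0 := by
        rw [star_mul, mul_assoc, ← mul_assoc (star a), mul_sub (star a * a), hxp]
        simp
      have := CStarRing.star_mul_self_eq_zero_iff _ |>.1 this
      rw [mul_sub, mul_one, sub_eq_zero] at this
      exact this.symm
    have := smul_le_smul_of_nonneg_left (hpK a ha) (inv_pos.2 hK).le
    rwa [Complex.coe_smul, inv_smul_smul₀ hK.ne', ← Complex.coe_smul] at this
  have h2 : E x ≤ y := by
    have h3 : 0 ≤ y * (1 - E p) := by
      refine Commute.mul_nonneg hy0 ?_ ((Commute.one_right _).sub_right (hcomm y hyN))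
      rw [sub_nonneg, ← hE.map_one]
      exact hE.map_mono hp.le_one
    rwa [mul_sub, mul_one, hy, sub_nonneg] at h3
  have := star_left_conjugate_le_conjugate (h1.trans h2) p
  rwa [hp.isSelfAdjoint.star_eq, mul_smul_comm, hpx, smul_mul_assoc, hxp, ← (hpN y hyN).eq,
    mul_assoc, hp.isIdempotentElem.eq] at this

/-- The expectation onto Np exceeds E by the factor E(p)⁻¹, which may be unbounded. So p is replaced
by ps, where s is the spectral projection of E(p) above t = ‖E(p)‖/2; it is central in N because
E(p) is. This costs a factor t⁻¹ in the constant. -/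
theorem IsExpectation.exists_finiteIndex_of_smul_le (hE : IsExpectation τ N E) {p : A}
    (hp : IsStarProjection p) (hp0 : p ≠ 0) (hpN : ∀ b ∈ N, Commute b p) {c : ℝ} (hc : 0 < c)
    (h : ∀ x y, 0 ≤ x → x * p = x → y ∈ N → 0 ≤ y → y * E p = E x → (c : ℂ) • x ≤ y * p) :
    ∃ (p : A) (K : ℝ), IsStarProjection p ∧ p ≠ 0 ∧ (∀ b ∈ N, Commute b p) ∧
      ∀ a, a * p = a → star a * a ≤ (K : ℂ) • E (star a * a) := by
  have hτ := hE.trace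
  have hcomm := hE.map_comm hpN
  have hEp : 0 ≤ E p := hE.map_nonneg hp.nonneg
  have hEp0 : E p ≠ 0 := fun h0 => hp0 <| hE.eq_zero_of_map_star_mul (by
    rwa [hp.isSelfAdjoint.star_eq, hp.isIdempotentElem.eq])
  have ht : 0 < ‖E p‖ / 2 := half_pos (norm_pos_iff.2 hEp0)
  obtain ⟨s, hsN, hs, hsc, -, hts, -, hs0⟩ :=
    hE.weakCompact.exists_spectralCut hτ hEp (hE.mem p) ht
  have hs1 := hs0 (half_lt_self (norm_pos_iff.2 hEp0))
  set t := ‖E p‖ / 2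
  have hsp : Commute s p := hpN s hsN
  have hsN' : ∀ b ∈ N, Commute b s := fun b hb => (hsc b (hcomm b hb).symm).symm
  refine ⟨p * s, c⁻¹ * t⁻¹, ?_, fun h0 => hs1 ?_, fun b hb => (hpN b hb).mul_right (hsN' b hb),
    fun a ha => ?_⟩
  · refine ⟨?_, ?_⟩
    · change p * s * (p * s) = p * s
      rw [mul_assoc, ← mul_assoc s, hsp.eq, mul_assoc, hs.isIdempotentElem.eq, ← mul_assoc,
        hp.isIdempotentElem.eq]
    · rw [IsSelfAdjoint, star_mul, hs.isSelfAdjoint.star_eq, hp.isSelfAdjoint.star_eq, hsp.eq]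
  · have h1 : E p * s = 0 := by rw [← hE.map_mul_right hsN, h0, map_zero]
    rw [h1] at hts
    have h2 : t • s = 0 := le_antisymm (by rwa [← Complex.coe_smul]) (smul_nonneg ht.le hs.nonneg)
    exact (smul_eq_zero.1 h2).resolve_left ht.ne'
  · have hap : a * p = a := by
      rw [← ha, mul_assoc, mul_assoc, hsp.eq, ← mul_assoc p, hp.isIdempotentElem.eq]
    have has : a * s = a := by
      rw [← ha, mul_assoc, mul_assoc, hs.isIdempotentElem.eq]
    have hx : 0 ≤ star a * a := star_mul_self_nonneg a
    have hxp : star a * a * p = star a * a := by rw [mul_assoc, hap]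
    have hxs : star a * a * s = star a * a := by rw [mul_assoc, has]
    have hsx : s * (star a * a) = star a * a := by
      have := congrArg star hxs
      rwa [star_mul, hs.isSelfAdjoint.star_eq, star_mul, star_star] at this
    obtain ⟨y, hyN, hy0, hy⟩ := hE.exists_cornerExpectation hp hpN hx hxp
    have h1 := star_left_conjugate_le_conjugate (h _ y hx hxp hyN hy0 hy) s
    rw [hs.isSelfAdjoint.star_eq, mul_smul_comm, hsx, smul_mul_assoc, hxs] at h1
    have h2 : t • (y * s) ≤ E (star a * a) := by
      have h3 : 0 ≤ y * (E p * s - (t : ℂ) • s) :=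
        Commute.mul_nonneg hy0 (sub_nonneg.2 hts)
          (((hcomm y hyN).mul_right (hsN' y hyN)).sub_right ((hsN' y hyN).smul_right _))
      rwa [mul_sub, ← mul_assoc, hy, ← hE.map_mul_right hsN, hxs, sub_nonneg, mul_smul_comm,
        Complex.coe_smul] at h3
    have h3 := star_left_conjugate_le_conjugate h2 p
    have h4 : p * E (star a * a) * p ≤ E (star a * a) := by
      have h5 : 0 ≤ E (star a * a) * (1 - p) :=
        Commute.mul_nonneg (hE.map_nonneg hx) (sub_nonneg.2 hp.le_one)
          ((Commute.one_right _).sub_right (hpN _ (hE.mem _)))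
      rw [← (hpN _ (hE.mem _)).eq, mul_assoc, hp.isIdempotentElem.eq]
      rwa [mul_sub, mul_one, sub_nonneg] at h5
    have e : p * (y * s) * p = s * (y * p) * s := by
      rw [← ((hpN y hyN).mul_left hsp).eq, mul_assoc, hp.isIdempotentElem.eq, ← mul_assoc s,
        ← (hsN' y hyN).eq, mul_assoc (y * s), ← hsp.eq, ← mul_assoc (y * s),
        mul_assoc y s s, hs.isIdempotentElem.eq, mul_assoc]
    rw [hp.isSelfAdjoint.star_eq, mul_smul_comm, smul_mul_assoc, e] at h3
    have h5 := h3.trans h4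
    have h6 := smul_le_smul_of_nonneg_left h1 ht.le
    have h7 := smul_le_smul_of_nonneg_left (h6.trans h5) (by positivity : 0 ≤ c⁻¹ * t⁻¹)
    have h8 : c⁻¹ * t⁻¹ * (t * c) = 1 := by field_simp
    rwa [Complex.coe_smul, smul_smul, smul_smul, mul_assoc, h8, one_smul, ← Complex.coe_smul] at h7

end

/-! ### Idempotents near almost idempotent elements. -/

section

/-- An almost idempotent element of a complete normed ring is close to an idempotent. -/
theorem exists_idempotent_near {R : Type*} [NormedRing R] [CompleteSpace R] {L ε : ℝ} (hL : 0 ≤ L)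
    (hε : 0 < ε) :
    ∃ η > 0, ∀ T : R, ‖T‖ ≤ L → ‖T * T - T‖ ≤ η →
      ∃ P : R, P * P = P ∧ ‖P - T‖ ≤ ε ∧ ∀ S, Commute T S → Commute P S := by
  -- The bound 1/14 gives 7η ≤ 1/2, so the defect x² - x halves at each step. The other bound keeps
  -- the total displacement C = 2(2L+3)η below both 1 and ε.
  let η := min (1 / 14) (min 1 ε / (2 * (2 * L + 3)))
  have hη : 0 < η := by positivity
  have hη1 : η ≤ 1 / 14 := min_le_left _ _
  let C := 2 * (2 * L + 3) * η
  have hC : C ≤ min 1 ε := by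
    have := min_le_right (1 / 14 : ℝ) (min 1 ε / (2 * (2 * L + 3)))
    rwa [le_div_iff₀' (by positivity)] at this
  have hC0 : 0 ≤ C := by positivity
  refine ⟨η, hη, fun T hT hd => ?_⟩
  -- This cubic fixes 0 and 1 with zero derivative, so iterating it squares the defect: with d = x²
  -- - x the new defect is 4d³ - 3d².
  let φ : R → R := fun x => 3 * (x * x) - 2 * (x * x * x)
  have hφ1 : ∀ x, φ x - x = (x * x - x) - 2 * ((x * x - x) * x) := fun x => by
    simp only [φ]; noncomm_ring
  have hφ2 : ∀ x, φ x * φ x - φ x = 4 * ((x * x - x) * (x * x - x) * (x * x - x)) -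
      3 * ((x * x - x) * (x * x - x)) := fun x => by
    simp only [φ]; noncomm_ring
  have hmul : ∀ (k : ℕ) (x : R), ‖(k : R) * x‖ ≤ k * ‖x‖ := fun k x => by
    rw [← nsmul_eq_mul]; exact norm_nsmul_le
  let t : ℕ → R := fun n => φ^[n] T
  have ht : ∀ n, t (n + 1) = φ (t n) := fun n => Function.iterate_succ_apply' φ n T
  have hstep : ∀ n, ‖t n * t n - t n‖ ≤ η / 2 ^ n → ‖t n‖ ≤ L + 1 →
      ‖t (n + 1) - t n‖ ≤ C / 2 / 2 ^ n := fun n h1 h2 => by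
    rw [ht, hφ1]
    have h3 : ‖2 * ((t n * t n - t n) * t n)‖ ≤ 2 * (η / 2 ^ n * (L + 1)) := by
      refine (hmul 2 _).trans ?_
      push_cast
      gcongr
      exact (norm_mul_le _ _).trans (mul_le_mul h1 h2 (norm_nonneg _) (by positivity))
    calc _ ≤ η / 2 ^ n + 2 * (η / 2 ^ n * (L + 1)) := (norm_sub_le _ _).trans (add_le_add h1 h3)
      _ = _ := by simp only [C]; ring
  have hnorm : ∀ n, ‖t n - T‖ ≤ C * (1 - (1 / 2) ^ n) → ‖t n‖ ≤ L + 1 := fun n h => by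
    have h4 : C * (1 - (1 / 2) ^ n) ≤ 1 * 1 := by
      refine mul_le_mul (hC.trans (min_le_left _ _)) (sub_le_self _ (by positivity)) ?_ zero_le_one
      rw [sub_nonneg]
      exact pow_le_one₀ (by norm_num) (by norm_num)
    have h5 := norm_le_norm_add_norm_sub' (t n) T
    linarith
  have key : ∀ n, ‖t n * t n - t n‖ ≤ η / 2 ^ n ∧ ‖t n - T‖ ≤ C * (1 - (1 / 2) ^ n) := fun n => by
    induction n with
    | zero => simpa [t] using hd
    | succ n ih =>
      obtain ⟨h1, h2⟩ := ih
      have h3 := hnorm n h2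
      refine ⟨?_, ?_⟩
      · rw [ht, hφ2]
        set d := t n * t n - t n
        have h7 : ‖d‖ ≤ η := h1.trans (div_le_self hη.le (one_le_pow₀ (by norm_num)))
        have h8 : ‖d * d‖ ≤ η * ‖d‖ := (norm_mul_le _ _).trans (by gcongr)
        have h9 : ‖d * d * d‖ ≤ η * ‖d‖ := by
          refine (norm_mul_le _ _).trans ?_
          calc ‖d * d‖ * ‖d‖ ≤ η * ‖d‖ * ‖d‖ := by gcongr
            _ ≤ η * ‖d‖ * 1 := by gcongr; linarith
            _ = _ := mul_one _
        have h10 := hmul 4 (d * d * d)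
        have h11 := hmul 3 (d * d)
        push_cast at h10 h11
        have h12 := norm_nonneg d
        calc _ ≤ 4 * (η * ‖d‖) + 3 * (η * ‖d‖) := (norm_sub_le _ _).trans (by linarith)
          _ = 7 * η * ‖d‖ := by ring
          _ ≤ 1 / 2 * (η / 2 ^ n) := by gcongr; linarith
          _ = _ := by rw [pow_succ]; field_simp
      · have h13 := norm_sub_le_norm_sub_add_norm_sub (t (n + 1)) (t n) T
        have h14 := hstep n h1 h3
        have h15 : C / 2 / 2 ^ n = C * (1 / 2) ^ n / 2 := by
          rw [one_div, inv_pow]; ring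
        have h16 : C * (1 - (1 / 2) ^ (n + 1)) = C * (1 - (1 / 2) ^ n) + C * (1 / 2) ^ n / 2 := by
          rw [pow_succ]; ring
        linarith
  have hdist : ∀ n, dist (t n) (t (n + 1)) ≤ C / 2 / 2 ^ n := fun n => by
    rw [dist_comm, dist_eq_norm]
    exact hstep n (key n).1 (hnorm n (key n).2)
  obtain ⟨P, hP⟩ := cauchySeq_tendsto_of_complete (cauchySeq_of_le_geometric_two hdist)
  refine ⟨P, ?_, ?_, fun S hS => ?_⟩
  · rw [← sub_eq_zero]
    refine tendsto_nhds_unique ((hP.mul hP).sub hP) (squeeze_zero_norm (fun n => (key n).1) ?_)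
    have := (tendsto_pow_atTop_nhds_zero_of_lt_one (r := (1 / 2 : ℝ)) (by norm_num)
      (by norm_num)).const_mul η
    simpa [div_eq_mul_inv] using this
  · rw [norm_sub_rev, ← dist_eq_norm]
    exact (dist_le_of_le_geometric_two_of_tendsto₀ hdist hP).trans (hC.trans (min_le_right _ _))
  · have hn : ∀ n, Commute (t n) S := fun n => by
      induction n with
      | zero => exact hS
      | succ n ih =>
        rw [ht]
        exact ((Nat.cast_commute 3 S).mul_left (ih.mul_left ih)).sub_left
          ((Nat.cast_commute 2 S).mul_left ((ih.mul_left ih).mul_left ih))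
    exact tendsto_nhds_unique (hP.mul_const S)
      ((hP.const_mul S).congr fun n => (hn n).eq.symm)

end

/-! ### An almost intertwining vector from a nearly extremal constant. -/

section

variable {A : Type*} [CStarAlgebra A] {τ : A →ₗ[ℂ] ℂ} {N : StarSubalgebra ℂ A}
  [PartialOrder A] [StarOrderedRing A] {E : A →ₗ[ℂ] A}

/-- A linear map which is small on the projections of a corner is small on the corner: elements
`0 ≤ x ≤ 1` have dyadic expansions into projections. -/
theorem IsWStarTrace.norm_le_of_isStarProjection (hτ : IsWStarTrace τ) {e : A}
    (he : IsStarProjection e) (F : A →ₗ[ℂ] A) {C c : ℝ} (hC0 : 0 ≤ C) (hC : ∀ x, ‖F x‖ ≤ C * ‖x‖)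
    (hc : ∀ r, IsStarProjection r → e * r = r → ‖F r‖ ≤ c) {x : A} (hex : e * x = x)
    (hxe : x * e = x) : ‖F x‖ ≤ 6 * c * ‖x‖ := by
  have hes := he.isSelfAdjoint.star_eq
  -- Binary digits: with r the spectral projection of x above 1/2, x is the mean of r and 2x - r,
  -- and 2x - r lies again between 0 and 1. The crude bound C is halved at each digit.
  have hdy : ∀ (n : ℕ) (x : A), 0 ≤ x → x ≤ 1 → x * e = x → ‖F x‖ ≤ c + C / 2 ^ n := fun n => by
    induction n with
    | zero =>
      intro x h0 h1 _
      have h2 : ‖x‖ ≤ 1 := (CStarAlgebra.norm_le_one_iff_of_nonneg x h0).2 h1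
      have h3 := hc 0 (.zero A) (mul_zero e)
      have h4 := norm_nonneg (F 0)
      have h5 := mul_le_mul_of_nonneg_left h2 hC0
      rw [pow_zero, div_one]
      linarith [hC x]
    | succ n ih =>
      intro x h0 h1 h2
      obtain ⟨r, -, hr, hrc, hr0, hr1, hr2, -⟩ := hτ.weakCompact_top.exists_spectralCut hτ h0
        (trivial : x ∈ (⊤ : StarSubalgebra ℂ A)) (t := 1 / 2) (by norm_num)
      rw [Complex.coe_smul] at hr1 hr2
      have hrx : Commute r x := hrc x (.refl x)
      have hre : r * e = r := by
        have := hr0 (1 - e) (by rw [mul_sub, mul_one, h2, sub_self])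
        rw [mul_sub, mul_one, sub_eq_zero] at this
        exact this.symm
      have her : e * r = r := by
        have := congrArg star hre
        rwa [star_mul, hes, hr.isSelfAdjoint.star_eq] at this
      have hxr : 0 ≤ x * (1 - r) :=
        Commute.mul_nonneg h0 (sub_nonneg.2 hr.le_one) ((Commute.one_right _).sub_right hrx.symm)
      have hxr' : 0 ≤ (1 - x) * r :=
        Commute.mul_nonneg (sub_nonneg.2 h1) hr.nonneg ((Commute.one_left _).sub_left hrx.symm)
      have h3 : 0 ≤ (2 : ℝ) • x - r := by
        have e1 : (2 : ℝ) • x - r = (2 : ℝ) • (x * r - (1 / 2 : ℝ) • r) + (2 : ℝ) • (x * (1 - r)) := by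
          rw [mul_sub, mul_one]; module
        rw [e1]
        exact add_nonneg (smul_nonneg zero_le_two (sub_nonneg.2 hr1)) (smul_nonneg zero_le_two hxr)
      have h4 : (2 : ℝ) • x - r ≤ 1 := by
        have e1 : 1 - ((2 : ℝ) • x - r) = (2 : ℝ) • ((1 - x) * r) +
            (2 : ℝ) • ((1 / 2 : ℝ) • (1 - r) - x * (1 - r)) := by
          rw [mul_sub, mul_one, sub_mul, one_mul]; module
        rw [← sub_nonneg, e1]
        exact add_nonneg (smul_nonneg zero_le_two hxr') (smul_nonneg zero_le_two (sub_nonneg.2 hr2))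
      have h5 := ih _ h3 h4 (by rw [sub_mul, smul_mul_assoc, h2, hre])
      have h6 := hc r hr her
      have e2 : F x = (1 / 2 : ℂ) • (F r + F ((2 : ℝ) • x - r)) := by
        rw [← map_add, ← map_smul, add_sub_cancel, ← Complex.coe_smul, smul_smul]
        norm_num
      rw [e2, norm_smul, pow_succ]
      have h7 := norm_add_le (F r) (F ((2 : ℝ) • x - r))
      have h8 : ‖(1 / 2 : ℂ)‖ = 1 / 2 := by norm_num
      have h9 : C / (2 ^ n * 2) = 1 / 2 * (C / 2 ^ n) := by field_simp
      rw [h8, h9]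
      linarith
  have hpos : ∀ x : A, 0 ≤ x → x ≤ 1 → x * e = x → ‖F x‖ ≤ c := fun x h0 h1 h2 => by
    have h3 : Tendsto (fun n : ℕ => c + C / 2 ^ n) atTop (𝓝 (c + C * 0)) := by
      have := ((tendsto_pow_atTop_nhds_zero_of_lt_one (r := (1 / 2 : ℝ)) (by norm_num)
        (by norm_num)).const_mul C).const_add c
      simpa [div_eq_mul_inv] using this
    rw [mul_zero, add_zero] at h3
    exact ge_of_tendsto' h3 fun n => hdy n x h0 h1 h2
  have hsa1 : ∀ x : A, IsSelfAdjoint x → ‖x‖ ≤ 1 → x * e = x → ‖F x‖ ≤ 3 * c := fun x hx hx1 h2 => by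
    have h3 : e * x = x := by
      have := congrArg star h2
      rwa [star_mul, hes, hx.star_eq] at this
    have key : ∀ y : A, IsSelfAdjoint y → ‖y‖ ≤ 1 → e * y = y → y * e = y → y ≤ e :=
      fun y hy hy1 h4 h5 => by
      have h6 : y ≤ 1 := hy.le_algebraMap_norm_self.trans (by
        rw [Algebra.algebraMap_eq_smul_one]
        calc ‖y‖ • (1 : A) ≤ (1 : ℝ) • (1 : A) := smul_le_smul_of_nonneg_right hy1 zero_le_one
          _ = 1 := one_smul _ _)
      have := star_left_conjugate_le_conjugate h6 e
      rwa [hes, h4, h5, mul_one, he.isIdempotentElem.eq] at this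
    have h4 : x ≤ e := key x hx hx1 h3 h2
    have h5 : -x ≤ e := key (-x) hx.neg (by rwa [norm_neg]) (by rw [mul_neg, h3]) (by rw [neg_mul, h2])
    -- A selfadjoint contraction is 2·(e + x)/2 - e, which gives 2c + c; real and imaginary parts
    -- then double this to 6c.
    have h6 := hpos ((1 / 2 : ℝ) • (e + x))
      (smul_nonneg (by norm_num) (by rw [← neg_le_iff_add_nonneg]; exact h5))
      (by
        calc (1 / 2 : ℝ) • (e + x) ≤ (1 / 2 : ℝ) • (e + e) :=
              smul_le_smul_of_nonneg_left (add_le_add_right h4 e) (by norm_num)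
          _ = e := by module
          _ ≤ 1 := he.le_one)
      (by rw [smul_mul_assoc, add_mul, h2, he.isIdempotentElem.eq])
    have h7 := hpos e he.nonneg he.le_one he.isIdempotentElem
    have e2 : F x = (2 : ℂ) • F ((1 / 2 : ℝ) • (e + x)) - F e := by
      rw [← map_smul, ← map_sub, ← Complex.coe_smul, smul_smul]
      norm_num
    rw [e2]
    refine (norm_sub_le _ _).trans ?_
    rw [norm_smul, Complex.norm_ofNat]
    linarith
  have hsa : ∀ x : A, IsSelfAdjoint x → x * e = x → ‖F x‖ ≤ 3 * c * ‖x‖ := fun x hx h2 => by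
    rcases eq_or_ne x 0 with rfl | hx0
    · simp
    have hn : 0 < ‖x‖ := norm_pos_iff.2 hx0
    have h3 := hsa1 (‖x‖⁻¹ • x) ((IsSelfAdjoint.all _).smul hx)
      (by rw [norm_smul, norm_inv, norm_norm, inv_mul_cancel₀ hn.ne'])
      (by rw [smul_mul_assoc, h2])
    rw [← Complex.coe_smul, map_smul, norm_smul, Complex.norm_real, norm_inv, norm_norm,
      inv_mul_le_iff₀ hn] at h3
    linarith
  have h1 : ((realPart x : A)) * e = realPart x := by
    rw [realPart_apply_coe, smul_mul_assoc, add_mul, hxe, ← hes, ← star_mul, hex]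
  have h2 : ((imaginaryPart x : A)) * e = imaginaryPart x := by
    rw [imaginaryPart_apply_coe, smul_mul_assoc, smul_mul_assoc, sub_mul, hxe, ← hes, ← star_mul, hex]
  have h3 := hsa _ (realPart x).2 h1
  have h4 := hsa _ (imaginaryPart x).2 h2
  have hc0 : 0 ≤ c := (norm_nonneg _).trans (hc 0 (.zero A) (mul_zero e))
  have h5 : ‖(realPart x : A)‖ ≤ ‖x‖ := realPart.norm_le x
  have h6 : ‖(imaginaryPart x : A)‖ ≤ ‖x‖ := imaginaryPart.norm_le x
  calc ‖F x‖ = ‖F (realPart x) + Complex.I • F (imaginaryPart x)‖ := by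
        rw [← map_smul, ← map_add, realPart_add_I_smul_imaginaryPart]
    _ ≤ ‖F (realPart x)‖ + ‖F (imaginaryPart x)‖ := by
        refine (norm_add_le _ _).trans ?_
        rw [norm_smul, Complex.norm_I, one_mul]
    _ ≤ 3 * c * ‖x‖ + 3 * c * ‖x‖ := by
        refine add_le_add (h3.trans ?_) (h4.trans ?_) <;> gcongr
    _ = _ := by ring

/-- Near-extremality forces y to be almost 1 as seen through z. With b = zz*, the hypotheses give
K₂b ≤ b² ≤ K₁ z y z*, so K₁ z(1 - y)z* ≤ (K₁ - K₂)b, and b ≤ K₁. -/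
theorem conj_one_sub_le {z y r : A} {K₁ K₂ : ℝ} (hK₁ : 0 < K₁) (hK : K₂ ≤ K₁)
    (hz : star z * z ≤ K₁ • y) (hy1 : y ≤ 1) (hrz : r * z = z) (hr : IsSelfAdjoint r)
    (hK₂ : K₂ • r ≤ z * star z) : z * (1 - y) * star z ≤ (K₁ - K₂) • 1 := by
  have hzr : star z * r = star z := by
    have := congrArg star hrz
    rwa [star_mul, hr.star_eq] at this
  set b := z * star z with hb
  have hb0 : 0 ≤ b := mul_star_self_nonneg z
  have hbr : b * r = b := by rw [hb, mul_assoc, hzr]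
  have hrb : r * b = b := by rw [hb, ← mul_assoc, hrz]
  have h1 : b * b ≤ K₁ • (z * y * star z) := by
    have := star_right_conjugate_le_conjugate hz z
    rw [mul_smul_comm, smul_mul_assoc] at this
    rw [hb]
    simpa only [mul_assoc] using this
  have h2 : 0 ≤ b * (b - K₂ • r) := by
    refine Commute.mul_nonneg hb0 (sub_nonneg.2 hK₂) ((Commute.refl b).sub_right ?_)
    exact Commute.smul_right (hbr.trans hrb.symm) _
  have h3 : b ≤ K₁ • 1 := by
    have e1 : ‖b‖ ≤ K₁ := by
      rw [hb, CStarRing.norm_self_mul_star, ← CStarRing.norm_star_mul_self]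
      refine (CStarAlgebra.norm_le_iff_le_algebraMap _ hK₁.le (star_mul_self_nonneg z)).2 ?_
      rw [Algebra.algebraMap_eq_smul_one]
      exact hz.trans (smul_le_smul_of_nonneg_left hy1 hK₁.le)
    rw [← Algebra.algebraMap_eq_smul_one]
    exact (CStarAlgebra.norm_le_iff_le_algebraMap _ hK₁.le hb0).1 e1
  have h4 : K₁ • (z * (1 - y) * star z) ≤ K₁ • ((K₁ - K₂) • 1) := by
    have e2 : z * (1 - y) * star z = b - z * y * star z := by
      rw [mul_sub, mul_one, sub_mul]
    rw [e2, smul_sub]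
    rw [mul_sub, mul_smul_comm, hbr, sub_nonneg] at h2
    calc K₁ • b - K₁ • (z * y * star z) ≤ K₁ • b - K₂ • b := sub_le_sub_left (h2.trans h1) _
      _ = (K₁ - K₂) • b := (sub_smul _ _ _).symm
      _ ≤ (K₁ - K₂) • (K₁ • 1) := smul_le_smul_of_nonneg_left h3 (sub_nonneg.2 hK)
      _ = _ := smul_comm _ _ _
  have := smul_le_smul_of_nonneg_left h4 (inv_pos.2 hK₁).le
  rwa [inv_smul_smul₀ hK₁.ne', inv_smul_smul₀ hK₁.ne'] at this

/-- Here ‖zy‖² = ‖z y² z*‖, and y² ≤ y ≤ s. -/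
theorem norm_mul_le_sqrt {z y s : A} {κ : ℝ} (hκ : 0 ≤ κ) (hy : 0 ≤ y) (hy1 : y ≤ 1) (hys : y ≤ s)
    (h : z * s * star z ≤ κ • 1) : ‖z * y‖ ≤ √κ := by
  refine Real.le_sqrt_of_sq_le ?_
  rw [sq, ← CStarRing.norm_self_mul_star]
  refine (CStarAlgebra.norm_le_iff_le_algebraMap _ hκ (mul_star_self_nonneg _)).2 ?_
  rw [Algebra.algebraMap_eq_smul_one]
  refine le_trans ?_ h
  have h1 : y * y ≤ y := by
    have := Commute.mul_nonneg hy (sub_nonneg.2 hy1) ((Commute.one_right y).sub_right (.refl y))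
    rwa [mul_sub, mul_one, sub_nonneg] at this
  have h2 := star_right_conjugate_le_conjugate (h1.trans hys) z
  rw [star_mul, (IsSelfAdjoint.of_nonneg hy).star_eq]
  simpa only [mul_assoc] using h2

theorem WeakCompact.exists_sqrt_add (hτ : IsWStarTrace τ) (hN : WeakCompact τ (N : Set A)) {c : A}
    (hc : 0 ≤ c) (hcN : c ∈ N) {t : ℝ} (ht : 0 < t) :
    ∃ w ∈ N, ∃ w' ∈ N, IsSelfAdjoint w ∧ IsSelfAdjoint w' ∧ w * w' = 1 ∧ w' * w = 1 ∧
      w' * w' = c + t • 1 := by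
  have hpos : ∀ s : ℝ, 0 < max s 0 + t := fun s => by have := le_max_right s 0; positivity
  have hf : Continuous fun s : ℝ => √(max s 0 + t) := by fun_prop
  have hg : Continuous fun s : ℝ => (√(max s 0 + t))⁻¹ :=
    hf.inv₀ fun s => (Real.sqrt_pos.2 (hpos s)).ne'
  refine ⟨cfc (fun s : ℝ => (√(max s 0 + t))⁻¹) c, hN.cfc_mem hτ _ hcN,
    cfc (fun s : ℝ => √(max s 0 + t)) c, hN.cfc_mem hτ _ hcN, cfc_predicate _ _, cfc_predicate _ _,
    ?_, ?_, ?_⟩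
  · rw [← cfc_mul _ _ c hg.continuousOn hf.continuousOn, ← cfc_one ℝ c]
    exact cfc_congr fun s _ => inv_mul_cancel₀ (Real.sqrt_pos.2 (hpos s)).ne'
  · rw [← cfc_mul _ _ c hf.continuousOn hg.continuousOn, ← cfc_one ℝ c]
    exact cfc_congr fun s _ => mul_inv_cancel₀ (Real.sqrt_pos.2 (hpos s)).ne'
  · have e : c + t • 1 = cfc (fun s : ℝ => s + t) c := by
      rw [cfc_add_const t (fun s => s) c, cfc_id' ℝ c, Algebra.algebraMap_eq_smul_one]
    rw [← cfc_mul _ _ c hf.continuousOn hf.continuousOn, e]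
    refine cfc_congr fun s hs => ?_
    have h0 : 0 ≤ s := spectrum_nonneg_of_nonneg hc hs
    rw [Real.mul_self_sqrt (hpos s).le, max_eq_left h0]

/-- If `E` has finite index on `Ap`, then some corner `eAe` almost acts on a vector `g` through the
right action of `N`. The vector `g` is nearly extremal for the inequality `ξ* ξ ≤ K E(ξ* ξ)`. -/
theorem IsExpectation.exists_almost_intertwiner (hE : IsExpectation τ N E) {p : A} {K : ℝ}
    (hp : IsStarProjection p) (hp0 : p ≠ 0) (hpN : ∀ b ∈ N, Commute b p)
    (hpK : ∀ a, a * p = a → star a * a ≤ (K : ℂ) • E (star a * a)) :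
    ∃ L : ℝ, ∀ δ > 0, ∃ e g : A, IsStarProjection e ∧ e * g = g ∧ g * p = g ∧ ‖g‖ ≤ L ∧
      1 / 2 ≤ ‖g‖ ∧ ∀ x, e * x = x → x * e = x → ‖x * g - g * E (star g * x * g)‖ ≤ δ * ‖x‖ := by
  have hτ := hE.trace
  -- S collects the constants that are valid on some nonzero corner eAp. Taking traces shows that
  -- none is below 1, so the infimum K₀ is positive.
  let S : Set ℝ := {K | ∃ e : A, IsStarProjection e ∧ (∃ a, e * a = a ∧ a * p = a ∧ a ≠ 0) ∧
    ∀ ξ, e * ξ = ξ → ξ * p = ξ → star ξ * ξ ≤ K • E (star ξ * ξ)}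
  have hS1 : ∀ K ∈ S, 1 ≤ K := by
    rintro K ⟨e, he, ⟨a, ha1, ha2, ha0⟩, h⟩
    have h1 := hτ.map_re_mono (h a ha1 ha2)
    rw [← Complex.coe_smul, map_smul, hE.trace_map, smul_eq_mul, Complex.re_ofReal_mul] at h1
    have h2 : 0 < (τ (star a * a)).re :=
      lt_of_le_of_ne (hτ.re_nonneg a) fun h => ha0 (hτ.eq_zero_of_re h.symm)
    by_contra! h3
    nlinarith
  have hSne : S.Nonempty := ⟨K, 1, .one A, ⟨p, one_mul p, hp.isIdempotentElem, hp0⟩, fun ξ _ h => by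
    rw [← Complex.coe_smul]; exact hpK ξ h⟩
  have hSbdd : BddBelow S := ⟨1, hS1⟩
  let K₀ := sInf S
  have hK₀ : 1 ≤ K₀ := le_csInf hSne hS1
  refine ⟨K₀ + 1, fun δ hδ => ?_⟩
  let κ := min ((δ / 12) ^ 2) (1 / 2)
  have hκ : 0 < κ := by positivity
  have hκ1 : κ ≤ 1 / 2 := min_le_right _ _
  -- K₁ lies just above K₀ and is valid on e, while K₂ lies just below K₀ and is valid on no corner,
  -- in particular not on e. Their gap is at most κ.
  obtain ⟨K₁, ⟨e, he, hea, heK⟩, hK₁⟩ := exists_lt_of_csInf_lt hSne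
    (lt_add_of_pos_right K₀ (half_pos hκ))
  have hK₁0 : K₀ ≤ K₁ := csInf_le hSbdd ⟨e, he, hea, heK⟩
  let K₂ := K₀ - κ / 2
  have hK₂0 : 1 / 2 ≤ K₂ := by simp only [K₂]; linarith
  have hK₂S : K₂ ∉ S := fun h => by
    have := csInf_le hSbdd h
    simp only [K₂, K₀] at this
    linarith
  have hK₂₁ : K₂ ≤ K₁ := by simp only [K₂]; linarith
  have hκ2 : K₁ - K₂ ≤ κ := by simp only [K₂]; linarith
  have hK₁pos : 0 < K₁ := by linarith
  obtain ⟨ξ, hξe, hξp, hξ⟩ : ∃ ξ, e * ξ = ξ ∧ ξ * p = ξ ∧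
      ¬ star ξ * ξ ≤ K₂ • E (star ξ * ξ) := by
    by_contra! h
    exact hK₂S ⟨e, he, hea, h⟩
  have hc0 : 0 ≤ E (star ξ * ξ) := hE.map_nonneg (star_mul_self_nonneg ξ)
  -- Normalisation of the violating vector ξ: were no such ζ available, ξ(E(ξ*ξ) + t)^(-1/2) would
  -- satisfy the bound K₂, and t → 0 would give it for ξ.
  obtain ⟨ζ, hζe, hζp, hζ1, hζ2⟩ : ∃ ζ, e * ζ = ζ ∧ ζ * p = ζ ∧ E (star ζ * ζ) ≤ 1 ∧
      K₂ < ‖ζ * star ζ‖ := by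
    by_contra! h
    have key : ∀ t : ℝ, 0 < t → star ξ * ξ ≤ K₂ • (E (star ξ * ξ) + t • 1) := fun t ht => by
      obtain ⟨w, hwN, w', hw'N, hw, hw', hww, hww', hsq⟩ :=
        hE.weakCompact.exists_sqrt_add hτ hc0 (hE.mem _) ht
      have e1 : star (ξ * w) * (ξ * w) = w * (star ξ * ξ) * w := by
        rw [star_mul, hw.star_eq]; simp only [mul_assoc]
      have h1 : E (star (ξ * w) * (ξ * w)) ≤ 1 := by
        rw [e1, hE.map_mul_right hwN, hE.map_mul_left hwN]
        have h2 : E (star ξ * ξ) ≤ w' * w' := by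
          rw [hsq]; exact le_add_of_nonneg_right (smul_nonneg ht.le zero_le_one)
        have h3 := star_left_conjugate_le_conjugate h2 w
        rwa [hw.star_eq, ← mul_assoc w, hww, one_mul, hww'] at h3
      have h2 := h (ξ * w) (by rw [← mul_assoc, hξe])
        (by rw [mul_assoc, (hpN w hwN).eq, ← mul_assoc, hξp]) h1
      rw [CStarRing.norm_self_mul_star, ← CStarRing.norm_star_mul_self] at h2
      have h3 := (CStarAlgebra.norm_le_iff_le_algebraMap _ (by linarith)
        (star_mul_self_nonneg (ξ * w))).1 h2
      rw [e1, Algebra.algebraMap_eq_smul_one] at h3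
      have h4 := star_left_conjugate_le_conjugate h3 w'
      rw [hw'.star_eq, mul_smul_comm, mul_one, smul_mul_assoc, hsq] at h4
      convert h4 using 1
      calc star ξ * ξ = (w' * w) * (star ξ * ξ) * (w * w') := by rw [hww, hww', one_mul, mul_one]
        _ = _ := by simp only [mul_assoc]
    refine hξ (hτ.wlim_mono (WLim.const _) (hτ.wlim_of_norm (x := fun n : ℕ =>
      K₂ • (E (star ξ * ξ) + (1 / ((n : ℝ) + 1)) • 1)) ?_)
      fun n => key _ Nat.one_div_pos_of_nat)
    have h5 := (((tendsto_one_div_add_atTop_nhds_zero_nat (𝕜 := ℝ)).smul_const (1 : A)).const_add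
      (E (star ξ * ξ))).const_smul K₂
    rwa [zero_smul, add_zero] at h5
  have ha0 : 0 ≤ ζ * star ζ := mul_star_self_nonneg ζ
  obtain ⟨e₁, -, he₁, he₁c, he₁0, he₁1, -, he₁2⟩ := hτ.weakCompact_top.exists_spectralCut hτ ha0
    (trivial : ζ * star ζ ∈ (⊤ : StarSubalgebra ℂ A)) (t := K₂) (by linarith)
  have hes := he.isSelfAdjoint.star_eq
  have he₁s := he₁.isSelfAdjoint.star_eq
  have he₁e : e₁ * e = e₁ := by
    have h1 : star ζ * e = star ζ := by
      have := congrArg star hζe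
      rwa [star_mul, hes] at this
    have := he₁0 (1 - e) (by rw [mul_sub, mul_one, mul_assoc ζ, h1, sub_self])
    rw [mul_sub, mul_one, sub_eq_zero] at this
    exact this.symm
  have hee₁ : e * e₁ = e₁ := by
    have := congrArg star he₁e
    rwa [star_mul, he₁s, hes] at this
  let g := e₁ * ζ
  have hg : e₁ * g = g := by rw [← mul_assoc, he₁.isIdempotentElem.eq]
  have hgp : g * p = g := by rw [mul_assoc, hζp]
  have heg : e * g = g := by rw [← mul_assoc, hee₁]
  have hgg : g * star g = ζ * star ζ * e₁ := by
    have h1 := (he₁c _ (.refl _)).eq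
    rw [star_mul, he₁s, mul_assoc, ← mul_assoc ζ, ← h1, ← mul_assoc, he₁.isIdempotentElem.eq]
  have hgK : K₂ • e₁ ≤ g * star g := by
    rw [hgg, ← Complex.coe_smul]; exact he₁1
  have hEg : E (star g * g) ≤ 1 := by
    refine (hE.map_mono ?_).trans hζ1
    have := star_left_conjugate_le_conjugate he₁.le_one ζ
    rw [mul_one] at this
    rw [star_mul, he₁s, mul_assoc, ← mul_assoc e₁, he₁.isIdempotentElem.eq, ← mul_assoc]
    exact this
  have hgnorm : ‖g‖ ^ 2 ≤ K₁ := by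
    rw [sq, ← CStarRing.norm_star_mul_self]
    refine (CStarAlgebra.norm_le_iff_le_algebraMap _ hK₁pos.le (star_mul_self_nonneg g)).2 ?_
    rw [Algebra.algebraMap_eq_smul_one]
    exact (heK g heg hgp).trans (smul_le_smul_of_nonneg_left hEg hK₁pos.le)
  have hgnorm2 : K₂ ≤ ‖g‖ ^ 2 := by
    have h1 := CStarAlgebra.norm_le_norm_of_nonneg_of_le
      (smul_nonneg (by linarith) he₁.nonneg) hgK
    have h2 : ‖e₁‖ = 1 := by
      have h3 : ‖e₁‖ * ‖e₁‖ = ‖e₁‖ := by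
        rw [← CStarRing.norm_star_mul_self, he₁s, he₁.isIdempotentElem.eq]
      exact mul_eq_left₀ (norm_ne_zero_iff.2 (he₁2 hζ2)) |>.1 h3
    rwa [norm_smul, h2, mul_one, CStarRing.norm_self_mul_star, ← sq,
      Real.norm_of_nonneg (by linarith)] at h1
  -- With y = E(g*rg), the difference is rg(1 - y) - (e₁ - r)g y. Near-extremality of rg controls
  -- the first term. That of (e₁ - r)g controls the second, since E(g*g) ≤ 1 gives y ≤ 1 - E(g*(e₁ -
  -- r)g).
  have hproj : ∀ r, IsStarProjection r → e₁ * r = r → ‖r * g - g * E (star g * r * g)‖ ≤ 2 * √κ := by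
    intro r hr her
    have hrs := hr.isSelfAdjoint.star_eq
    have hre : r * e₁ = r := by
      have := congrArg star her
      rwa [star_mul, hrs, he₁s] at this
    have hr' : IsStarProjection (e₁ - r) := by
      refine ⟨?_, he₁.isSelfAdjoint.sub hr.isSelfAdjoint⟩
      rw [IsIdempotentElem, mul_sub, sub_mul, sub_mul, he₁.isIdempotentElem.eq,
        hr.isIdempotentElem.eq, her, hre, sub_self, sub_zero]
    have hr'e : (e₁ - r) * e₁ = e₁ - r := by rw [sub_mul, he₁.isIdempotentElem.eq, hre]
    have main : ∀ q, IsStarProjection q → q * e₁ = q → E (star (q * g) * (q * g)) ≤ 1 →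
        (q * g) * (1 - E (star (q * g) * (q * g))) * star (q * g) ≤ κ • 1 := by
      intro q hq hqe hq1
      have hqs := hq.isSelfAdjoint.star_eq
      refine (conj_one_sub_le (r := q) hK₁pos hK₂₁ (heK (q * g) ?_ ?_) hq1 ?_ hq.isSelfAdjoint
        ?_).trans (smul_le_smul_of_nonneg_right hκ2 zero_le_one)
      · have h1 : e₁ * q = q := by
          have := congrArg star hqe
          rwa [star_mul, hqs, he₁s] at this
        rw [← mul_assoc, ← h1, ← mul_assoc e, hee₁]
      · rw [mul_assoc, hgp]
      · rw [← mul_assoc, hq.isIdempotentElem.eq]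
      · have := star_right_conjugate_le_conjugate hgK q
        rw [hqs, mul_smul_comm, hqe, smul_mul_assoc, hq.isIdempotentElem.eq] at this
        rw [star_mul, hqs]
        simpa only [mul_assoc] using this
    have hsplit : ∀ q, IsStarProjection q → star (q * g) * (q * g) = star g * q * g := fun q hq => by
      rw [star_mul, hq.isSelfAdjoint.star_eq, mul_assoc, ← mul_assoc q, hq.isIdempotentElem.eq,
        mul_assoc]
    have hy0 : 0 ≤ E (star (r * g) * (r * g)) := hE.map_nonneg (star_mul_self_nonneg _)
    have hy'0 : 0 ≤ E (star ((e₁ - r) * g) * ((e₁ - r) * g)) :=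
      hE.map_nonneg (star_mul_self_nonneg _)
    have hsum : E (star (r * g) * (r * g)) + E (star ((e₁ - r) * g) * ((e₁ - r) * g)) ≤ 1 := by
      rw [← map_add, hsplit r hr, hsplit _ hr', ← add_mul, ← mul_add, add_sub_cancel, mul_assoc, hg]
      exact hEg
    have hy1 := (le_add_of_nonneg_right hy'0).trans hsum
    have hy'1 := (le_add_of_nonneg_left hy0).trans hsum
    have h1 := main r hr hre hy1
    have h2 := main _ hr' hr'e hy'1
    have h3 := norm_mul_le_sqrt hκ.le (sub_nonneg.2 hy1) (sub_le_self _ hy0) le_rfl h1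
    have h4 := norm_mul_le_sqrt hκ.le hy0 hy1 (le_sub_iff_add_le.2 hsum) h2
    rw [← hsplit r hr]
    set y := E (star (r * g) * (r * g))
    have e1 : r * g - g * y = r * g * (1 - y) - (e₁ - r) * g * y := by
      rw [sub_mul e₁, hg, mul_sub, mul_one, sub_mul]; abel
    rw [e1]
    refine (norm_sub_le _ _).trans ?_
    linarith
  have hsqrt : 2 * √κ ≤ δ / 6 := by
    have h1 : √κ ≤ δ / 12 := by
      rw [Real.sqrt_le_left (by positivity)]
      exact min_le_left _ _
    linarith
  refine ⟨e₁, g, he₁, hg, hgp, ?_, ?_, fun x hex hxe => ?_⟩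
  · by_contra! h
    nlinarith
  · by_contra! h
    nlinarith [norm_nonneg g]
  · let F : A →ₗ[ℂ] A := LinearMap.mulRight ℂ g - (LinearMap.mulLeft ℂ g).comp
      (E.comp ((LinearMap.mulRight ℂ g).comp (LinearMap.mulLeft ℂ (star g))))
    have hF : ∀ x, F x = x * g - g * E (star g * x * g) := fun x => rfl
    have := hτ.norm_le_of_isStarProjection he₁ F (C := ‖g‖ + ‖g‖ * (‖g‖ * ‖g‖)) (c := δ / 6)
      (by positivity) (fun x => ?_) (fun r hr her => (hproj r hr her).trans hsqrt) hex hxe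
    · rwa [hF, mul_div_cancel₀ _ (by norm_num : (6 : ℝ) ≠ 0)] at this
    · rw [hF]
      have h1 : ‖E (star g * x * g)‖ ≤ ‖g‖ * ‖x‖ * ‖g‖ := by
        refine (hE.norm_map_le _).trans ((norm_mul_le _ _).trans ?_)
        gcongr
        exact (norm_mul_le _ _).trans_eq (by rw [norm_star])
      calc _ ≤ ‖x‖ * ‖g‖ + ‖g‖ * (‖g‖ * ‖x‖ * ‖g‖) := by
            refine (norm_sub_le _ _).trans (add_le_add (norm_mul_le _ _) ?_)
            exact (norm_mul_le _ _).trans (by gcongr)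
        _ = _ := by ring

end

/-! ### From the almost intertwiner to a commuting idempotent. -/

section

variable {A : Type*} [CStarAlgebra A] {τ : A →ₗ[ℂ] ℂ} {N : StarSubalgebra ℂ A}
  [PartialOrder A] [StarOrderedRing A] {E : A →ₗ[ℂ] A}

/-- The commutant of e is spanned by its unitaries: a selfadjoint contraction y is the mean of the
unitaries y ± i√(1 - y²), which commute with whatever commutes with y. -/
theorem map_mul_of_unitary_commute {e : A} (he : IsSelfAdjoint e) (T : A →ₗ[ℂ] A)
    (h : ∀ u ∈ unitary A, Commute e u → ∀ a, T (u * a) = u * T a) {x : A} (hx : Commute e x) (a : A) :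
    T (x * a) = x * T a := by
  have h1 : ∀ y : A, IsSelfAdjoint y → ‖y‖ ≤ 1 → Commute e y → T (y * a) = y * T a :=
    fun y hy hy1 hey => by
      let u := selfAdjoint.unitarySelfAddISMul ⟨y, hy⟩ hy1
      have hs : Commute e (CFC.sqrt (1 - y ^ 2)) :=
        (Commute.cfcₙ_nnreal (((Commute.one_left e).sub_left (hey.symm.pow_left 2))) _).symm
      have hu : Commute e u := hey.add_right (hs.smul_right _)
      have hu' : Commute e (star (u : A)) := by
        have := hu.star_star
        rwa [he.star_eq] at this
      have e1 : y = (2⁻¹ : ℝ) • ((u : A) + star (u : A)) := by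
        rw [← realPart_apply_coe]
        exact congrArg Subtype.val (selfAdjoint.realPart_unitarySelfAddISMul ⟨y, hy⟩ hy1).symm
      rw [e1, ← Complex.coe_smul, smul_mul_assoc, map_smul, add_mul, map_add, h _ u.2 hu,
        h _ (Unitary.star_mem u.2) hu', ← add_mul, smul_mul_assoc]
  have h2 : ∀ y : A, IsSelfAdjoint y → Commute e y → T (y * a) = y * T a := fun y hy hey => by
    rcases eq_or_ne y 0 with rfl | hy0
    · simp
    have hn : ‖y‖ ≠ 0 := norm_ne_zero_iff.2 hy0
    have h3 := h1 (‖y‖⁻¹ • y) ((IsSelfAdjoint.all _).smul hy)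
      (by rw [norm_smul, norm_inv, norm_norm, inv_mul_cancel₀ hn]) (hey.smul_right _)
    rw [← Complex.coe_smul, smul_mul_assoc, smul_mul_assoc, map_smul] at h3
    exact smul_right_injective A (Complex.ofReal_ne_zero.2 (inv_ne_zero hn)) h3
  have hx' : Commute e (star x) := by
    have := hx.star_star
    rwa [he.star_eq] at this
  have h3 := h2 (realPart x) (realPart x).2 (by
    rw [realPart_apply_coe]; exact (hx.add_right hx').smul_right _)
  have h4 := h2 (imaginaryPart x) (imaginaryPart x).2 (by
    rw [imaginaryPart_apply_coe]; exact ((hx.sub_right hx').smul_right _).smul_right _)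
  rw [← realPart_add_I_smul_imaginaryPart x, add_mul, map_add, h3, smul_mul_assoc, map_smul, h4,
    add_mul, smul_mul_assoc]

/-- An almost intertwining vector can be perturbed to an idempotent which commutes with the corner
`eAe` and with the right action of `N`, and whose range is a cyclic `N`-module. -/
theorem IsExpectation.exists_idempotent (hE : IsExpectation τ N E) {p : A} {L : ℝ}
    (hp : IsStarProjection p) (hpN : ∀ b ∈ N, Commute b p)
    (hL : ∀ δ > 0, ∃ e g : A, IsStarProjection e ∧ e * g = g ∧ g * p = g ∧ ‖g‖ ≤ L ∧
      1 / 2 ≤ ‖g‖ ∧ ∀ x, e * x = x → x * e = x → ‖x * g - g * E (star g * x * g)‖ ≤ δ * ‖x‖) :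
    ∃ (e ζ : A) (P : A →L[ℂ] A) (C : ℝ), IsStarProjection e ∧ e * ζ = ζ ∧ ζ * p = ζ ∧ ζ ≠ 0 ∧
      P ζ = ζ ∧ (∀ x, e * x = x → x * e = x → ∀ a, P (x * a) = x * P a) ∧
      (∀ b ∈ N, ∀ a, P (a * b) = P a * b) ∧
      ∀ a, P a = a → ∃ b ∈ N, a = ζ * b ∧ ‖b‖ ≤ C * ‖a‖ := by
  have hτ := hE.trace
  have hL0 : 1 / 2 ≤ L := by
    obtain ⟨e, g, -, -, -, h1, h2, -⟩ := hL 1 one_pos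
    exact h2.trans h1
  -- Chosen so that ‖P(P - T₀)‖ ≤ (L² + 2)·2ε = 1/4, which makes 1 - P(P - T₀) invertible, and so
  -- that 2εL ≤ 1/8 keeps P g away from 0.
  let ε := 1 / (8 * (L ^ 2 + 2))
  have hε : 0 < ε := by positivity
  have hε1 : ε * (L ^ 2 + 2) = 1 / 8 := by simp only [ε]; field_simp
  obtain ⟨η, hη, hidem⟩ := exists_idempotent_near (R := A →L[ℂ] A) (L := L ^ 2 + 2 * L) (ε := ε)
    (by positivity) hε
  -- The three bounds serve, in order, P g ≠ 0, ‖T₁ - T₀‖ ≤ ε and the defect ‖T₁² - T₁‖ ≤ η.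
  let δ := min (min (1 / 4) (ε / (2 * L))) (η / (L * (4 * L ^ 2 + 4 * L + 3)))
  have hδ : 0 < δ := by positivity
  have hδ1 : δ ≤ 1 / 4 := (min_le_left _ _).trans (min_le_left _ _)
  have hδ2 : 2 * δ * L ≤ ε := by
    have := (min_le_left (min (1 / 4) (ε / (2 * L))) (η / (L * (4 * L ^ 2 + 4 * L + 3)))).trans
      (min_le_right _ _)
    rw [le_div_iff₀ (by positivity)] at this
    linarith
  have hδ3 : δ * (L * (4 * L ^ 2 + 4 * L + 3)) ≤ η := by
    have := min_le_right (min (1 / 4) (ε / (2 * L))) (η / (L * (4 * L ^ 2 + 4 * L + 3)))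
    rwa [le_div_iff₀ (by positivity)] at this
  obtain ⟨e, g, he, heg, hgp, hgL, hg2, hD⟩ := hL δ hδ
  have hes := he.isSelfAdjoint.star_eq
  have hee := he.isIdempotentElem.eq
  have hpp := hp.isIdempotentElem.eq
  have hen : ‖e‖ ≤ 1 := he.norm_le
  have hpn : ‖p‖ ≤ 1 := hp.norm_le
  let θ := rankOne E g
  have hθ : ∀ a, θ a = g * E (star g * a) := fun a => rfl
  have hθn : ∀ a, ‖θ a‖ ≤ L ^ 2 * ‖a‖ := fun a => by
    refine (hE.norm_rankOne_le g a).trans ?_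
    rw [← sq]; gcongr
  have hθe : ∀ a, e * θ a = θ a := fun a => by rw [hθ, ← mul_assoc, heg]
  have hθp : ∀ a, θ a * p = θ a := fun a => by
    rw [hθ, mul_assoc, (hpN _ (hE.mem _)).eq, ← mul_assoc, hgp]
  have hcomm : ∀ x, e * x = x → x * e = x → ∀ a, ‖x * θ a - θ (x * a)‖ ≤ 2 * δ * L * ‖x‖ * ‖a‖ :=
    fun x hex hxe a => by
      have h1 := hD x hex hxe
      have h2 := hD (star x) (by rw [← hes, ← star_mul, hxe]) (by rw [← hes, ← star_mul, hex])
      rw [norm_star] at h2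
      have h3 : star (star x * g - g * E (star g * star x * g)) =
          star g * x - E (star g * x * g) * star g := by
        rw [star_sub, star_mul, star_star, star_mul, ← hE.map_star, star_mul, star_mul, star_star,
          star_star, mul_assoc]
      have e1 : x * θ a - θ (x * a) = (x * g - g * E (star g * x * g)) * E (star g * a) -
          g * E (star (star x * g - g * E (star g * star x * g)) * a) := by
        rw [h3, hθ, hθ, sub_mul, sub_mul, map_sub, mul_assoc (E _), hE.map_mul_left (hE.mem _),
          mul_sub]
        simp only [mul_assoc]
        abel
      have h4 : ‖E (star g * a)‖ ≤ L * ‖a‖ := by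
        refine (hE.norm_map_le _).trans ((norm_mul_le _ _).trans ?_)
        rw [norm_star]; gcongr
      have h5 : ‖E (star (star x * g - g * E (star g * star x * g)) * a)‖ ≤ δ * ‖x‖ * ‖a‖ := by
        refine (hE.norm_map_le _).trans ((norm_mul_le _ _).trans ?_)
        rw [norm_star]; gcongr
      rw [e1]
      calc _ ≤ δ * ‖x‖ * (L * ‖a‖) + L * (δ * ‖x‖ * ‖a‖) := by
            refine (norm_sub_le _ _).trans (add_le_add ?_ ?_)
            · exact (norm_mul_le _ _).trans (by gcongr)
            · exact (norm_mul_le _ _).trans (by gcongr)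
        _ = _ := by ring
  -- Averaging runs over the unitaries of A that commute with e rather than over those of eAe; their
  -- span is the whole commutant of e, which contains eAe.
  let G : Subgroup (unitary A) :=
    { carrier := {u | Commute e (u : A)}
      mul_mem' := fun hu hv => Commute.mul_right hu hv
      one_mem' := Commute.one_right e
      inv_mem' := fun {u} hu => by
        have := Commute.star_star hu
        rwa [hes] at this }
  obtain ⟨T, h, hh, hT, hTu, hTN⟩ := hE.exists_average G g
  have hTe : ∀ x, Commute e x → ∀ a, T (x * a) = x * T a := fun x hx a =>
    map_mul_of_unitary_commute he.isSelfAdjoint T (fun u hu heu => hTu ⟨u, hu⟩ heu) hx a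
  have hnear : ∀ a, e * a = a → ‖T a - θ a‖ ≤ 2 * δ * L * ‖a‖ := fun a ha => by
    refine hτ.wlim_norm_le ((hT a).sub (WLim.const (θ a))) fun n => ?_
    have hc : Convex ℝ {f : A →ₗ[ℂ] A | ‖f a - θ a‖ ≤ 2 * δ * L * ‖a‖} := by
      intro f hf f' hf' s t hs ht hst
      simp only [Set.mem_ofPred_eq, LinearMap.add_apply, LinearMap.smul_apply] at hf hf' ⊢
      have e1 : s • f a + t • f' a - θ a = s • (f a - θ a) + t • (f' a - θ a) := by
        obtain rfl : t = 1 - s := by linarith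
        module
      rw [e1]
      refine (norm_add_le _ _).trans ?_
      rw [norm_smul, norm_smul, Real.norm_of_nonneg hs, Real.norm_of_nonneg ht]
      calc s * ‖f a - θ a‖ + t * ‖f' a - θ a‖ ≤ s * (2 * δ * L * ‖a‖) + t * (2 * δ * L * ‖a‖) := by
            gcongr
        _ = _ := by rw [← add_mul, hst, one_mul]
    refine convexHull_min ?_ hc (hh n)
    rintro _ ⟨u, rfl⟩
    let w : A := ((u : unitary A) : A)
    have hw : Commute e (star w) := by
      have := Commute.star_star u.2
      rwa [hes] at this
    have hww : w * star w = 1 := Unitary.mul_star_self_of_mem (u : unitary A).2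
    have h1 := hcomm (star w * e) (by rw [← mul_assoc, hw.eq, mul_assoc, hee])
      (by rw [mul_assoc, hee]) a
    have e1 : rankOne E (w * g) a - θ a =
        -(w * (star w * e * θ a - θ (star w * e * a))) := by
      rw [mul_assoc (star w), hθe, mul_assoc (star w), ha, mul_sub, ← mul_assoc w (star w), hww,
        one_mul, rankOne_apply, hθ (star w * a), star_mul]
      simp only [mul_assoc]
      abel
    change ‖rankOne E (w * g) a - θ a‖ ≤ _
    rw [e1, norm_neg, CStarRing.norm_coe_unitary_mul (u : unitary A)]
    refine h1.trans ?_
    have h2 : ‖star w * e‖ ≤ 1 := by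
      refine le_trans (CStarRing.norm_mem_unitary_mul _ (Unitary.star_mem (u : unitary A).2)).le hen
    calc _ ≤ 2 * δ * L * 1 * ‖a‖ := by gcongr
      _ = _ := by rw [mul_one]
  have hTp : ∀ a, T a * p = T a := fun a => by
    refine hτ.wlim_unique ((hT a).mul_right p) ?_
    have e1 : ∀ n, h n a * p = h n a := fun n => by
      have hc : Convex ℝ {f : A →ₗ[ℂ] A | f a * p = f a} := by
        intro f hf f' hf' s t hs ht hst
        simp only [Set.mem_ofPred_eq, LinearMap.add_apply, LinearMap.smul_apply] at hf hf' ⊢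
        rw [add_mul, smul_mul_assoc, smul_mul_assoc, hf, hf']
      refine convexHull_min ?_ hc (hh n)
      rintro _ ⟨u, rfl⟩
      simp only [Set.mem_ofPred_eq, rankOne_apply]
      rw [mul_assoc _ _ p, (hpN _ (hE.mem _)).eq, ← mul_assoc, mul_assoc _ g p, hgp]
    simpa only [e1] using hT a
  let lm : A → A →L[ℂ] A := fun x => ContinuousLinearMap.mul ℂ A x
  let rm : A → A →L[ℂ] A := fun x => (ContinuousLinearMap.mul ℂ A).flip x
  let Q : A →L[ℂ] A := lm e * rm p
  have hQ : ∀ a, Q a = e * (a * p) := fun a => rfl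
  have hQn' : ∀ a, ‖Q a‖ ≤ ‖a‖ := fun a => by
    rw [hQ]
    calc _ ≤ 1 * (‖a‖ * 1) := (norm_mul_le _ _).trans (by
          gcongr; exact (norm_mul_le _ _).trans (by gcongr))
      _ = _ := by ring
  have hQn : ‖Q‖ ≤ 1 := ContinuousLinearMap.opNorm_le_bound _ zero_le_one fun a => by
    rw [one_mul]; exact hQn' a
  have heQ : ∀ a, e * Q a = Q a := fun a => by rw [hQ, ← mul_assoc, hee]
  have hQid : ∀ a, e * a = a → a * p = a → Q a = a := fun a h1 h2 => by rw [hQ, h2, h1]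
  have hQQ : Q * Q = Q := ContinuousLinearMap.ext fun a =>
    hQid _ (heQ a) (by change e * (a * p) * p = e * (a * p); rw [mul_assoc, mul_assoc, hpp])
  -- T₀ is g e_N g* and T₁ its average, both restricted to eAp by Q. They are compared in the Banach
  -- algebra of bounded operators on A, so P will be a bounded idempotent with no adjoint.
  let T₀ : A →L[ℂ] A := θ.mkContinuous (L ^ 2) hθn * Q
  have hT₀ : ∀ a, T₀ a = θ (Q a) := fun a => rfl
  have hT₀n' : ∀ a, ‖T₀ a‖ ≤ L ^ 2 * ‖a‖ := fun a =>
    (hθn _).trans (mul_le_mul_of_nonneg_left (hQn' a) (sq_nonneg L))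
  have hnear' : ∀ a, ‖T (Q a) - θ (Q a)‖ ≤ 2 * δ * L * ‖a‖ := fun a =>
    (hnear _ (heQ a)).trans (mul_le_mul_of_nonneg_left (hQn' a) (by positivity))
  let T₁ : A →L[ℂ] A := (T.comp (Q : A →ₗ[ℂ] A)).mkContinuous (L ^ 2 + 2 * δ * L) fun a => by
    have h1 := norm_le_norm_add_norm_sub' (T (Q a)) (θ (Q a))
    have h2 := hnear' a
    have h3 : ‖θ (Q a)‖ ≤ L ^ 2 * ‖a‖ := hT₀n' a
    calc ‖T (Q a)‖ ≤ L ^ 2 * ‖a‖ + 2 * δ * L * ‖a‖ := by linarith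
      _ = _ := by ring
  have hT₁ : ∀ a, T₁ a = T (Q a) := fun a => rfl
  have hT₁n : ‖T₁‖ ≤ L ^ 2 + 2 * L := by
    refine (LinearMap.mkContinuous_norm_le _ (by positivity) _).trans ?_
    have : 2 * δ * L ≤ 2 * 1 * L := by gcongr; linarith
    linarith
  have hT₀n : ‖T₀‖ ≤ L ^ 2 := ContinuousLinearMap.opNorm_le_bound _ (sq_nonneg L) hT₀n'
  have hdiff : ‖T₁ - T₀‖ ≤ 2 * δ * L := ContinuousLinearMap.opNorm_le_bound _ (by positivity) hnear'
  have hgE : ‖g * E (star g * g) - g‖ ≤ δ := by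
    have := hD e hee hee
    rw [heg, mul_assoc, heg, norm_sub_rev] at this
    exact this.trans (mul_le_of_le_one_right hδ.le hen)
  have hT₀T₀ : ‖T₀ * T₀ - T₀‖ ≤ δ * L := by
    refine ContinuousLinearMap.opNorm_le_bound _ (by positivity) fun a => ?_
    have e1 : (T₀ * T₀ - T₀) a = (g * E (star g * g) - g) * E (star g * Q a) := by
      change T₀ (T₀ a) - T₀ a = _
      rw [hT₀ (T₀ a), hT₀ a, hQid _ (hθe _) (hθp _), hθ (θ _), hθ, sub_mul, ← mul_assoc (star g),
        hE.map_mul_right (hE.mem _), mul_assoc g]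
    have h4 : ‖E (star g * Q a)‖ ≤ L * ‖a‖ := by
      refine (hE.norm_map_le _).trans ((norm_mul_le _ _).trans ?_)
      rw [norm_star]
      exact mul_le_mul hgL (hQn' a) (norm_nonneg _) (by positivity)
    rw [e1, mul_assoc]
    exact (norm_mul_le _ _).trans (mul_le_mul hgE h4 (norm_nonneg _) hδ.le)
  have hT₁T₁ : ‖T₁ * T₁ - T₁‖ ≤ η := by
    have e1 : T₁ * T₁ - T₁ = T₁ * (T₁ - T₀) + (T₁ - T₀) * T₀ + (T₀ * T₀ - T₀) - (T₁ - T₀) := by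
      simp only [mul_sub, sub_mul]
      abel
    rw [e1]
    calc _ ≤ (L ^ 2 + 2 * L) * (2 * δ * L) + 2 * δ * L * L ^ 2 + δ * L + 2 * δ * L := by
          refine (norm_sub_le _ _).trans (add_le_add ((norm_add_le _ _).trans (add_le_add
            ((norm_add_le _ _).trans (add_le_add ?_ ?_)) hT₀T₀)) hdiff)
          · exact (norm_mul_le _ _).trans (by gcongr)
          · exact (norm_mul_le _ _).trans (by gcongr)
      _ = δ * (L * (4 * L ^ 2 + 4 * L + 3)) := by ring
      _ ≤ η := hδ3
  obtain ⟨P₀, hP₀, hP₀n, hP₀c⟩ := hidem T₁ hT₁n hT₁T₁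
  have hT₁Q : T₁ * Q = T₁ := by
    refine ContinuousLinearMap.ext fun a => ?_
    change T (Q (Q a)) = T (Q a)
    rw [show Q (Q a) = Q a from congrArg (fun f : A →L[ℂ] A => f a) hQQ]
  have hQT₁ : Q * T₁ = T₁ := ContinuousLinearMap.ext fun a =>
    hQid _ (by change e * T (Q a) = T (Q a); rw [← hTe e (.refl e), heQ]) (hTp _)
  have hPQ : Commute P₀ Q := hP₀c Q (hT₁Q.trans hQT₁.symm)
  let P := P₀ * Q
  have hP : P * P = P := by
    change P₀ * Q * (P₀ * Q) = P₀ * Q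
    rw [mul_assoc P₀ Q, ← mul_assoc Q P₀ Q, ← hPQ.eq, mul_assoc P₀ Q Q, hQQ, ← mul_assoc, hP₀]
  have hQP : Q * P = P := by
    change Q * (P₀ * Q) = P₀ * Q
    rw [← mul_assoc, ← hPQ.eq, mul_assoc, hQQ]
  have hPn : ‖P - T₀‖ ≤ 2 * ε := by
    have e1 : P - T₀ = (P₀ - T₁) * Q + (T₁ - T₀) := by
      rw [sub_mul, hT₁Q]; simp only [P]; abel
    rw [e1]
    have h1 : ‖(P₀ - T₁) * Q‖ ≤ ε * 1 := (norm_mul_le _ _).trans (by gcongr)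
    refine (norm_add_le _ _).trans ?_
    linarith
  have hPx : ∀ x, e * x = x → x * e = x → ∀ a, P (x * a) = x * P a := fun x hex hxe a => by
    have h1 : Commute T₁ (lm x) := ContinuousLinearMap.ext fun a => by
      change T (e * (x * a * p)) = x * T (e * (a * p))
      rw [← hTe x (hex.trans hxe.symm), ← mul_assoc x e, hxe, ← mul_assoc, ← mul_assoc, hex, mul_assoc]
    have h2 : Q (x * a) = x * Q a := by
      rw [hQ, hQ, ← mul_assoc x e, hxe, ← mul_assoc, ← mul_assoc, hex, mul_assoc]
    change P₀ (Q (x * a)) = x * P₀ (Q a)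
    rw [h2]
    exact congrArg (fun f : A →L[ℂ] A => f (Q a)) (hP₀c _ h1).eq
  have hPb : ∀ b ∈ N, ∀ a, P (a * b) = P a * b := fun b hb a => by
    have h2 : ∀ a, Q (a * b) = Q a * b := fun a => by
      rw [hQ, hQ, mul_assoc a, (hpN b hb).eq]
      simp only [mul_assoc]
    have h1 : Commute T₁ (rm b) := ContinuousLinearMap.ext fun a => by
      change T (Q (a * b)) = T (Q a) * b
      rw [h2, hTN b hb]
    change P₀ (Q (a * b)) = P₀ (Q a) * b
    rw [h2]
    exact congrArg (fun f : A →L[ℂ] A => f (Q a)) (hP₀c _ h1).eq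
  have hQPa : ∀ a, Q (P a) = P a := fun a => congrArg (fun f : A →L[ℂ] A => f a) hQP
  have hPPa : ∀ a, P (P a) = P a := fun a => congrArg (fun f : A →L[ℂ] A => f a) hP
  refine ⟨e, P g, P, 2 * L, he, ?_, ?_, ?_, hPPa g, hPx, hPb, fun a ha => ?_⟩
  · rw [← hQPa, heQ]
  · rw [← hQPa, hQ, mul_assoc, mul_assoc, hpp]
  · intro h0
    have h1 : ‖(P - T₀) g‖ ≤ 2 * ε * L :=
      ((P - T₀).le_opNorm g).trans (mul_le_mul hPn hgL (norm_nonneg _) (by positivity))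
    have e1 : (P - T₀) g = -(g * E (star g * g)) := by
      change P g - θ (Q g) = _
      rw [h0, hQid g heg hgp, zero_sub]
      rfl
    rw [e1, norm_neg] at h1
    have h2 := norm_sub_norm_le g (g * E (star g * g))
    rw [norm_sub_rev] at h2
    have h3 : 2 * ε * L ≤ 1 / 8 := by nlinarith [sq_nonneg (L - 1)]
    linarith
  -- The range of P is ζN with ζ = P g: on it 1 - R acts as PT₀, since s - Rs = PT₀s = ζE(g*s).
  -- Inverting 1 - R writes every a in the range in this form, with coefficient bounded by 2L‖a‖.
  · let R := P * (P - T₀)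
    have hR : ‖R‖ ≤ 1 / 2 := by
      have h1 : ‖P‖ ≤ L ^ 2 + 2 := by
        have := norm_le_norm_add_norm_sub' P T₀
        nlinarith [sq_nonneg L]
      calc ‖R‖ ≤ (L ^ 2 + 2) * (2 * ε) := (norm_mul_le _ _).trans (by gcongr)
        _ = 2 * (ε * (L ^ 2 + 2)) := by ring
        _ ≤ 1 / 2 := by rw [hε1]; norm_num
    obtain ⟨u, hu⟩ := isUnit_one_sub_of_norm_lt_one (hR.trans_lt (by norm_num : (1 : ℝ) / 2 < 1))
    let s := (↑u⁻¹ : A →L[ℂ] A) a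
    have hs : s - R s = a := by
      have h1 : ((1 - R) * ↑u⁻¹) a = a := by rw [← hu, u.mul_inv]; rfl
      exact h1
    have hsn : ‖s‖ ≤ 2 * ‖a‖ := by
      have h1 : ‖R s‖ ≤ 1 / 2 * ‖s‖ := (R.le_opNorm s).trans (by gcongr)
      have h2 := norm_le_norm_add_norm_sub' s (R s)
      rw [hs] at h2
      linarith
    have hRs : R s = P ((P - T₀) s) := rfl
    have hPs : P s = s := by
      have h1 : s = a + R s := by rw [← hs]; abel
      rw [h1, map_add, ha, hRs, hPPa]
    have hT₀s : T₀ s = g * E (star g * s) := by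
      rw [hT₀, ← hPs, hQPa, hθ]
    refine ⟨E (star g * s), hE.mem _, ?_, ?_⟩
    · have h2 : R s = s - P g * E (star g * s) := by
        rw [hRs, sub_apply, map_sub, hPs, hPs, hT₀s, hPb _ (hE.mem _)]
      rw [h2] at hs
      rw [← hs]; abel
    · refine (hE.norm_map_le _).trans ((norm_mul_le _ _).trans ?_)
      rw [norm_star]
      calc ‖g‖ * ‖s‖ ≤ L * (2 * ‖a‖) := by gcongr
        _ = _ := by ring

end

/-! ### The embedding of a corner, and central averages. -/

section

variable {A : Type*} [CStarAlgebra A] {τ : A →ₗ[ℂ] ℂ} {N : StarSubalgebra ℂ A}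
  [PartialOrder A] [StarOrderedRing A] {E : A →ₗ[ℂ] A}

/-- If `E` has finite index on a corner `Ap`, then a corner of `A` embeds into `N` inside `A`. -/
theorem IsExpectation.exists_intertwiner (hE : IsExpectation τ N E) {p : A} {K : ℝ}
    (hp : IsStarProjection p) (hp0 : p ≠ 0) (hpN : ∀ b ∈ N, Commute b p)
    (hpK : ∀ a, a * p = a → star a * a ≤ (K : ℂ) • E (star a * a)) :
    ∃ (e v : A) (Ψ : A →ₗ[ℂ] A), IsStarProjection e ∧ e ≠ 0 ∧ v * star v = e ∧ (∀ x, Ψ x ∈ N) ∧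
      (∀ x, Ψ (star x) = star (Ψ x)) ∧
      (∀ x y, e * x = x → x * e = x → e * y = y → y * e = y → Ψ (x * y) = Ψ x * Ψ y) ∧
      ∀ x, e * x = x → x * e = x → x * v = v * Ψ x := by
  have hτ := hE.trace
  obtain ⟨L, hL⟩ := hE.exists_almost_intertwiner hp hp0 hpN hpK
  obtain ⟨e, ζ, P, C, he, heζ, hζp, hζ0, hPζ, hPx, hPb, hC⟩ := hE.exists_idempotent hp hpN hL
  let c := E (star ζ * ζ)
  have hcN : c ∈ N := hE.mem _
  have hc0 : 0 ≤ c := hE.map_nonneg (star_mul_self_nonneg ζ)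
  -- The size of the spectral gap of c = E(ζ*ζ) above 0; it is tuned to C²|K|t < 1.
  let t := 1 / (C ^ 2 * |K| + 1)
  have ht : 0 < t := by positivity
  have htC : C ^ 2 * |K| * t < 1 := by
    simp only [t]
    rw [mul_one_div, div_lt_one (by positivity)]
    exact lt_add_one _
  obtain ⟨q, hqN, hq, hqc, hcq, hq0, -⟩ := hE.weakCompact.exists_support hτ hc0 hcN
  obtain ⟨s, hsN, hs, hsc, -, hts, hst, -⟩ := hE.weakCompact.exists_spectralCut hτ hc0 hcN ht
  have hcs : Commute c s := (hsc c (.refl c)).symm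
  have hsq : Commute s q := hsc q (hcq.trans hqc.symm)
  have hqq := hq.isIdempotentElem.eq
  have h1s := hs.one_sub
  -- The spectral part n of c in (0, t] vanishes. Finite index gives ‖ζn‖² ≤ |K|t. Writing ζn = ζb
  -- with ‖b‖ ≤ C‖ζn‖, the relation c(n - b) = 0 gives n = qb. So ‖n‖² ≤ C²|K|t < 1, which is
  -- impossible for a nonzero projection.
  have hn0 : q * (1 - s) = 0 := by
    let n := q * (1 - s)
    have hnN : n ∈ N := mul_mem hqN (sub_mem (one_mem N) hsN)
    have hqs' : Commute q (1 - s) := (Commute.one_right q).sub_right hsq.symm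
    have hns : star n = n := by
      rw [star_mul, hq.isSelfAdjoint.star_eq, h1s.isSelfAdjoint.star_eq, ← hqs'.eq]
    have hnn : n * n = n := by
      simp only [n]
      rw [mul_assoc, ← mul_assoc (1 - s), ← hqs'.eq, mul_assoc q, h1s.isIdempotentElem.eq,
        ← mul_assoc, hqq]
    have hcn : c * n = c * (1 - s) := by rw [← mul_assoc, hcq]
    have hncn : star n * c * n = c * (1 - s) := by
      have h1 : Commute c n := (show Commute c q from hcq.trans hqc.symm).mul_right
        ((Commute.one_right c).sub_right hcs)
      rw [hns, ← h1.eq, mul_assoc, hnn, hcn]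
    have h1 : ‖ζ * n‖ ^ 2 ≤ |K| * t := by
      have h2 := hpK (ζ * n) (by rw [mul_assoc, (hpN n hnN).eq, ← mul_assoc, hζp])
      have h3 : E (star (ζ * n) * (ζ * n)) = c * (1 - s) := by
        rw [star_mul, ← mul_assoc, mul_assoc (star n), hE.map_mul_right hnN,
          hE.map_mul_left (star_mem hnN), hncn]
      have h4 := CStarAlgebra.norm_le_norm_of_nonneg_of_le (star_mul_self_nonneg (ζ * n)) h2
      have h5 : 0 ≤ c * (1 - s) := Commute.mul_nonneg hc0 h1s.nonneg
        ((Commute.one_right c).sub_right hcs)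
      have h6 := CStarAlgebra.norm_le_norm_of_nonneg_of_le h5 hst
      rw [norm_smul, Complex.norm_real, Real.norm_of_nonneg ht.le] at h6
      rw [h3, CStarRing.norm_star_mul_self, norm_smul, Complex.norm_real, Real.norm_eq_abs, ← sq] at h4
      refine h4.trans (mul_le_mul_of_nonneg_left (h6.trans ?_) (abs_nonneg K))
      exact mul_le_of_le_one_right ht.le h1s.norm_le
    obtain ⟨b, hbN, hb, hbn⟩ := hC (ζ * n) (by rw [hPb n hnN, hPζ])
    have h2 : c * (n - b) = 0 := by
      have h3 : ∀ d ∈ N, c * d = E (star ζ * (ζ * d)) := fun d hd => by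
        rw [← mul_assoc, hE.map_mul_right hd]
      rw [mul_sub, h3 n hnN, h3 b hbN, hb, sub_self]
    have h3 : n = q * b := by
      have := hq0 _ h2
      rw [mul_sub, sub_eq_zero, ← mul_assoc, hqq] at this
      exact this
    have h4 : ‖n‖ ≤ C * ‖ζ * n‖ := by
      rw [h3]
      refine (norm_mul_le _ _).trans (le_trans ?_ (h3 ▸ hbn))
      exact mul_le_of_le_one_left (norm_nonneg b) hq.norm_le
    have h5 : ‖n‖ * ‖n‖ = ‖n‖ := by rw [← CStarRing.norm_star_mul_self, hns, hnn]
    by_contra h6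
    have h7 : ‖n‖ = 1 := (mul_eq_left₀ (norm_ne_zero_iff.2 h6)).1 h5
    have h8 : (1 : ℝ) ≤ C ^ 2 * (|K| * t) := by
      rw [h7] at h4
      calc (1 : ℝ) ≤ (C * ‖ζ * n‖) ^ 2 := one_le_pow₀ h4
        _ = C ^ 2 * ‖ζ * n‖ ^ 2 := mul_pow _ _ _
        _ ≤ _ := by gcongr
    linarith
  have hc1s : c * (1 - s) = 0 := by rw [← hcq, mul_assoc, hn0, mul_zero]
  have hcs' : c * s = c := by
    rw [mul_sub, mul_one, sub_eq_zero] at hc1s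
    exact hc1s.symm
  have hss := hs.isSelfAdjoint.star_eq
  have hζs : ζ * s = ζ := by
    have : ζ * (1 - s) = 0 := hE.eq_zero_of_map_star_mul (by
      rw [star_mul, ← mul_assoc, mul_assoc (star _), hE.map_mul_right (sub_mem (one_mem N) hsN),
        hE.map_mul_left (star_mem (sub_mem (one_mem N) hsN)), mul_assoc, hc1s, mul_zero])
    rw [mul_sub, mul_one, sub_eq_zero] at this
    exact this.symm
  obtain ⟨w, hwN, w', hw'N, hw, hww', -, hwc, hws⟩ := hE.weakCompact.exists_invSqrt hτ hc0 hcN ht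
  have hwwc : w * w * c = s := by
    have := hws s hs hcs hts
    rwa [hcs'] at this
  -- Thanks to the gap, w acts as c^(-1/2) on the support of c, so ξ generates the same module as ζ
  -- and E(ξ*ξ) is the projection s. This makes the coefficient E(ξ*a) of an element of ξN
  -- canonical, and Ψ multiplicative.
  obtain ⟨ξ, hξ⟩ : ∃ ξ, ξ = ζ * w := ⟨_, rfl⟩
  have hξN : E (star ξ * ξ) = s := by
    rw [hξ, star_mul, ← mul_assoc, mul_assoc (star w), hE.map_mul_right hwN,
      hE.map_mul_left (star_mem hwN), hw.star_eq, mul_assoc, ← (hwc c (.refl c)).eq, ← mul_assoc, hwwc]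
  have hξs : ξ * s = ξ := by rw [hξ, mul_assoc, (hwc s hcs).eq, ← mul_assoc, hζs]
  have heξ : e * ξ = ξ := by rw [hξ, ← mul_assoc, heζ]
  have hξ0 : ξ ≠ 0 := fun h => hζ0 (by
    rw [← mul_one ζ, ← hww', ← mul_assoc, ← hξ, h, zero_mul])
  have hPξ : P ξ = ξ := by rw [hξ, hPb w hwN, hPζ]
  have hrange : ∀ a, P a = a → a = ξ * E (star ξ * a) := fun a ha => by
    obtain ⟨b, hbN, hb, -⟩ := hC a ha
    have h1 : a = ξ * (w' * b) := by
      rw [hb, hξ, ← mul_assoc, mul_assoc ζ w w', hww', mul_one]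
    rw [h1, ← mul_assoc (star ξ), hE.map_mul_right (mul_mem hw'N hbN), hξN, ← mul_assoc ξ s, hξs]
  let Ψ : A →ₗ[ℂ] A :=
    E.comp ((LinearMap.mulRight ℂ ξ).comp (LinearMap.mulLeft ℂ (star ξ)))
  have hΨ : ∀ x, Ψ x = E (star ξ * x * ξ) := fun x => rfl
  have hxξ : ∀ x, e * x = x → x * e = x → x * ξ = ξ * Ψ x := fun x hex hxe => by
    have := hrange (x * ξ) (by rw [hPx x hex hxe, hPξ])
    rwa [← mul_assoc (star ξ)] at this
  have hΨstar : ∀ x, Ψ (star x) = star (Ψ x) := fun x => by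
    rw [hΨ, hΨ, ← hE.map_star, star_mul (star ξ * x), star_mul, star_star, mul_assoc]
  have hsΨ : ∀ x, s * Ψ x = Ψ x := fun x => by
    have h1 : s * star ξ = star ξ := by
      have := congrArg star hξs
      rwa [star_mul, hss] at this
    rw [hΨ, ← hE.map_mul_left hsN, ← mul_assoc s, ← mul_assoc s, h1]
  have hΨmul : ∀ x y, e * x = x → x * e = x → e * y = y → y * e = y → Ψ (x * y) = Ψ x * Ψ y :=
    fun x y hex hxe hey hye => by
      have h1 : ξ * Ψ (x * y) = ξ * (Ψ x * Ψ y) := by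
        rw [← hxξ (x * y) (by rw [← mul_assoc, hex]) (by rw [mul_assoc, hye]), mul_assoc,
          hxξ y hey hye, ← mul_assoc, hxξ x hex hxe, mul_assoc]
      have h2 : ∀ d ∈ N, E (star ξ * (ξ * d)) = s * d := fun d hd => by
        rw [← mul_assoc, hE.map_mul_right hd, hξN]
      have h3 := h2 (Ψ (x * y)) (hE.mem _)
      rw [h1, h2 (Ψ x * Ψ y) (mul_mem (hE.mem _) (hE.mem _)), hsΨ, ← mul_assoc, hsΨ] at h3
      exact h3.symm
  -- Polar decomposition on the other side: D commutes with eAe, so ξ can be cut by a spectral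
  -- projection e₂ of D and multiplied by D^(-1/2) there without spoiling the intertwining relation.
  -- The result is a partial isometry with range projection e₂.
  let D := ξ * star ξ
  have hD0 : 0 ≤ D := mul_star_self_nonneg ξ
  have hDne : D ≠ 0 := fun h => hξ0 ((CStarRing.mul_star_self_eq_zero_iff ξ).1 h)
  have hDt : 0 < ‖D‖ / 2 := half_pos (norm_pos_iff.2 hDne)
  have hDx : ∀ x, e * x = x → x * e = x → Commute D x := fun x hex hxe => by
    have hes := he.isSelfAdjoint.star_eq
    have h1 := hxξ (star x) (by rw [← hes, ← star_mul, hxe]) (by rw [← hes, ← star_mul, hex])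
    have h2 : star ξ * x = Ψ x * star ξ := by
      have := congrArg star h1
      rwa [star_mul, star_star, star_mul ξ, hΨstar, star_star] at this
    change ξ * star ξ * x = x * (ξ * star ξ)
    rw [mul_assoc, h2, ← mul_assoc, ← mul_assoc, hxξ x hex hxe]
  obtain ⟨e₂, -, he₂, he₂c, he₂0, he₂t, -, he₂n⟩ := hτ.weakCompact_top.exists_spectralCut hτ hD0
    (trivial : D ∈ (⊤ : StarSubalgebra ℂ A)) hDt
  obtain ⟨W, -, -, -, hW, -, -, hWc, hWs⟩ := hτ.weakCompact_top.exists_invSqrt hτ hD0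
    (trivial : D ∈ (⊤ : StarSubalgebra ℂ A)) hDt
  have hDe₂ : Commute D e₂ := (he₂c D (.refl D)).symm
  have hWD := hWs e₂ he₂ hDe₂ he₂t
  have he₂s := he₂.isSelfAdjoint.star_eq
  have he₂2 := he₂.isIdempotentElem.eq
  have he₂e : e₂ * e = e₂ := by
    have h1 : D * e = D := by
      have := congrArg star heξ
      rw [star_mul, he.isSelfAdjoint.star_eq] at this
      rw [mul_assoc, this]
    have := he₂0 (1 - e) (by rw [mul_sub, mul_one, h1, sub_self])
    rw [mul_sub, mul_one, sub_eq_zero] at this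
    exact this.symm
  have hee₂ : e * e₂ = e₂ := by
    have := congrArg star he₂e
    rwa [star_mul, he₂s, he.isSelfAdjoint.star_eq] at this
  have hsub : ∀ x, e₂ * x = x → x * e₂ = x → e * x = x ∧ x * e = x := fun x h1 h2 =>
    ⟨by rw [← h1, ← mul_assoc, hee₂], by rw [← h2, mul_assoc, he₂e]⟩
  refine ⟨e₂, W * e₂ * ξ, Ψ, he₂, he₂n (half_lt_self (norm_pos_iff.2 hDne)), ?_,
    fun x => hE.mem _, hΨstar, fun x y h1 h2 h3 h4 => ?_, fun x h1 h2 => ?_⟩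
  · rw [star_mul (W * e₂), star_mul W, hW.star_eq, he₂s]
    calc W * e₂ * ξ * (star ξ * (e₂ * W)) = W * (e₂ * D * (e₂ * W)) := by
          simp only [D, mul_assoc]
      _ = W * (W * (D * e₂)) := by
          rw [← (hWc e₂ hDe₂).eq, ← hDe₂.eq, ← mul_assoc (D * e₂), ← (hWc _
            ((Commute.refl D).mul_right hDe₂)).eq, mul_assoc W, mul_assoc D, he₂2]
      _ = e₂ := by rw [← mul_assoc, hWD]
  · exact hΨmul x y (hsub x h1 h2).1 (hsub x h1 h2).2 (hsub y h3 h4).1 (hsub y h3 h4).2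
  · have hx := hDx x (hsub x h1 h2).1 (hsub x h1 h2).2
    rw [mul_assoc (W * e₂), ← hxξ x (hsub x h1 h2).1 (hsub x h1 h2).2, ← mul_assoc, ← mul_assoc,
      ← mul_assoc (W * e₂), mul_assoc W e₂ x, (he₂c x hx).eq, ← mul_assoc, (hWc x hx).eq]

/-- The element of minimal `2`-norm in the closed convex hull of the unitary orbit of `e`. -/
theorem IsWStarTrace.exists_central_average (hτ : IsWStarTrace τ) (e : A) :
    ∃ (S : ℕ → A) (c : A),
      (∀ n, S n ∈ convexHull ℝ (Set.range fun u : unitary A => (u : A) * e * star (u : A))) ∧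
      Tendsto (fun n => l2norm τ (S n - c)) atTop (𝓝 0) ∧ ∀ a, Commute c a := by
  set Co := convexHull ℝ (Set.range fun u : unitary A => (u : A) * e * star (u : A)) with hCo
  have hconj : ∀ u ∈ unitary A, ∀ x ∈ Co, u * x * star u ∈ Co := fun u hu x hx => by
    have hc : Convex ℝ {x : A | u * x * star u ∈ Co} := by
      intro x hx y hy s t hs ht hst
      simp only [Set.mem_ofPred_eq, mul_add, add_mul, mul_smul_comm, smul_mul_assoc] at hx hy ⊢
      exact convex_convexHull ℝ _ hx hy hs ht hst
    refine convexHull_min ?_ hc hx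
    rintro _ ⟨w, rfl⟩
    refine subset_convexHull ℝ _ ⟨⟨u, hu⟩ * w, ?_⟩
    simp only [Submonoid.coe_mul, star_mul, mul_assoc]
  have hl2u : ∀ u ∈ unitary A, ∀ x, l2norm τ (u * x * star u) ≤ l2norm τ x := fun u hu x => by
    refine le_of_eq (congrArg (fun z => √(z : ℂ).re) ?_)
    rw [hτ.tracial, star_mul, star_star, star_mul]
    have h1 := Unitary.star_mul_self_of_mem hu
    calc τ (u * x * star u * (u * (star x * star u))) = τ (u * (x * (star u * u) * star x * star u)) := by
          simp only [mul_assoc]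
      _ = τ (star x * x) := by
          rw [h1, mul_one, hτ.tracial, mul_assoc, h1, mul_one, hτ.tracial]
  have hne : Co.Nonempty := ⟨_, subset_convexHull ℝ _ ⟨1, rfl⟩⟩
  let I : ℝ := sInf ((fun x => l2norm τ x ^ 2) '' Co)
  have hI : ∀ x ∈ Co, I ≤ l2norm τ x ^ 2 := fun x hx =>
    csInf_le ⟨0, by rintro _ ⟨ν, -, rfl⟩; exact sq_nonneg _⟩ ⟨x, hx, rfl⟩
  have hseq : ∀ n : ℕ, ∃ x ∈ Co, l2norm τ x ^ 2 < I + 1 / ((n : ℝ) + 1) := fun n => by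
    obtain ⟨_, ⟨x, h1, rfl⟩, h⟩ := exists_lt_of_csInf_lt (hne.image _)
      (lt_add_of_pos_right I (by positivity : (0 : ℝ) < 1 / ((n : ℝ) + 1)))
    exact ⟨x, h1, h⟩
  -- Parallelogram law, as the midpoint stays in the convex hull. It makes minimising sequences
  -- Cauchy in 2-norm and their limit invariant under conjugation.
  have hpar : ∀ x ∈ Co, ∀ y ∈ Co, ∀ r, l2norm τ x ^ 2 ≤ I + r → l2norm τ y ^ 2 ≤ I + r →
      l2norm τ (x - y) ^ 2 ≤ 4 * r := fun x hx y hy r hxr hyr => by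
    have h1 := hI _ (convex_convexHull ℝ _ hx hy (by norm_num : (0 : ℝ) ≤ 1 / 2)
      (by norm_num : (0 : ℝ) ≤ 1 / 2) (by norm_num))
    rw [← smul_add, ← Complex.coe_smul, hτ.l2_smul, mul_pow, hτ.l2_add_sq, Complex.norm_real] at h1
    rw [hτ.l2_sub_sq]
    norm_num at h1
    linarith
  choose S hS hSlt using hseq
  have hbd : ∀ n, ‖S n‖ ≤ ‖e‖ := fun n => by
    have : Co ⊆ Metric.closedBall 0 ‖e‖ := convexHull_min (by
      rintro _ ⟨u, rfl⟩
      rw [mem_closedBall_zero_iff]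
      exact ((CStarRing.norm_mul_mem_unitary _ (Unitary.star_mem u.2)).trans
        (CStarRing.norm_coe_unitary_mul u e)).le) (convex_closedBall _ _)
    exact mem_closedBall_zero_iff.1 (this (hS n))
  obtain ⟨c, hc, -⟩ := hτ.exists_wlim hbd
  have hSc : ∀ n, l2norm τ (S n - c) ≤ √(4 * (1 / ((n : ℝ) + 1))) := fun n => by
    refine hτ.l2_le_of_wlim ((WLim.const (S n)).sub hc) ?_
    filter_upwards [eventually_ge_atTop n] with m hm
    refine Real.le_sqrt_of_sq_le (hpar _ (hS n) _ (hS m) _ (hSlt n).le ((hSlt m).le.trans ?_))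
    have : (n : ℝ) ≤ m := by exact_mod_cast hm
    gcongr
  have hlim : Tendsto (fun n : ℕ => √(4 * (1 / ((n : ℝ) + 1)))) atTop (𝓝 0) := by
    have := ((tendsto_one_div_add_atTop_nhds_zero_nat (𝕜 := ℝ)).const_mul 4).sqrt
    rwa [mul_zero, Real.sqrt_zero] at this
  refine ⟨S, c, hS, squeeze_zero (fun _ => hτ.l2_nonneg _) hSc hlim, fun a => ?_⟩
  have hcu : ∀ u ∈ unitary A, u * c * star u = c := fun u hu => by
    refine sub_eq_zero.1 (hτ.l2_eq_zero (le_antisymm ?_ (hτ.l2_nonneg _)))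
    have h1 : ∀ n : ℕ, l2norm τ (u * c * star u - c) ≤ 3 * √(4 * (1 / ((n : ℝ) + 1))) := fun n => by
      have h2 : l2norm τ (u * (c - S n) * star u) ≤ √(4 * (1 / ((n : ℝ) + 1))) := by
        refine (hl2u u hu _).trans ?_
        rw [← hτ.l2_neg, neg_sub]
        exact hSc n
      have h3 : l2norm τ (u * S n * star u - S n) ≤ √(4 * (1 / ((n : ℝ) + 1))) :=
        Real.le_sqrt_of_sq_le (hpar _ (hconj u hu _ (hS n)) _ (hS n) _
          ((pow_le_pow_left₀ (hτ.l2_nonneg _) (hl2u u hu _) 2).trans (hSlt n).le) (hSlt n).le)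
      have e1 : u * c * star u - c = u * (c - S n) * star u + (u * S n * star u - S n) + (S n - c) := by
        rw [mul_sub, sub_mul]; abel
      rw [e1]
      refine (hτ.l2_add_le _ _).trans ?_
      linarith [hτ.l2_add_le (u * (c - S n) * star u) (u * S n * star u - S n), hSc n]
    have h4 := hlim.const_mul 3
    rw [mul_zero] at h4
    exact ge_of_tendsto' h4 h1
  have ha : a ∈ Submodule.span ℂ (unitary A : Set A) := by
    rw [CStarAlgebra.span_unitary]; trivial
  induction ha using Submodule.span_induction with
  | mem u hu =>
    have := congrArg (· * u) (hcu u hu)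
    simp only [mul_assoc, Unitary.star_mul_self_of_mem hu, mul_one] at this
    exact this.symm
  | zero => exact Commute.zero_right c
  | add x y _ _ hx hy => exact hx.add_right hy
  | smul r x _ hx => exact hx.smul_right r

end

/-! ### An embedded corner keeps unitaries from leaving N. -/

section

variable {A : Type*} [CStarAlgebra A] {τ : A →ₗ[ℂ] ℂ} {N : StarSubalgebra ℂ A}
  [PartialOrder A] [StarOrderedRing A] {E : A →ₗ[ℂ] A}

/-- If a corner `eAe` embeds into `N` inside `A`, then no sequence of unitaries leaves `N`. -/
theorem IsExpectation.not_tendsto_of_intertwiner (hE : IsExpectation τ N E) {e v : A} {Ψ : A → A}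
    (he : IsStarProjection e) (hv : v ≠ 0) (hev : e * v = v) (hΨN : ∀ x, Ψ x ∈ N)
    (hΨs : ∀ x, Ψ (star x) = star (Ψ x)) (hΨ : ∀ x, e * x = x → x * e = x → x * v = v * Ψ x)
    {u : ℕ → A} (hu : ∀ n, u n ∈ unitary A) :
    ¬ ∀ x, Tendsto (fun n => l2norm τ (E (u n * x))) atTop (𝓝 0) := by
  intro hlim
  have hτ := hE.trace
  have hes := he.isSelfAdjoint.star_eq
  have hee := he.isIdempotentElem.eq
  let θ := rankOne E v
  have hθ : ∀ a, θ a = v * E (star v * a) := fun a => rfl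
  have hθx : ∀ x, e * x = x → x * e = x → ∀ a, θ (x * a) = x * θ a := fun x hex hxe a => by
    have h1 := hΨ (star x) (by rw [← hes, ← star_mul, hxe]) (by rw [← hes, ← star_mul, hex])
    have h2 : star v * x = Ψ x * star v := by
      have := congrArg star h1
      rwa [star_mul, star_star, star_mul, hΨs, star_star] at this
    rw [hθ, hθ, ← mul_assoc, h2, mul_assoc, hE.map_mul_left (hΨN x), ← mul_assoc, ← mul_assoc,
      hΨ x hex hxe]
  have heθ : ∀ a, e * θ a = θ a := fun a => by rw [hθ, ← mul_assoc, hev]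
  have hθe : ∀ a, θ (e * a) = θ a := fun a => by rw [hθx e hee hee, heθ]
  -- Linearity of θ over eAe, applied to e m w e: on a conjugate of e the map m ↦ θ(m ·) becomes
  -- right multiplication by a bounded element, cut by e.
  have hθu : ∀ w ∈ unitary A, ∀ m, θ (m * (w * e * star w)) = e * m * (w * θ (star w)) :=
    fun w _ m => by
      rw [← hθe, ← heθ (star w), ← mul_assoc w e, ← mul_assoc (e * m) (w * e), ← mul_assoc (e * m) w,
        ← hθx (e * m * w * e) (by simp only [← mul_assoc, hee]) (by rw [mul_assoc, hee])]
      simp only [mul_assoc]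
  have hθn : ∀ a, ‖θ a‖ ≤ ‖v‖ * ‖v‖ * ‖a‖ := hE.norm_rankOne_le v
  set Co := convexHull ℝ (Set.range fun u : unitary A => (u : A) * e * star (u : A)) with hCo
  obtain ⟨S, c, hS, hSc, hc⟩ := hτ.exists_central_average e
  have hpartner : ∀ x ∈ Co, ∃ F, ‖F‖ ≤ ‖v‖ * ‖v‖ * ‖(1 : A)‖ ∧ ∀ m, θ (m * x) = e * m * F := by
    intro x hx
    have hcv : Convex ℝ {x : A | ∃ F, ‖F‖ ≤ ‖v‖ * ‖v‖ * ‖(1 : A)‖ ∧ ∀ m, θ (m * x) = e * m * F} := by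
      rintro x ⟨F, hF, hFm⟩ x' ⟨F', hF', hFm'⟩ s t hs ht hst
      refine ⟨s • F + t • F', ?_, fun m => ?_⟩
      · refine (norm_add_le _ _).trans ?_
        rw [norm_smul, norm_smul, Real.norm_of_nonneg hs, Real.norm_of_nonneg ht]
        calc s * ‖F‖ + t * ‖F'‖ ≤ s * (‖v‖ * ‖v‖ * ‖(1 : A)‖) + t * (‖v‖ * ‖v‖ * ‖(1 : A)‖) := by
              gcongr
          _ = _ := by rw [← add_mul, hst, one_mul]
      · simp only [← Complex.coe_smul, mul_add, mul_smul_comm, map_add, map_smul, hFm, hFm']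
    refine convexHull_min ?_ hcv hx
    rintro _ ⟨w, rfl⟩
    refine ⟨w * θ (star (w : A)), ?_, hθu w w.2⟩
    rw [CStarRing.norm_coe_unitary_mul]
    refine (hθn _).trans (le_of_eq ?_)
    rw [norm_star, ← CStarRing.norm_coe_unitary_mul w 1, mul_one]
  choose F hFn hFm using fun n => hpartner _ (hS n)
  obtain ⟨f, hf, -⟩ := hτ.exists_wlim hFn
  have hSw : WLim τ S c := hτ.wlim_of_l2 hSc
  have hce : e * (c * e) = c * e := by rw [← mul_assoc, ← (hc e).eq, mul_assoc, hee]
  -- In the limit the conjugates of e average to the central c, which passes through θ because ce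
  -- lies in eAe.
  have hmf : ∀ m, e * m * f = c * θ m := fun m => by
    have h1 : WLim τ (fun n => θ (m * S n)) (θ (m * c)) :=
      hτ.wlim_mul_left (hE.wlim (hτ.wlim_mul_left (hτ.wlim_mul_left hSw m) (star v))) v
    have h2 := hτ.wlim_mul_left hf (e * m)
    simp only [← hFm] at h2
    rw [hτ.wlim_unique h2 h1, ← (hc m).eq, ← hθe, ← mul_assoc, ← (hc e).eq,
      hθx (c * e) hce (by rw [mul_assoc, hee]), mul_assoc, heθ]
  -- By centrality c = uₖ c uₖ*, and c is 2-norm close to Sₙ. For a conjugate wew* in place of c,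
  -- `hmf` turns uₖ(wew*)uₖ* f into uₖ w c v E(v* w* uₖ*), which tends to 0 since ‖E(uₖ w v)‖₂ does.
  have hcf : c * f = 0 := by
    refine hτ.ext fun X => ?_
    rw [zero_mul, map_zero]
    have hzero : ∀ x ∈ Co, Tendsto (fun k => τ (u k * x * star (u k) * f * X)) atTop (𝓝 0) := by
      intro x hx
      have hcv : Convex ℝ
          {x : A | Tendsto (fun k => τ (u k * x * star (u k) * f * X)) atTop (𝓝 0)} := by
        intro x hx y hy s t _ _ _
        simp only [Set.mem_ofPred_eq] at hx hy ⊢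
        have := (hx.const_mul (s : ℂ)).add (hy.const_mul (t : ℂ))
        simpa only [← Complex.coe_smul, mul_add, add_mul, mul_smul_comm, smul_mul_assoc, map_add,
          map_smul, smul_eq_mul, mul_zero, add_zero] using this
      refine convexHull_min ?_ hcv hx
      rintro _ ⟨w, rfl⟩
      simp only [Set.mem_ofPred_eq]
      let B := ‖X‖ * ‖(w : A) * c * v‖
      have e1 : ∀ k, τ (u k * (w * e * star (w : A)) * star (u k) * f * X) =
          τ (E (star v * (star (w : A) * star (u k))) * (X * (u k * (w * c * v)))) := fun k => by
        have h1 := hmf (star (w : A) * star (u k))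
        have h2 : u k * (w * e * star (w : A)) * star (u k) * f * X =
            u k * w * (e * (star (w : A) * star (u k)) * f) * X := by simp only [mul_assoc]
        rw [h2, h1, hθ, ← hτ.tracial]
        rw [show u k * w * (c * (v * E (star v * (star (w : A) * star (u k))))) =
          u k * (w * c * v) * E (star v * (star (w : A) * star (u k))) by simp only [mul_assoc],
          ← mul_assoc, hτ.tracial]
      have h3 : Tendsto (fun k => l2norm τ (E (u k * (w * v))) * B) atTop (𝓝 0) := by
        simpa only [zero_mul] using (hlim (w * v)).mul_const B
      refine squeeze_zero_norm (fun k => ?_) h3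
      rw [e1]
      refine (hτ.norm_map_mul_le _ _).trans ?_
      have h4 : l2norm τ (E (star v * (star (w : A) * star (u k)))) =
          l2norm τ (E (u k * (w * v))) := by
        rw [← hτ.l2_star, ← hE.map_star]
        simp only [star_mul, star_star, mul_assoc]
      have h5 : l2norm τ (X * (u k * (w * c * v))) ≤ B := by
        refine (hτ.l2_le_norm _).trans ((norm_mul_le _ _).trans ?_)
        rw [CStarRing.norm_mem_unitary_mul _ (hu k)]
      rw [h4]
      exact mul_le_mul_of_nonneg_left h5 (hτ.l2_nonneg _)
    have hbd : ∀ n, ‖τ (c * f * X)‖ ≤ l2norm τ (S n - c) * ‖f * X‖ := fun n => by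
      have e1 : ∀ k, τ (c * f * X) - τ (u k * S n * star (u k) * f * X) =
          -τ ((S n - c) * (star (u k) * (f * X) * u k)) := fun k => by
        have h1 : c = u k * c * star (u k) := by
          rw [← (hc _).eq, mul_assoc, Unitary.mul_star_self_of_mem (hu k), mul_one]
        have h2 : c * f * X - u k * S n * star (u k) * f * X =
            u k * ((c - S n) * (star (u k) * (f * X))) := by
          conv_lhs => rw [h1]
          simp only [mul_sub, sub_mul, mul_assoc]
        rw [← map_sub, ← map_neg, ← neg_mul, neg_sub, h2, hτ.tracial, mul_assoc]
      have h2 : ∀ k, ‖τ (c * f * X) - τ (u k * S n * star (u k) * f * X)‖ ≤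
          l2norm τ (S n - c) * ‖f * X‖ := fun k => by
        rw [e1, norm_neg]
        refine (hτ.norm_map_mul_le _ _).trans (mul_le_mul_of_nonneg_left ?_ (hτ.l2_nonneg _))
        refine (hτ.l2_le_norm _).trans ?_
        rw [CStarRing.norm_mul_mem_unitary _ (hu k),
          CStarRing.norm_mem_unitary_mul _ (Unitary.star_mem (hu k))]
      have h3 := ((hzero _ (hS n)).const_sub (τ (c * f * X))).norm
      rw [sub_zero] at h3
      exact le_of_tendsto' h3 h2
    have h4 := hSc.mul_const ‖f * X‖
    rw [zero_mul] at h4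
    exact norm_le_zero_iff.1 (ge_of_tendsto' h4 hbd)
  have hc0 : 0 ≤ c := by
    refine hτ.wlim_nonneg hSw fun n => ?_
    refine convexHull_min ?_ (convex_Ici (𝕜 := ℝ) (0 : A)) (hS n)
    rintro _ ⟨w, rfl⟩
    exact star_right_conjugate_nonneg he.nonneg (w : A)
  have hcs : star c = c := (IsSelfAdjoint.of_nonneg hc0).star_eq
  have hcθ : c * θ v = 0 := by
    have h1 : c * (c * θ v) = 0 := by
      rw [← hmf v, ← mul_assoc, ((hc (e * v))).eq, mul_assoc, hcf, mul_zero]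
    refine (CStarRing.star_mul_self_eq_zero_iff _).1 ?_
    rw [star_mul, hcs, mul_assoc, h1, mul_zero]
  obtain ⟨z, -, hz, hzc, hcz, hz0, hzy⟩ := hτ.weakCompact_top.exists_support hτ hc0
    (trivial : c ∈ (⊤ : StarSubalgebra ℂ A))
  have hzc' : ∀ y, Commute z y := fun y => hzy y (hc y)
  have h1z : IsStarProjection (1 - z) := hz.one_sub
  have hcz' : c * (1 - z) = 0 := by rw [mul_sub, mul_one, hcz, sub_self]
  -- The support z of c is central, so averaging does not change τ(·(1 - z)). Its value at c is 0,
  -- hence e ≤ z.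
  have htr : ∀ x ∈ Co, τ (x * (1 - z)) = τ (e * (1 - z)) := by
    intro x hx
    have hcv : Convex ℝ {x : A | τ (x * (1 - z)) = τ (e * (1 - z))} := by
      intro x hx y hy s t _ _ hst
      simp only [Set.mem_ofPred_eq] at hx hy ⊢
      rw [add_mul, map_add, ← Complex.coe_smul, ← Complex.coe_smul, smul_mul_assoc, smul_mul_assoc,
        map_smul, map_smul, hx, hy, ← add_smul, ← Complex.ofReal_add, hst, Complex.ofReal_one,
        one_smul]
    refine convexHull_min ?_ hcv hx
    rintro _ ⟨w, rfl⟩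
    have h2 : Commute (1 - z) (star (w : A)) := (Commute.one_left _).sub_left (hzc' _)
    simp only [Set.mem_ofPred_eq]
    rw [mul_assoc, ← h2.eq, hτ.tracial, mul_assoc (1 - z), ← mul_assoc (star (w : A)),
      Unitary.coe_star_mul_self, one_mul, hτ.tracial]
  have hez : e * (1 - z) = 0 := by
    have h1 : τ (e * (1 - z)) = 0 := by
      have h2 := hSw (1 - z)
      simp only [htr _ (hS _), hcz', map_zero] at h2
      exact tendsto_nhds_unique tendsto_const_nhds h2
    refine hτ.faithful _ ?_
    have h3 : Commute (1 - z) e := (Commute.one_left _).sub_left (hzc' _)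
    rw [star_mul, hes, h1z.isSelfAdjoint.star_eq, mul_assoc, ← mul_assoc e, hee, ← h3.eq,
      ← mul_assoc, h1z.isIdempotentElem.eq, h3.eq, h1]
  have hθv : θ v = 0 := by
    have h1 := hz0 _ hcθ
    rw [mul_sub, mul_one, sub_eq_zero] at hez
    rw [← heθ, hez, mul_assoc, h1, mul_zero]
  -- θ(v) = vE(v*v), so its vanishing gives E(v*v)² = 0.
  refine hv (hE.eq_zero_of_map_star_mul ((CStarRing.star_mul_self_eq_zero_iff _).1 ?_))
  rw [← hE.map_star, star_mul, star_star, ← hE.map_mul_right (hE.mem _), mul_assoc, ← hθ, hθv, mul_zero,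
    map_zero]

end

/-! ### Von Neumann algebras as tracial C*-algebras. -/

section

variable {H : Type*} [NormedAddCommGroup H] [InnerProductSpace ℂ H] [CompleteSpace H]

theorem isClosed_toStarSubalgebra (M : VonNeumannAlgebra H) :
    IsClosed (M.toStarSubalgebra : Set (H →L[ℂ] H)) := by
  rw [VonNeumannAlgebra.coe_toStarSubalgebra, ← M.centralizer_centralizer]
  exact Set.isClosed_centralizer _

noncomputable scoped instance (M : VonNeumannAlgebra H) : CStarAlgebra M.toStarSubalgebra :=
  have := isClosed_toStarSubalgebra M
  StarSubalgebra.cstarAlgebra _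

/-- The spectrum does not depend on whether it is taken in M or in B(H), so the square root can be
taken inside M. This matches the operator order with the C*-order of M. -/
theorem exists_eq_star_mul_self_of_isPositive {M : VonNeumannAlgebra H} {a : M.toStarSubalgebra}
    (h : (a : H →L[ℂ] H).IsPositive) : ∃ b, a = star b * b := by
  have hsa : IsSelfAdjoint a := Subtype.ext h.isSelfAdjoint
  have hsp : SpectrumRestricts a ContinuousMap.realToNNReal := by
    rw [SpectrumRestricts.nnreal_iff]
    intro x hx
    have := isClosed_toStarSubalgebra M
    rw [← spectrum.algebraMap_mem_iff ℂ, StarSubalgebra.spectrum_eq (S := M.toStarSubalgebra),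
      spectrum.algebraMap_mem_iff ℂ] at hx
    rw [← ContinuousLinearMap.nonneg_iff_isPositive] at h
    exact spectrum_nonneg_of_nonneg h hx
  obtain ⟨b, hb, -, hba⟩ := CFC.exists_sqrt_of_isSelfAdjoint_of_quasispectrumRestricts hsa hsp
  exact ⟨b, by rw [hb.star_eq, ← hba]⟩

scoped instance (M : VonNeumannAlgebra H) : StarOrderedRing M.toStarSubalgebra :=
  .of_nonneg_iff' (fun {x y} h z => by
      change (z : H →L[ℂ] H) + x ≤ z + y
      exact add_le_add_right h _) fun x => by
    refine ⟨fun h => exists_eq_star_mul_self_of_isPositive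
      (ContinuousLinearMap.nonneg_iff_isPositive _ |>.1 h), ?_⟩
    rintro ⟨b, rfl⟩
    exact star_mul_self_nonneg (b : H →L[ℂ] H)

theorem isPositive_coe_iff {M : VonNeumannAlgebra H} {a : M.toStarSubalgebra} :
    (a : H →L[ℂ] H).IsPositive ↔ 0 ≤ a :=
  (ContinuousLinearMap.nonneg_iff_isPositive _).symm

/-- Bounded sequences of operators have weak limits along the hyperfilter. -/
theorem exists_weak_limit (T : ℕ → H →L[ℂ] H) {C : ℝ} (hT : ∀ n, ‖T n‖ ≤ C) :
    ∃ S : H →L[ℂ] H, ‖S‖ ≤ C ∧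
      ∀ v w, Tendsto (fun n => ⟪T n v, w⟫_ℂ) (hyperfilter ℕ : Filter ℕ) (𝓝 ⟪S v, w⟫_ℂ) := by
  have hC : 0 ≤ C := (norm_nonneg _).trans (hT 0)
  have hbd : ∀ v w n, ‖⟪T n v, w⟫_ℂ‖ ≤ C * ‖v‖ * ‖w‖ := fun v w n =>
    (norm_inner_le_norm _ _).trans (by gcongr; exact (T n).le_of_opNorm_le (hT n) v)
  have hex : ∀ v w, ∃ z, ‖z‖ ≤ C * ‖v‖ * ‖w‖ ∧
      Tendsto (fun n => ⟪T n v, w⟫_ℂ) (hyperfilter ℕ : Filter ℕ) (𝓝 z) := fun v w => by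
    obtain ⟨z, hz, h⟩ := (isCompact_closedBall (0 : ℂ) (C * ‖v‖ * ‖w‖)).ultrafilter_le_nhds
      ((hyperfilter ℕ).map fun n => ⟪T n v, w⟫_ℂ) (by
        refine le_principal_iff.2 (Filter.mem_map.2 (Filter.univ_mem' fun n => ?_))
        exact mem_closedBall_zero_iff.2 (hbd v w n))
    exact ⟨z, mem_closedBall_zero_iff.1 hz, h⟩
  choose B hB hlim using hex
  let B' : H →ₗ⋆[ℂ] H →ₗ[ℂ] ℂ := LinearMap.mk₂'ₛₗ (starRingEnd ℂ) (RingHom.id ℂ) B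
    (fun v v' w => tendsto_nhds_unique (hlim _ _)
      (by simpa only [map_add, inner_add_left] using (hlim v w).add (hlim v' w)))
    (fun c v w => tendsto_nhds_unique (hlim _ _)
      (by simpa only [map_smul, inner_smul_left, smul_eq_mul] using (hlim v w).const_mul (starRingEnd ℂ c)))
    (fun v w w' => tendsto_nhds_unique (hlim _ _)
      (by simpa only [inner_add_right] using (hlim v w).add (hlim v w')))
    (fun c v w => tendsto_nhds_unique (hlim _ _)
      (by simpa only [inner_smul_right, smul_eq_mul, RingHom.id_apply] using (hlim v w).const_mul c))
  let S := InnerProductSpace.continuousLinearMapOfBilin (B'.mkContinuous₂ C hB)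
  have hS : ∀ v w, ⟪S v, w⟫_ℂ = B v w := fun v w =>
    InnerProductSpace.continuousLinearMapOfBilin_apply _ v w
  refine ⟨S, S.opNorm_le_bound hC fun v => ?_, fun v w => by rw [hS]; exact hlim v w⟩
  rcases eq_or_ne (S v) 0 with h0 | h0
  · rw [h0, norm_zero]; positivity
  have h1 : ‖S v‖ * ‖S v‖ ≤ C * ‖v‖ * ‖S v‖ := by
    have := hB v (S v)
    rwa [← hS, inner_self_eq_norm_sq_to_K, norm_pow, RCLike.norm_ofReal, abs_norm, sq] at this
  exact le_of_mul_le_mul_right h1 (norm_pos_iff.2 h0)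

/-- The subalgebra `N ⊆ M`, as a *-subalgebra of `M`. -/
noncomputable def subalgebraOf (M N : VonNeumannAlgebra H) : StarSubalgebra ℂ M.toStarSubalgebra :=
  N.toStarSubalgebra.comap M.toStarSubalgebra.subtype

/-- A bounded sequence has a weak operator limit, which stays in N = N''. Normality enters here: τ(·
z) is a series of matrix coefficients dominated by a summable one, so it passes to the limit. -/
theorem IsTrace.weakCompact {M N : VonNeumannAlgebra H} (hNM : N ≤ M)
    {τ : M.toStarSubalgebra →ₗ[ℂ] ℂ} (hτ : IsTrace M τ) : WeakCompact τ (subalg M N) := by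
  intro x C hx hC
  obtain ⟨S, hSC, hS⟩ := exists_weak_limit (fun n => (x n : H →L[ℂ] H)) hC
  have hS' : ∀ v w, Tendsto (fun n => ⟪v, (x n : H →L[ℂ] H) w⟫_ℂ) (hyperfilter ℕ : Filter ℕ)
      (𝓝 ⟪v, S w⟫_ℂ) := fun v w => by
    have := (Complex.continuous_conj.tendsto _).comp (hS w v)
    simpa only [Function.comp_def, inner_conj_symm] using this
  have hSN : S ∈ N := by
    rw [← N.commutant_commutant, VonNeumannAlgebra.mem_commutant_iff]
    intro y hy
    rw [VonNeumannAlgebra.mem_commutant_iff] at hy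
    refine ContinuousLinearMap.ext fun w => ext_inner_left ℂ fun v => ?_
    refine tendsto_nhds_unique ?_ (hS' v (y w))
    have h1 := hS' (ContinuousLinearMap.adjoint y v) w
    simp only [ContinuousLinearMap.adjoint_inner_left] at h1
    refine h1.congr fun n => ?_
    exact congrArg (fun f : H →L[ℂ] H => ⟪v, f w⟫_ℂ) (hy _ (hx n)).symm
  refine ⟨⟨S, hNM hSN⟩, hSN, hSC, fun z => ?_⟩
  obtain ⟨ξ, η, hξ, hη, hsum⟩ := hτ.normal
  have h1 : ∀ a : M.toStarSubalgebra, τ (a * z) =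
      ∑' k, ⟪η k, (a : H →L[ℂ] H) ((z : H →L[ℂ] H) (ξ k))⟫_ℂ := fun a => (hsum (a * z)).tsum_eq.symm
  simp only [h1]
  refine tendsto_tsum_of_dominated_convergence
    (bound := fun k => C * ‖(z : H →L[ℂ] H)‖ * (‖ξ k‖ ^ 2 + ‖η k‖ ^ 2)) ((hξ.add hη).mul_left _)
    (fun k => hS' _ _) (Eventually.of_forall fun n k => ?_)
  have hC0 : 0 ≤ C := (norm_nonneg _).trans (hC n)
  have h2 : ‖(x n : H →L[ℂ] H) ((z : H →L[ℂ] H) (ξ k))‖ ≤ C * (‖(z : H →L[ℂ] H)‖ * ‖ξ k‖) := by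
    refine ((x n : H →L[ℂ] H).le_of_opNorm_le (hC n) _).trans ?_
    gcongr
    exact ContinuousLinearMap.le_opNorm _ _
  calc _ ≤ ‖η k‖ * (C * (‖(z : H →L[ℂ] H)‖ * ‖ξ k‖)) := (norm_inner_le_norm _ _).trans (by gcongr)
    _ = C * ‖(z : H →L[ℂ] H)‖ * (‖η k‖ * ‖ξ k‖) := by ring
    _ ≤ _ := by
      gcongr
      nlinarith [sq_nonneg (‖η k‖ - ‖ξ k‖), sq_nonneg ‖η k‖, sq_nonneg ‖ξ k‖]

theorem IsTrace.isWStarTrace {M : VonNeumannAlgebra H} {τ : M.toStarSubalgebra →ₗ[ℂ] ℂ}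
    (hτ : IsTrace M τ) : IsWStarTrace τ where
  map_one := hτ.map_one
  nonneg := hτ.nonneg
  tracial := hτ.tracial
  faithful := hτ.faithful
  compact := by
    have h : subalg M M = Set.univ := Set.eq_univ_of_forall fun x => x.2
    rw [← h]
    exact hτ.weakCompact le_rfl

theorem IsExpectation.condExp_subalg {M N : VonNeumannAlgebra H} {τ : M.toStarSubalgebra →ₗ[ℂ] ℂ}
    (hτ : IsTrace M τ) {E : M.toStarSubalgebra →ₗ[ℂ] M.toStarSubalgebra}
    (hE : IsExpectation τ (subalgebraOf M N) E) (x : M.toStarSubalgebra) :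
    condExp τ (subalg M N) x = E x :=
  IsCondExp.condExp_eq hτ (fun _ ha _ hb => sub_mem (H := subalgebraOf M N) ha hb) (fun _ ha => star_mem (s := subalgebraOf M N) ha)
    ⟨hE.mem x, fun z hz => hE.map_mul x z hz⟩

/-- For z in N one has τ(yp·zp) = τ(yE(p)z) = τ(E(x)z) = τ(x·zp). The normalisation of the trace on
pMp plays no role in the defining identity. -/
theorem IsExpectation.condExp_induced {M N : VonNeumannAlgebra H} {τ : M.toStarSubalgebra →ₗ[ℂ] ℂ}
    (hτ : IsTrace M τ) {E : M.toStarSubalgebra →ₗ[ℂ] M.toStarSubalgebra}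
    (hE : IsExpectation τ (subalgebraOf M N) E) {p x y : M.toStarSubalgebra}
    (hp : IsStarProjection p) (hpN : ∀ b ∈ subalgebraOf M N, Commute b p) (hx : p * x = x)
    (hyN : y ∈ subalgebraOf M N) (hy : y * E p = E x) :
    condExp τ (induced M N p) x = y * p := by
  refine IsCondExp.condExp_eq hτ ?_ ?_ ⟨⟨y, hyN, rfl⟩, ?_⟩
  · rintro _ ⟨a, ha, rfl⟩ _ ⟨b, hb, rfl⟩
    exact ⟨a - b, sub_mem (H := subalgebraOf M N) ha hb,
      (sub_mul a b p).symm⟩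
  · rintro _ ⟨a, ha, rfl⟩
    have hsa : star a ∈ subalgebraOf M N := star_mem (s := subalgebraOf M N) ha
    exact ⟨star a, hsa, by rw [star_mul, hp.isSelfAdjoint.star_eq, (hpN _ hsa).eq]⟩
  · rintro _ ⟨z, hz, rfl⟩
    have hz' : z ∈ subalgebraOf M N := hz
    have h1 : y * p * (z * p) = y * z * p := by
      rw [mul_assoc y, ← mul_assoc p, ← (hpN z hz').eq, mul_assoc z, hp.isIdempotentElem.eq, mul_assoc]
    have h2 : τ (y * z * p) = τ (y * E p * z) := by
      rw [← hE.map_mul' p (mul_mem hyN hz'), mul_assoc, mul_assoc,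
        (hE.map_comm hpN z hz').eq]
    rw [h1, h2, hy, hE.map_mul x z hz', ← mul_assoc, hτ.tracial (x * z), ← mul_assoc, hx]

end

/-! ### Translation of corner embeddings and of the index. -/

section

variable {H : Type*} [NormedAddCommGroup H] [InnerProductSpace ℂ H] [CompleteSpace H]

theorem isStarProjection_coe_iff {M : VonNeumannAlgebra H} {p : M.toStarSubalgebra} :
    IsStarProjection (p : H →L[ℂ] H) ↔ IsStarProjection p :=
  ⟨fun h => ⟨Subtype.ext h.isIdempotentElem, Subtype.ext h.isSelfAdjoint⟩,
    fun h => ⟨congrArg Subtype.val h.isIdempotentElem, congrArg Subtype.val h.isSelfAdjoint⟩⟩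

/-- Precomposing Ψ with x ↦ pxp makes it a map on all of M, as the abstract part requires. The
injectivity clause is used only at x = p, where it gives v ≠ 0. -/
theorem CornerEmbeds.exists_intertwiner {M N : VonNeumannAlgebra H} (hNM : N ≤ M)
    (h : CornerEmbeds M M N) :
    ∃ (e v : M.toStarSubalgebra) (Ψ : M.toStarSubalgebra → M.toStarSubalgebra),
      IsStarProjection e ∧ v ≠ 0 ∧ e * v = v ∧ (∀ x, Ψ x ∈ subalgebraOf M N) ∧
      (∀ x, Ψ (star x) = star (Ψ x)) ∧ ∀ x, e * x = x → x * e = x → x * v = v * Ψ x := by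
  obtain ⟨p, q, hp, hq, hpM, hqN, hp0, -, Ψ, v, -, hvM, hv, ⟨hvv, -⟩, -, hxv, hinj⟩ := h
  let e : M.toStarSubalgebra := ⟨p, hpM⟩
  have he : IsStarProjection e := isStarProjection_coe_iff.1 hp
  let cut : M.toStarSubalgebra → corner M hp := fun x => ⟨p * x * p,
    mul_mem (mul_mem hpM x.2) hpM, by rw [← mul_assoc, ← mul_assoc, hp.isIdempotentElem.eq],
    by rw [mul_assoc, hp.isIdempotentElem.eq]⟩
  have hcut : ∀ x : M.toStarSubalgebra, e * x = x → x * e = x → (cut x : H →L[ℂ] H) = x :=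
    fun x h1 h2 => by
      have h3 : p * (x : H →L[ℂ] H) = x := congrArg Subtype.val h1
      have h4 : (x : H →L[ℂ] H) * p = x := congrArg Subtype.val h2
      change p * (x : H →L[ℂ] H) * p = x
      rw [h3, h4]
  refine ⟨e, ⟨v, hvM⟩, fun x => ⟨Ψ (cut x), hNM (Ψ (cut x)).2.1⟩, he, fun h0 => hp0 ?_, ?_,
    fun x => (Ψ (cut x)).2.1, fun x => Subtype.ext ?_, fun x h1 h2 => Subtype.ext ?_⟩
  · have h1 : v = 0 := congrArg Subtype.val h0
    exact congrArg Subtype.val (hinj ⟨p, self_mem_corner M hp hpM⟩ (by rw [h1, mul_zero]))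
  · refine Subtype.ext ?_
    change p * v = v
    rw [← hv, ← mul_assoc, hvv.2.1]
  · have h1 : cut (star x) = star (cut x) := Subtype.ext (by
      change p * star (x : H →L[ℂ] H) * p = star (p * (x : H →L[ℂ] H) * p)
      rw [star_mul, star_mul, hp.isSelfAdjoint.star_eq, mul_assoc])
    change (Ψ (cut (star x)) : H →L[ℂ] H) = star (Ψ (cut x) : H →L[ℂ] H)
    rw [h1, map_star]
    rfl
  · have := hxv (cut x)
    rw [hcut x h1 h2] at this
    exact this

/-- The projection in N is q = Ψ(e). The injectivity clause comes from vv* = e, since xv = 0 gives x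
= xvv* = 0. -/
theorem cornerEmbeds_of_intertwiner {M N : VonNeumannAlgebra H} {e v : M.toStarSubalgebra}
    {Ψ : M.toStarSubalgebra →ₗ[ℂ] M.toStarSubalgebra} (he : IsStarProjection e) (he0 : e ≠ 0)
    (hv : v * star v = e) (hΨN : ∀ x, Ψ x ∈ subalgebraOf M N) (hΨs : ∀ x, Ψ (star x) = star (Ψ x))
    (hΨm : ∀ x y, e * x = x → x * e = x → e * y = y → y * e = y → Ψ (x * y) = Ψ x * Ψ y)
    (hΨ : ∀ x, e * x = x → x * e = x → x * v = v * Ψ x) : CornerEmbeds M M N := by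
  have hee := he.isIdempotentElem.eq
  have hes := he.isSelfAdjoint.star_eq
  have hev : e * v = v := by
    have h1 : (1 - e) * v = 0 := by
      refine (CStarRing.mul_star_self_eq_zero_iff _).1 ?_
      rw [star_mul, mul_assoc, ← mul_assoc v, hv, ← mul_assoc, sub_mul, one_mul, hee, sub_self, zero_mul]
    rw [sub_mul, one_mul, sub_eq_zero] at h1
    exact h1.symm
  let q := Ψ e
  have hq : IsStarProjection q :=
    ⟨(hΨm e e hee hee hee hee).symm.trans (by rw [hee]), by rw [IsSelfAdjoint, ← hΨs, hes]⟩
  have hvq : v * q = v := by rw [← hΨ e hee hee, hev]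
  have hqv : q * star v = star v := by
    have := congrArg star hvq
    rwa [star_mul, hq.isSelfAdjoint.star_eq] at this
  have hqΨ : ∀ x, e * x = x → x * e = x → q * Ψ x = Ψ x ∧ Ψ x * q = Ψ x := fun x h1 h2 =>
    ⟨by rw [← hΨm e x hee hee h1 h2, h1], by rw [← hΨm x e h1 h2 hee hee, h2]⟩
  have hv0 : v ≠ 0 := fun h => he0 (by rw [← hv, h, zero_mul])
  have hq0 : q ≠ 0 := fun h => hv0 (by rw [← hvq, h, mul_zero])
  have hxΨ : ∀ x, e * x = x → x * e = x → Commute (star v * v) (Ψ x) := fun x h1 h2 => by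
    have h3 := hΨ (star x) (by rw [← hes, ← star_mul, h2]) (by rw [← hes, ← star_mul, h1])
    have h4 : star v * x = Ψ x * star v := by
      have := congrArg star h3
      rwa [star_mul, star_star, star_mul, hΨs, star_star] at this
    rw [commute_iff_eq, mul_assoc, ← hΨ x h1 h2, ← mul_assoc, h4, mul_assoc]
  have hp' : IsStarProjection (e : H →L[ℂ] H) := isStarProjection_coe_iff.2 he
  have hq' : IsStarProjection (q : H →L[ℂ] H) := isStarProjection_coe_iff.2 hq
  let ι : corner M hp' → M.toStarSubalgebra := fun x => ⟨x, x.2.1⟩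
  have hι : ∀ x, e * ι x = ι x ∧ ι x * e = ι x := fun x =>
    ⟨Subtype.ext x.2.2.1, Subtype.ext x.2.2.2⟩
  have hval : ∀ {a b : M.toStarSubalgebra}, a = b → (a : H →L[ℂ] H) = b := fun h => by rw [h]
  let Φ : corner M hp' →⋆ₙₐ[ℂ] corner N hq' :=
    { toFun := fun x => ⟨Ψ (ι x), hΨN _, hval (hqΨ _ (hι x).1 (hι x).2).1,
        hval (hqΨ _ (hι x).1 (hι x).2).2⟩
      map_smul' := fun c x => Subtype.ext (hval (map_smul Ψ c (ι x)))
      map_zero' := Subtype.ext (hval (map_zero Ψ))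
      map_add' := fun x y => Subtype.ext (hval (map_add Ψ (ι x) (ι y)))
      map_mul' := fun x y => Subtype.ext (hval
        (hΨm (ι x) (ι y) (hι x).1 (hι x).2 (hι y).1 (hι y).2))
      map_star' := fun x => Subtype.ext (hval (hΨs (ι x))) }
  have hΦ : ∀ x, (Φ x : H →L[ℂ] H) = Ψ (ι x) := fun x => rfl
  refine ⟨e, q, hp', hq', e.2, hΨN e, fun h => he0 (Subtype.ext h), fun h => hq0 (Subtype.ext h), Φ, v,
    rfl, v.2, hval (show v * star v * v = v by rw [hv, hev]), ⟨?_, fun x => ?_⟩,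
    ⟨⟨(star v * v).2, ?_, ?_⟩, fun x => hval (hxΨ (ι x) (hι x).1 (hι x).2)⟩,
    fun x => hval (hΨ (ι x) (hι x).1 (hι x).2), fun x hx => ?_⟩
  · have h1 : (v : H →L[ℂ] H) * star (v : H →L[ℂ] H) = e := hval hv
    rw [h1]
    exact self_mem_corner M hp' e.2
  · have h1 : (v : H →L[ℂ] H) * star (v : H →L[ℂ] H) = e := hval hv
    rw [h1]
    exact x.2.2.1.trans x.2.2.2.symm
  · exact hval (show q * (star v * v) = star v * v by rw [← mul_assoc, hqv])
  · exact hval (show star v * v * q = star v * v by rw [mul_assoc, hvq])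
  · have h1 : ι x * v = 0 := Subtype.ext hx
    have h2 : ι x = 0 := by rw [← (hι x).2, ← hv, ← mul_assoc, h1, zero_mul]
    exact Subtype.ext (hval h2)

theorem mem_commutant_iff_forall_commute {M N : VonNeumannAlgebra H} (hNM : N ≤ M)
    {p : M.toStarSubalgebra} :
    (p : H →L[ℂ] H) ∈ N.commutant ↔ ∀ b ∈ subalgebraOf M N, Commute b p := by
  rw [VonNeumannAlgebra.mem_commutant_iff]
  exact ⟨fun h b hb => Subtype.ext (h b hb), fun h b hb => congrArg Subtype.val (h ⟨b, hNM hb⟩ hb)⟩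

theorem mem_reduced_iff {M : VonNeumannAlgebra H} {p x : M.toStarSubalgebra}
    (hp : IsStarProjection p) : x ∈ reduced M p ↔ p * x = x ∧ x * p = x := by
  constructor
  · rintro ⟨y, rfl⟩
    exact ⟨by rw [← mul_assoc, ← mul_assoc, hp.isIdempotentElem.eq],
      by rw [mul_assoc, hp.isIdempotentElem.eq]⟩
  · rintro ⟨h1, h2⟩
    exact ⟨x, by rw [h1, h2]⟩

/-- From left to right the same p has finite index; in the other direction p may have to shrink, as
in `exists_finiteIndex_of_smul_le`. -/
theorem IsExpectation.exists_finiteIndex_iff {M N : VonNeumannAlgebra H} (hNM : N ≤ M)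
    {τ : M.toStarSubalgebra →ₗ[ℂ] ℂ} (hτ : IsTrace M τ)
    {E : M.toStarSubalgebra →ₗ[ℂ] M.toStarSubalgebra}
    (hE : IsExpectation τ (subalgebraOf M N) E) :
    (∃ (p : M.toStarSubalgebra) (K : ℝ), IsStarProjection p ∧ p ≠ 0 ∧
      (∀ b ∈ subalgebraOf M N, Commute b p) ∧
      ∀ a, a * p = a → star a * a ≤ (K : ℂ) • E (star a * a)) ↔
    ¬ ∀ p : M.toStarSubalgebra, IsStarProjection p → p ≠ 0 → (p : H →L[ℂ] H) ∈ N.commutant →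
      ppIndex τ (reduced M p) (induced M N p) = ⊤ := by
  have hind : ∀ {p x y : M.toStarSubalgebra} {c : ℝ≥0}, IsStarProjection p →
      (∀ b ∈ subalgebraOf M N, Commute b p) → p * x = x → y ∈ subalgebraOf M N → y * E p = E x →
      (((condExp τ (induced M N p) x : H →L[ℂ] H) -
        ((c : ℝ) : ℂ) • (x : H →L[ℂ] H)).IsPositive ↔ ((c : ℝ) : ℂ) • x ≤ y * p) :=
    fun hp hpN h1 hyN hy => by
      rw [hE.condExp_induced hτ hp hpN h1 hyN hy, ← sub_nonneg, ← isPositive_coe_iff]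
      rfl
  push Not
  constructor
  · rintro ⟨p, K, hp, hp0, hpN, hpK⟩
    refine ⟨p, hp, hp0, (mem_commutant_iff_forall_commute hNM).2 hpN, ?_⟩
    -- K carries no sign condition; enlarging it to at least 1 makes its inverse a legitimate
    -- positive constant.
    have hK : ∀ a, a * p = a → star a * a ≤ ((max K 1 : ℝ) : ℂ) • E (star a * a) := fun a ha => by
      refine (hpK a ha).trans ?_
      rw [Complex.coe_smul, Complex.coe_smul]
      exact smul_le_smul_of_nonneg_right (le_max_left K 1) (hE.map_nonneg (star_mul_self_nonneg a))
    have hKpos : 0 < max K 1 := lt_max_of_lt_right one_pos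
    let c : ℝ≥0 := ⟨(max K 1)⁻¹, (inv_pos.2 hKpos).le⟩
    have hc : (c : ℝ≥0∞) ≤ ppConst τ (reduced M p) (induced M N p) := by
      refine le_sSup ⟨c, rfl, fun x hx hxp => ?_⟩
      have hx0 := isPositive_coe_iff.1 hxp
      obtain ⟨h1, h2⟩ := (mem_reduced_iff hp).1 hx
      obtain ⟨y, hyN, hy0, hy⟩ := hE.exists_cornerExpectation hp hpN hx0 h2
      exact (hind hp hpN h1 hyN hy).2
        (hE.smul_le_of_finiteIndex hp hpN hKpos hK hx0 h2 hyN hy0 hy)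
    have hc0 : c ≠ 0 := fun h => (inv_pos.2 hKpos).ne' (congrArg NNReal.toReal h)
    rw [ppIndex, Ne, ENNReal.inv_eq_top]
    exact fun h => hc0 (ENNReal.coe_eq_zero.1 (le_zero_iff.1 (h ▸ hc)))
  · rintro ⟨p, hp, hp0, hpN', hidx⟩
    have hpN := (mem_commutant_iff_forall_commute hNM).1 hpN'
    rw [ppIndex, Ne, ENNReal.inv_eq_top, ppConst] at hidx
    obtain ⟨_, ⟨c, rfl, hc⟩, hc0⟩ : ∃ l ∈ {l | ∃ c : ℝ≥0, l = (c : ℝ≥0∞) ∧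
        ∀ x ∈ reduced M p, (x : H →L[ℂ] H).IsPositive →
          ((condExp τ (induced M N p) x : H →L[ℂ] H) - ((c : ℝ) : ℂ) • (x : H →L[ℂ] H)).IsPositive},
        l ≠ 0 := by
      by_contra! h
      exact hidx (le_zero_iff.1 (sSup_le fun l hl => (h l hl).le))
    have hc0' : 0 < (c : ℝ) := NNReal.coe_pos.2 (pos_iff_ne_zero.2 (ENNReal.coe_ne_zero.1 hc0))
    refine hE.exists_finiteIndex_of_smul_le hp hp0 hpN hc0' fun x y hx hxp hyN _ hy => ?_
    have hpx : p * x = x := by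
      have := congrArg star hxp
      rwa [star_mul, hp.isSelfAdjoint.star_eq, (IsSelfAdjoint.of_nonneg hx).star_eq] at this
    exact (hind hp hpN hpx hyN hy).1
      (hc x ((mem_reduced_iff hp).2 ⟨hpx, hxp⟩) (isPositive_coe_iff.2 hx))

end

end FiniteVN


/-! ### The equivalence, assembled as the cycle 3 → 1 → 2 → 3. -/

theorem mainTheorem4 {H : Type*} [NormedAddCommGroup H] [InnerProductSpace ℂ H] [CompleteSpace H]
    (M N : VonNeumannAlgebra H) (hNM : N ≤ M)
    (τ : M.toStarSubalgebra →ₗ[ℂ] ℂ) (hτ : FiniteVN.IsTrace M τ)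
    (hdiff : FiniteVN.IsDiffuse M) (hamen : FiniteVN.IsAmenable M τ) :
    List.TFAE
      [¬ FiniteVN.CornerEmbeds M M N,
        ∀ p : M.toStarSubalgebra, IsStarProjection p → p ≠ 0 →
          (p : H →L[ℂ] H) ∈ N.commutant →
          FiniteVN.ppIndex τ (FiniteVN.reduced M p) (FiniteVN.induced M N p) = ⊤,
        ∃ u : ℕ → M.toStarSubalgebra, (∀ n, u n ∈ unitary M.toStarSubalgebra) ∧
          ∀ x : M.toStarSubalgebra,
            Tendsto (fun n => FiniteVN.norm2 τ
              (FiniteVN.condExp τ (FiniteVN.subalg M N) (u n * x))) atTop (𝓝 0)] := by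
  open FiniteVN in
  have hτ' := hτ.isWStarTrace
  obtain ⟨E, hE⟩ :=
    exists_isExpectation hτ' (N := subalgebraOf M N) (hτ.weakCompact hNM)
  have hnorm : ∀ x, norm2 τ (condExp τ (subalg M N) x) = l2norm τ (E x) := fun x => by
    rw [hE.condExp_subalg hτ]; rfl
  simp only [hnorm]
  tfae_have 3 → 1 := by
    rintro ⟨u, hu, hlim⟩ h
    obtain ⟨e, v, Ψ, he, hv, hev, hΨN, hΨs, hΨ⟩ := h.exists_intertwiner hNM
    exact hE.not_tendsto_of_intertwiner he hv hev hΨN hΨs hΨ hu hlim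
  tfae_have 1 → 2 := by
    intro h
    by_contra h2
    obtain ⟨p, K, hp, hp0, hpN, hpK⟩ := (hE.exists_finiteIndex_iff hNM hτ).2 h2
    obtain ⟨e, v, Ψ, he, he0, hv, hΨN, hΨs, hΨm, hΨ⟩ := hE.exists_intertwiner hp hp0 hpN hpK
    exact h (cornerEmbeds_of_intertwiner he he0 hv hΨN hΨs hΨm hΨ)
  tfae_have 2 → 3 := by
    intro h
    refine hE.exists_seq fun s ε hε => ?_
    by_contra! hF
    exact (hE.exists_finiteIndex_iff hNM hτ).1 (hE.exists_finiteIndex hε hF) h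
  tfae_finish
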